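/- Fix an integer $n\ge 1$, vectors $\vec\beta_p,\vec h\in\mathbb R^n$ ($p\ge 2$) with $\vec\beta_p=0$ for odd $p$ and $\sum_{p\ge2}2^p\vec\beta_p(j)^2<\infty$ for every $j\le n$, and a symmetric positive definite $n\times n$ matrix $Q$ with all diagonal entries equal to $1$. Write $\langle A,B\rangle=\operatorname{tr}(AB)$, $|A|=\det A$, and $$\xi'(A)=\sum_{p\ge 2}p\,(\vec\beta_p\vec\beta_p^{\mathsf T})\odot A^{\circ(p-1)},$$ with entrywise (Hadamard) product $\odot$ and powers $\circ$. Consider pairs $(x,\Phi)$, where $x:[0,n]\to[0,1]$ is the cumulative distribution function of a probability measure on $[0,n]$, that is, a right-continuous non-decreasing function with the convention $x(0-)=0$ and with $x(n)=1$, and where $\Phi$ is a path of positive semidefinite $n\times n$ matrices on $[0,n]$, with entries $1$-Lipschitz in $t$, with positive semidefinite increments $\Phi(t)-\Phi(s)$ for $s\le t$, and with $\operatorname{tr}\Phi(t)=t$, $\Phi(0)=0$, $\Phi(n)=Q$. The space of such pairs carries the distance $$\int_0^n|x_1(t)-x_2(t)|\,dt+\max_{i,j\le n}\ \sup_{t\in[0,n]}|\Phi_1^{i,j}(t)-\Phi_2^{i,j}(t)|.$$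 Let $t_x=\inf\{t\in[0,n] : x(t)\ge 1\}$ and $\hat\Phi(t)=\int_t^n x(s)\Phi'(s)\,ds$. On the domain of all pairs with $|Q-\Phi(t_x)|>0$, the Crisanti--Sommers functional is $$\mathscr C(x,\Phi)=\frac12\Big(\int_0^n x(t)\langle\xi'(\Phi(t))+\vec h\vec h^{\mathsf T},\Phi'(t)\rangle\,dt+\log|\Phi(n)-\Phi(t_x)|+\int_0^{t_x}\langle\hat\Phi(t)^{-1},\Phi'(t)\rangle\,dt\Big).$$ Put $E=\langle \vec h\vec h^{\mathsf T}+\xi'(Q),Q\rangle+n-\log|Q|$ and $$T=n-\frac1{\sqrt n}e^{-E},\qquad L=\sqrt n\,e^{E},$$ and, with $\|M\|_\infty=\max_{i,j}|M_{ij}|$, let $A_{T,L}$ be the set of all $(x,\Phi)$ in the domain such that $x(t)=1$ for all $t\in[0,n]$ with $t\ge T$ and $\|(Q-\Phi(t_x))^{-1}\|_\infty\le L$. Then $A_{T,L}$ is compact, and $\mathscr C$ attains its minimum over its whole domain at a point of $A_{T,L}$. This point can be chosen so that, moreover, the maximum absolute row sum of $(Q-\Phi(t_x))^{-1}$ is at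 most $L$. -/

import Mathlib

open MeasureTheory Matrix

noncomputable section

/-- A cumulative distribution function of a probability measure on `[0, n]`: a right-continuous
non-decreasing `x : [0, n] → [0, 1]` with `x (n) = 1`, extended to the line by its values `0` to the
left of `0` (so that `x (0-) = 0`; an atom at `0` is allowed) and `1` to the right of `n`. -/
structure OverlapCDF (n : ℕ) where
  toFun : ℝ → ℝ
  monotone : Monotone toFun
  right_continuous : ∀ t, ContinuousWithinAt toFun (Set.Ici t) t
  eq_zero : ∀ t, t < 0 → toFun t = 0
  eq_one : ∀ t, (n : ℝ) ≤ t → toFun t = 1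

/-- A monotone path of positive semidefinite matrices on `[0, n]` from `0` to `Q`, parametrized by
its trace, and extended to the line by its end values. -/
structure MatrixPath {n : ℕ} (Q : Matrix (Fin n) (Fin n) ℝ) where
  toFun : ℝ → Matrix (Fin n) (Fin n) ℝ
  posSemidef : ∀ t ∈ Set.Icc (0 : ℝ) n, (toFun t).PosSemidef
  monotone : ∀ s ∈ Set.Icc (0 : ℝ) n, ∀ t ∈ Set.Icc (0 : ℝ) n, s ≤ t →
    (toFun t - toFun s).PosSemidef
  lipschitz : ∀ s ∈ Set.Icc (0 : ℝ) n, ∀ t ∈ Set.Icc (0 : ℝ) n, ∀ i j,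
    |toFun t i j - toFun s i j| ≤ |t - s|
  trace_eq : ∀ t ∈ Set.Icc (0 : ℝ) n, (toFun t).trace = t
  eq_start : ∀ t, t ≤ 0 → toFun t = 0
  eq_end : ∀ t, (n : ℝ) ≤ t → toFun t = Q

/-- The pairs `(x, Φ)` of functional order parameters. -/
structure OrderParam {n : ℕ} (Q : Matrix (Fin n) (Fin n) ℝ) where
  x : OverlapCDF n
  Φ : MatrixPath Q

namespace OrderParam

variable {n : ℕ} {Q : Matrix (Fin n) (Fin n) ℝ}

/-- `‖x₁ - x₂‖₁`, the `L¹` distance on `[0, n]`. -/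
def distX (p q : OrderParam Q) : ℝ :=
  ∫ t in (0 : ℝ)..n, |p.x.toFun t - q.x.toFun t|

/-- `‖Φ₁ - Φ₂‖_∞`, the supremum over `t ∈ [0, n]` and all entries. -/
def distPath (p q : OrderParam Q) : ℝ :=
  ⨆ k : Set.Icc (0 : ℝ) n × Fin n × Fin n,
    |p.Φ.toFun k.1 k.2.1 k.2.2 - q.Φ.toFun k.1 k.2.1 k.2.2|

theorem intervalIntegrable_x (p q : OrderParam Q) :
    IntervalIntegrable (fun t => |p.x.toFun t - q.x.toFun t|) volume (0 : ℝ) n :=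
  ((p.x.monotone.intervalIntegrable).sub (q.x.monotone.intervalIntegrable)).abs

theorem bddAbove_path (p q : OrderParam Q) :
    BddAbove (Set.range fun k : Set.Icc (0 : ℝ) n × Fin n × Fin n =>
      |p.Φ.toFun k.1 k.2.1 k.2.2 - q.Φ.toFun k.1 k.2.1 k.2.2|) := by
  have key : ∀ (p : OrderParam Q) (t : ℝ), t ∈ Set.Icc (0 : ℝ) n → ∀ i j,
      |p.Φ.toFun t i j| ≤ n := by
    intro p t ht i j
    have h := p.Φ.lipschitz 0 ⟨le_refl _, Nat.cast_nonneg n⟩ t ht i j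
    rw [p.Φ.eq_start 0 le_rfl] at h
    simp only [Matrix.zero_apply, sub_zero, abs_of_nonneg ht.1] at h
    exact h.trans ht.2
  refine ⟨n + n, ?_⟩
  rintro _ ⟨⟨⟨t, ht⟩, i, j⟩, rfl⟩
  exact (abs_sub _ _).trans (add_le_add (key p t ht i j) (key q t ht i j))

/-- The space of order parameters with the distance `‖x₁ - x₂‖₁ + ‖Φ₁ - Φ₂‖_∞`. -/
instance : PseudoMetricSpace (OrderParam Q) where
  dist p q := distX p q + distPath p q
  dist_self p := by simp [distX, distPath]
  dist_comm p q := by simp only [distX, distPath, abs_sub_comm]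
  dist_triangle p q r := by
    have h1 : distX p r ≤ distX p q + distX q r := by
      unfold distX
      rw [← intervalIntegral.integral_add (intervalIntegrable_x p q) (intervalIntegrable_x q r)]
      exact intervalIntegral.integral_mono_on (Nat.cast_nonneg n) (intervalIntegrable_x p r)
        ((intervalIntegrable_x p q).add (intervalIntegrable_x q r))
        (fun t _ => abs_sub_le _ _ _)
    have h2 : distPath p r ≤ distPath p q + distPath q r := by
      unfold distPath
      refine Real.iSup_le (fun k => (abs_sub_le _ (q.Φ.toFun k.1 k.2.1 k.2.2) _).trans
        (add_le_add (le_ciSup (bddAbove_path p q) k) (le_ciSup (bddAbove_path q r) k))) ?_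
      exact add_nonneg (Real.iSup_nonneg fun _ => abs_nonneg _)
        (Real.iSup_nonneg fun _ => abs_nonneg _)
    linarith

/-- `t_x = inf {t ∈ [0, n] | 1 ≤ x t}`. -/
def tx (p : OrderParam Q) : ℝ := sInf {t | t ∈ Set.Icc (0 : ℝ) n ∧ 1 ≤ p.x.toFun t}

/-- The entrywise derivative `Φ'`. -/
def pathDeriv (p : OrderParam Q) (t : ℝ) : Matrix (Fin n) (Fin n) ℝ :=
  Matrix.of fun i j => deriv (fun s => p.Φ.toFun s i j) t

/-- `Φ̂ t = ∫_t^n x(s) Φ'(s) ds`, entrywise. -/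
def pathHat (p : OrderParam Q) (t : ℝ) : Matrix (Fin n) (Fin n) ℝ :=
  Matrix.of fun i j => ∫ s in t..(n : ℝ), p.x.toFun s * p.pathDeriv s i j

end OrderParam

/-- `ξ'(A) = ∑_{p ≥ 2} p (β_p ⊗ β_p) ⊙ A^{∘(p-1)}`; the summation index below is `p - 2`. -/
def xiDeriv {n : ℕ} (β : ℕ → Fin n → ℝ) (A : Matrix (Fin n) (Fin n) ℝ) :
    Matrix (Fin n) (Fin n) ℝ :=
  Matrix.of fun i j => ∑' k : ℕ, ((k : ℝ) + 2) * (β (k + 2) i * β (k + 2) j) * A i j ^ (k + 1)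

/-- The Frobenius product `⟨A, B⟩ = tr (A B)` of symmetric matrices. -/
def frob {n : ℕ} (A B : Matrix (Fin n) (Fin n) ℝ) : ℝ := (A * B).trace

/-- The integral Crisanti–Sommers functional. -/
def crisantiSommers {n : ℕ} (β : ℕ → Fin n → ℝ) (h : Fin n → ℝ) {Q : Matrix (Fin n) (Fin n) ℝ}
    (p : OrderParam Q) : ℝ :=
  (1 / 2) * ((∫ t in (0 : ℝ)..n,
        p.x.toFun t * frob (xiDeriv β (p.Φ.toFun t) + vecMulVec h h) (p.pathDeriv t))
    + Real.log (p.Φ.toFun n - p.Φ.toFun p.tx).det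
    + ∫ t in (0 : ℝ)..p.tx, frob (p.pathHat t)⁻¹ (p.pathDeriv t))

/-- The domain of the Crisanti–Sommers functional. -/
def csDomain {n : ℕ} (Q : Matrix (Fin n) (Fin n) ℝ) : Set (OrderParam Q) :=
  {p | 0 < (Q - p.Φ.toFun p.tx).det}

/-- The largest absolute value of an entry. -/
def maxEntryNorm {n : ℕ} (A : Matrix (Fin n) (Fin n) ℝ) : ℝ := ⨆ k : Fin n × Fin n, |A k.1 k.2|

/-- The largest absolute row sum (the operator norm for the sup norm on vectors). -/
def maxRowSumNorm {n : ℕ} (A : Matrix (Fin n) (Fin n) ℝ) : ℝ := ⨆ i, ∑ j, |A i j|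

/-- `A_{T,L}`: `x t = 1` for `t ≥ T`, the matrix `Q - Φ(t_x)` is invertible, and its inverse has
entries bounded by `L`. -/
def boundedParams {n : ℕ} (Q : Matrix (Fin n) (Fin n) ℝ) (T L : ℝ) : Set (OrderParam Q) :=
  {p | p ∈ csDomain Q ∧ (∀ t ∈ Set.Icc (0 : ℝ) n, T ≤ t → p.x.toFun t = 1) ∧
    maxEntryNorm (Q - p.Φ.toFun p.tx)⁻¹ ≤ L}

/-- The exponent `⟨h hᵀ + ξ'(Q), Q⟩ + n - log |Q|`. -/
def csExponent {n : ℕ} (β : ℕ → Fin n → ℝ) (h : Fin n → ℝ) (Q : Matrix (Fin n) (Fin n) ℝ) : ℝ :=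
  frob (vecMulVec h h + xiDeriv β Q) Q + n - Real.log Q.det

/-- `T = n - n^{-1/2} exp (-E)`, with `E` the exponent above. -/
def csT {n : ℕ} (β : ℕ → Fin n → ℝ) (h : Fin n → ℝ) (Q : Matrix (Fin n) (Fin n) ℝ) : ℝ :=
  n - 1 / Real.sqrt n * Real.exp (-csExponent β h Q)

/-- `L = n^{1/2} exp E`, with `E` the exponent above. -/
def csL {n : ℕ} (β : ℕ → Fin n → ℝ) (h : Fin n → ℝ) (Q : Matrix (Fin n) (Fin n) ℝ) : ℝ :=
  Real.sqrt n * Real.exp (csExponent β h Q)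

end

open Filter Topology

/-! ### Loewner order, trace pairing and concavity of log det -/

section MatrixInequalities

variable {n : ℕ}

open scoped MatrixOrder Matrix.Norms.L2Operator in
theorem Matrix.PosSemidef.exists_conjTranspose_mul_self {A : Matrix (Fin n) (Fin n) ℝ}
    (hA : A.PosSemidef) : ∃ C : Matrix (Fin n) (Fin n) ℝ, A = Cᴴ * C := by
  obtain ⟨C, hC⟩ := CStarAlgebra.nonneg_iff_eq_star_mul_self.mp hA.nonneg
  exact ⟨C, hC⟩

theorem Matrix.PosSemidef.posDef_of_det_pos {A : Matrix (Fin n) (Fin n) ℝ} (hA : A.PosSemidef)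
    (h : 0 < A.det) : A.PosDef :=
  hA.posDef_iff_det_ne_zero.2 h.ne'

theorem Matrix.PosDef.mono {A B : Matrix (Fin n) (Fin n) ℝ} (hA : A.PosDef)
    (h : (B - A).PosSemidef) : B.PosDef := by
  have := hA.add_posSemidef h
  rwa [add_sub_cancel] at this

theorem Matrix.PosDef.mul_inv_self {A : Matrix (Fin n) (Fin n) ℝ} (hA : A.PosDef) :
    A * A⁻¹ = 1 := Matrix.mul_nonsing_inv _ (hA.det_pos.ne'.isUnit)

theorem Matrix.PosDef.inv_mul_self {A : Matrix (Fin n) (Fin n) ℝ} (hA : A.PosDef) :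
    A⁻¹ * A = 1 := Matrix.nonsing_inv_mul _ (hA.det_pos.ne'.isUnit)

theorem Matrix.PosSemidef.symm_conj {A B : Matrix (Fin n) (Fin n) ℝ} (hA : A.PosSemidef)
    (hB : B.IsHermitian) : (B * A * B).PosSemidef := by
  have := hA.mul_mul_conjTranspose_same B
  rwa [hB.eq] at this

theorem frob_nonneg {A B : Matrix (Fin n) (Fin n) ℝ} (hA : A.PosSemidef) (hB : B.PosSemidef) :
    0 ≤ frob A B := by
  obtain ⟨C, rfl⟩ := hA.exists_conjTranspose_mul_self
  unfold frob
  rw [Matrix.mul_assoc, Matrix.trace_mul_comm]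
  exact (hB.mul_mul_conjTranspose_same C).trace_nonneg

theorem frob_eq_sum (A B : Matrix (Fin n) (Fin n) ℝ) :
    frob A B = ∑ i, ∑ j, A i j * B j i := by
  simp [frob, Matrix.trace, Matrix.mul_apply]

theorem frob_add_left (A B C : Matrix (Fin n) (Fin n) ℝ) :
    frob (A + B) C = frob A C + frob B C := by simp [frob, Matrix.add_mul]

theorem frob_sub_left (A B C : Matrix (Fin n) (Fin n) ℝ) :
    frob (A - B) C = frob A C - frob B C := by simp [frob, Matrix.sub_mul]

theorem frob_add_right (A B C : Matrix (Fin n) (Fin n) ℝ) :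
    frob A (B + C) = frob A B + frob A C := by simp [frob, Matrix.mul_add]

theorem frob_sub_right (A B C : Matrix (Fin n) (Fin n) ℝ) :
    frob A (B - C) = frob A B - frob A C := by simp [frob, Matrix.mul_sub]

theorem frob_smul_left (c : ℝ) (A B : Matrix (Fin n) (Fin n) ℝ) :
    frob (c • A) B = c * frob A B := by simp [frob]

theorem frob_smul_right (c : ℝ) (A B : Matrix (Fin n) (Fin n) ℝ) :
    frob A (c • B) = c * frob A B := by simp [frob]

theorem frob_le_frob_left {A B C : Matrix (Fin n) (Fin n) ℝ} (h : (B - A).PosSemidef)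
    (hC : C.PosSemidef) : frob A C ≤ frob B C := by
  have := frob_nonneg h hC
  rw [frob_sub_left] at this
  linarith

theorem frob_le_frob_right {A B C : Matrix (Fin n) (Fin n) ℝ} (h : (B - A).PosSemidef)
    (hC : C.PosSemidef) : frob C A ≤ frob C B := by
  have := frob_nonneg hC h
  rw [frob_sub_right] at this
  linarith

/-- Inversion reverses the Loewner order. -/
theorem Matrix.PosDef.inv_sub_inv_posSemidef {A B : Matrix (Fin n) (Fin n) ℝ} (hA : A.PosDef)
    (h : (B - A).PosSemidef) : (A⁻¹ - B⁻¹).PosSemidef := by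
  have hB := hA.mono h
  have hAs : (A⁻¹).IsHermitian := hA.isHermitian.inv
  have hBs : (B⁻¹).IsHermitian := hB.isHermitian.inv
  -- Both summands are congruences of positive semidefinite matrices, so no square roots are needed.
  have key : A⁻¹ - B⁻¹ = (A⁻¹ - B⁻¹) * A * (A⁻¹ - B⁻¹) + B⁻¹ * (B - A) * B⁻¹ := by
    have h1 := hA.inv_mul_self
    have h2 := hA.mul_inv_self
    have h4 := hB.mul_inv_self
    simp only [Matrix.sub_mul, Matrix.mul_sub, Matrix.mul_assoc, h1, h2, h4, Matrix.mul_one]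
    simp only [← Matrix.mul_assoc, Matrix.one_mul]
    abel
  rw [key]
  exact (hA.posSemidef.symm_conj (hAs.sub hBs)).add (h.symm_conj hBs)

/-- Test the quadratic form on e_i ± e_j. Entrywise bounds thus reduce to diagonal ones, which are
monotone in the Loewner order. -/
theorem Matrix.PosSemidef.abs_apply_le {A : Matrix (Fin n) (Fin n) ℝ} (hA : A.PosSemidef)
    {K : ℝ} (hK : ∀ i, A i i ≤ K) (i j : Fin n) : |A i j| ≤ K := by
  have hs : A j i = A i j := by simpa using hA.isHermitian.apply i j
  have h := fun s : ℝ => hA.dotProduct_mulVec_nonneg (Pi.single i 1 + s • Pi.single j 1)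
  simp only [star_trivial, Matrix.mulVec_add, Matrix.mulVec_smul, add_dotProduct,
    dotProduct_add, smul_dotProduct, dotProduct_smul, Matrix.mulVec_single_one,
    single_one_dotProduct, Matrix.col_apply, smul_eq_mul, hs] at h
  have h1 := h 1
  have h2 := h (-1)
  rw [abs_le]
  constructor <;> nlinarith [hK i, hK j]

theorem Matrix.PosDef.log_det_eq {M : Matrix (Fin n) (Fin n) ℝ} (hM : M.PosDef) :
    Real.log M.det = ∑ i, Real.log (hM.isHermitian.eigenvalues i) := by
  rw [hM.isHermitian.det_eq_prod_eigenvalues]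
  simp only [RCLike.ofReal_real_eq_id, id]
  exact Real.log_prod (fun i _ => (hM.eigenvalues_pos i).ne')

theorem Matrix.IsHermitian.trace_eq_sum {M : Matrix (Fin n) (Fin n) ℝ} (hM : M.IsHermitian) :
    M.trace = ∑ i, hM.eigenvalues i := by
  simpa using hM.trace_eq_sum_eigenvalues

/-- A common reduction: if `A = P⁻¹ = CᴴC` then `C B Cᴴ` has the trace and the determinant of
`P⁻¹ B`. -/
theorem Matrix.PosDef.exists_congr_one {P : Matrix (Fin n) (Fin n) ℝ} (hP : P.PosDef) :
    ∃ C D : Matrix (Fin n) (Fin n) ℝ, D * C = 1 ∧ D * Dᴴ = P ∧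
      (∀ B : Matrix (Fin n) (Fin n) ℝ, B.PosDef → (C * B * Cᴴ).PosDef ∧
        Real.log (C * B * Cᴴ).det = Real.log B.det - Real.log P.det ∧
        (C * B * Cᴴ).trace = frob P⁻¹ B ∧ D * (C * B * Cᴴ) * Dᴴ = B) := by
  obtain ⟨C, hC⟩ := hP.inv.posSemidef.exists_conjTranspose_mul_self
  have hdet : C.det ≠ 0 := by
    intro h0
    have := hP.inv.det_pos
    rw [hC, Matrix.det_mul, h0, mul_zero] at this
    exact lt_irrefl _ this
  have hu : IsUnit C.det := hdet.isUnit
  have hDC : C⁻¹ * C = 1 := Matrix.nonsing_inv_mul _ hu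
  have hCD : C * C⁻¹ = 1 := Matrix.mul_nonsing_inv _ hu
  have hDC' : Cᴴ * (C⁻¹)ᴴ = 1 := by rw [← Matrix.conjTranspose_mul, hDC, Matrix.conjTranspose_one]
  refine ⟨C, C⁻¹, hDC, ?_, fun B hB => ⟨?_, ?_, ?_, ?_⟩⟩
  · have h1 : P * (Cᴴ * C) = 1 := by rw [← hC]; exact hP.mul_inv_self
    have h2 : C⁻¹ * (C⁻¹)ᴴ = P * (Cᴴ * C) * (C⁻¹ * (C⁻¹)ᴴ) := by rw [h1, Matrix.one_mul]
    rw [h2, Matrix.mul_assoc P, Matrix.mul_assoc Cᴴ, ← Matrix.mul_assoc C, hCD, Matrix.one_mul,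
      hDC', Matrix.mul_one]
  · refine hB.mul_mul_conjTranspose_same ?_
    exact Matrix.vecMul_injective_of_isUnit ((Matrix.isUnit_iff_isUnit_det _).2 hu)
  · have : (C * B * Cᴴ).det = B.det * (P.det)⁻¹ := by
      have h3 : (P⁻¹).det = (P.det)⁻¹ := by
        rw [Matrix.det_nonsing_inv, Ring.inverse_eq_inv']
      rw [← h3, hC]
      simp only [Matrix.det_mul]
      ring
    rw [this, Real.log_mul hB.det_pos.ne' (inv_ne_zero hP.det_pos.ne'), Real.log_inv]
    ring
  · rw [frob, hC, Matrix.mul_assoc, Matrix.trace_mul_comm, Matrix.mul_assoc, Matrix.mul_assoc,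
      Matrix.trace_mul_comm, Matrix.mul_assoc]
  · calc C⁻¹ * (C * B * Cᴴ) * (C⁻¹)ᴴ = (C⁻¹ * C) * B * (Cᴴ * (C⁻¹)ᴴ) := by
          simp only [Matrix.mul_assoc]
      _ = B := by rw [hDC, hDC', Matrix.one_mul, Matrix.mul_one]

/-- Concavity of `log det`. -/
theorem Matrix.PosDef.log_det_le {P B : Matrix (Fin n) (Fin n) ℝ} (hP : P.PosDef)
    (hB : B.PosDef) : Real.log B.det - Real.log P.det ≤ frob P⁻¹ (B - P) := by
  obtain ⟨C, D, -, -, h⟩ := hP.exists_congr_one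
  obtain ⟨hM, hdet, htr, -⟩ := h B hB
  have h1 : frob P⁻¹ P = n := by simp [frob, hP.inv_mul_self]
  rw [frob_sub_right, h1, ← htr, ← hdet, hM.log_det_eq, hM.isHermitian.trace_eq_sum]
  have : ∑ i, Real.log (hM.isHermitian.eigenvalues i) ≤ ∑ i, (hM.isHermitian.eigenvalues i - 1) :=
    Finset.sum_le_sum fun i _ => Real.log_le_sub_one_of_pos (hM.eigenvalues_pos i)
  simpa using this

/-- The inequality of arithmetic and geometric means for the eigenvalues, read off from concavity of
log det at the identity. -/
theorem Matrix.PosSemidef.det_le_one_of_trace_le {M : Matrix (Fin n) (Fin n) ℝ}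
    (hM : M.PosSemidef) (h : M.trace ≤ n) : M.det ≤ 1 := by
  by_cases h0 : M.det = 0
  · rw [h0]; exact zero_le_one
  have hpd : M.PosDef := hM.posDef_iff_det_ne_zero.2 h0
  have := (Matrix.PosDef.one (n := Fin n) (R := ℝ)).log_det_le hpd
  rw [frob_sub_right] at this
  simp [frob] at this
  rw [← Real.log_nonpos_iff hpd.det_pos.le]
  linarith

end MatrixInequalities

/-! ### Entropy bound, bounds on inverses, and their stability under limits -/

section MatrixBounds

variable {n : ℕ}

theorem Matrix.IsHermitian.sub_smul_one_posSemidef {M : Matrix (Fin n) (Fin n) ℝ}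
    (hM : M.IsHermitian) {c : ℝ} (h : ∀ i, c ≤ hM.eigenvalues i) :
    (M - c • (1 : Matrix (Fin n) (Fin n) ℝ)).PosSemidef := by
  have hD : (diagonal fun i => hM.eigenvalues i - c).PosSemidef :=
    Matrix.PosSemidef.diagonal fun i => sub_nonneg.2 (h i)
  have := hD.mul_mul_conjTranspose_same (hM.eigenvectorUnitary : Matrix (Fin n) (Fin n) ℝ)
  convert this using 1
  have hs := hM.spectral_theorem
  rw [Unitary.conjStarAlgAut_apply] at hs
  have hd : (diagonal fun i => hM.eigenvalues i - c) =
      diagonal (RCLike.ofReal ∘ hM.eigenvalues) - c • (1 : Matrix (Fin n) (Fin n) ℝ) := by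
    ext i j
    by_cases hij : i = j
    · subst hij; simp
    · simp [hij]
  rw [hd, Matrix.mul_sub, Matrix.sub_mul, ← Matrix.star_eq_conjTranspose, ← hs]
  simp

theorem Matrix.IsHermitian.smul_one_sub_posSemidef {M : Matrix (Fin n) (Fin n) ℝ}
    (hM : M.IsHermitian) {c : ℝ} (h : ∀ i, hM.eigenvalues i ≤ c) :
    (c • (1 : Matrix (Fin n) (Fin n) ℝ) - M).PosSemidef := by
  have hD : (diagonal fun i => c - hM.eigenvalues i).PosSemidef :=
    Matrix.PosSemidef.diagonal fun i => sub_nonneg.2 (h i)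
  have := hD.mul_mul_conjTranspose_same (hM.eigenvectorUnitary : Matrix (Fin n) (Fin n) ℝ)
  convert this using 1
  have hs := hM.spectral_theorem
  rw [Unitary.conjStarAlgAut_apply] at hs
  have hd : (diagonal fun i => c - hM.eigenvalues i) =
      c • (1 : Matrix (Fin n) (Fin n) ℝ) - diagonal (RCLike.ofReal ∘ hM.eigenvalues) := by
    ext i j
    by_cases hij : i = j
    · subst hij; simp
    · simp [hij]
  rw [hd, Matrix.mul_sub, Matrix.sub_mul, ← Matrix.star_eq_conjTranspose, ← hs]
  simp

/-- If the relative entropies of `A` and `Q` with respect to `P` add up to at most `m`, then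
`A ≥ e^{-m} Q / 4`. -/
theorem Matrix.PosDef.sub_smul_posSemidef_of_entropy_le (hn : 0 < n)
    {A P Q : Matrix (Fin n) (Fin n) ℝ}
    (hA : A.PosDef) (hP : P.PosDef) (hQ : Q.PosDef) {m : ℝ}
    (h : (frob P⁻¹ A - n - (Real.log A.det - Real.log P.det)) +
      (frob P⁻¹ Q - n - (Real.log Q.det - Real.log P.det)) ≤ m) :
    (A - (Real.exp (-m) / 4) • Q).PosSemidef := by
  have : NeZero n := ⟨hn.ne'⟩
  obtain ⟨C, D, -, hD, hC⟩ := hP.exists_congr_one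
  obtain ⟨hMA, hdA, htA, heA⟩ := hC A hA
  obtain ⟨hMQ, hdQ, htQ, heQ⟩ := hC Q hQ
  set z := hMA.isHermitian.eigenvalues with hz
  set μ := hMQ.isHermitian.eigenvalues with hμ
  have hzpos : ∀ i, 0 < z i := hMA.eigenvalues_pos
  have hμpos : ∀ i, 0 < μ i := hMQ.eigenvalues_pos
  obtain ⟨i, -, hi⟩ := Finset.exists_min_image Finset.univ z ⟨0, Finset.mem_univ _⟩
  obtain ⟨j, -, hj⟩ := Finset.exists_max_image Finset.univ μ ⟨0, Finset.mem_univ _⟩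
  -- The entropy is a sum of terms w - 1 - log w ≥ 0, so it bounds each of them. It is used at the
  -- smallest eigenvalue of A and the largest of Q, both relative to P.
  have hent : ∀ (w : Fin n → ℝ), (∀ i, 0 < w i) → ∀ i,
      w i - 1 - Real.log (w i) ≤ ∑ i, w i - n - ∑ i, Real.log (w i) := by
    intro w hw i
    have : ∑ i, w i - n - ∑ i, Real.log (w i) = ∑ i, (w i - 1 - Real.log (w i)) := by
      simp [Finset.sum_sub_distrib]
    rw [this]
    refine Finset.single_le_sum (f := fun i => w i - 1 - Real.log (w i))
      (fun k _ => ?_) (Finset.mem_univ i)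
    have := Real.log_le_sub_one_of_pos (hw k)
    simpa using this
  have h1 := hent z hzpos i
  have h2 := hent μ hμpos j
  rw [← htA, ← htQ, ← hdA, ← hdQ, hMA.log_det_eq, hMQ.log_det_eq, hMA.isHermitian.trace_eq_sum,
    hMQ.isHermitian.trace_eq_sum] at h
  -- Tangent line of log at 2: the function 2 log μ - μ is largest there. This is the origin of the
  -- factor 4.
  have hlog : Real.log (μ j) ≤ μ j / 2 - 1 + Real.log 2 := by
    have := Real.log_le_sub_one_of_pos (half_pos (hμpos j))
    rw [Real.log_div (hμpos j).ne' two_ne_zero] at this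
    linarith
  have hle : Real.exp (-m) / 4 * μ j ≤ z i := by
    rw [← Real.exp_log (hzpos i), ← Real.exp_log (hμpos j)]
    have h4 : (4 : ℝ) = Real.exp (2 * Real.log 2) := by
      rw [two_mul, Real.exp_add, Real.exp_log two_pos]; norm_num
    rw [h4, ← Real.exp_sub, ← Real.exp_add, Real.exp_le_exp]
    have := hzpos i
    linarith
  have hsA := hMA.isHermitian.sub_smul_one_posSemidef (c := z i) fun k => hi k (Finset.mem_univ k)
  have hsQ := hMQ.isHermitian.smul_one_sub_posSemidef (c := μ j) fun k => hj k (Finset.mem_univ k)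
  have hc : 0 ≤ Real.exp (-m) / 4 := by positivity
  -- With c = e^{-m}/4, after the congruence: A - cQ = (A - z) + c(μ - Q) + (z - cμ).
  have hone : ((z i - Real.exp (-m) / 4 * μ j) • (1 : Matrix (Fin n) (Fin n) ℝ)).PosSemidef :=
    Matrix.PosSemidef.one.smul (sub_nonneg.2 hle)
  have hfin := ((hsA.add (hsQ.smul hc)).add hone).mul_mul_conjTranspose_same D
  convert hfin using 1
  conv_lhs => rw [← heA, ← heQ]
  rw [← Matrix.smul_mul, ← Matrix.mul_smul, ← Matrix.sub_mul, ← Matrix.mul_sub]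
  congr 2
  module

/-- `2 H⁻¹ - H⁻¹ A H⁻¹ ≥ 2 (A + H)⁻¹` when `A ≤ H`. -/
theorem Matrix.PosDef.two_smul_inv_sub_posSemidef {A H : Matrix (Fin n) (Fin n) ℝ}
    (hA : A.PosDef) (h : (H - A).PosSemidef) :
    (((2 : ℝ) • H⁻¹ - H⁻¹ * A * H⁻¹) - (2 : ℝ) • (A + H)⁻¹).PosSemidef := by
  have hH := hA.mono h
  set S := A + H with hS
  have hSpd : S.PosDef := hA.add hH
  have hle : (S - (2 : ℝ) • A).PosSemidef := by
    convert h using 1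
    rw [hS, two_smul]; abel
  -- The matrix form of the scalar identity 2/h - a/h² - 2/(a+h) = a(h-a)/(h²(a+h)). The middle
  -- factor is nonnegative because 2A ≤ S gives S⁻¹ ≤ (2A)⁻¹.
  have hkey : ((2 : ℝ) • H⁻¹ - H⁻¹ * A * H⁻¹) - (2 : ℝ) • S⁻¹ =
      H⁻¹ * (A - (2 : ℝ) • (A * S⁻¹ * A)) * H⁻¹ := by
    have hA' : A = S - H := by rw [hS]; abel
    have h1 := hH.inv_mul_self
    have h2 := hH.mul_inv_self
    have h3 := hSpd.inv_mul_self
    have h4 := hSpd.mul_inv_self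
    have e1 : A * S⁻¹ * A = S - (2 : ℝ) • H + H * S⁻¹ * H := by
      rw [hA']
      simp only [Matrix.sub_mul, Matrix.mul_sub, h4, Matrix.one_mul, Matrix.mul_assoc, h3,
        Matrix.mul_one, two_smul]
      abel
    have e2 : H⁻¹ * (H * S⁻¹ * H) * H⁻¹ = S⁻¹ := by
      rw [Matrix.mul_assoc, Matrix.mul_assoc, Matrix.mul_assoc, h2, Matrix.mul_one,
        ← Matrix.mul_assoc, h1, Matrix.one_mul]
    have e3 : H⁻¹ * H * H⁻¹ = H⁻¹ := by rw [h1, Matrix.one_mul]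
    rw [e1, hA']
    simp only [Matrix.sub_mul, Matrix.mul_sub, Matrix.mul_add, Matrix.add_mul, smul_add, smul_sub,
      Matrix.mul_smul, Matrix.smul_mul, e2, e3]
    module
  rw [hkey]
  refine Matrix.PosSemidef.symm_conj ?_ hH.isHermitian.inv
  have hinv := (hA.smul (two_pos : (0 : ℝ) < 2)).inv_sub_inv_posSemidef hle
  have hA2 : ((2 : ℝ) • A)⁻¹ = (2 : ℝ)⁻¹ • A⁻¹ := by
    refine Matrix.inv_eq_left_inv ?_
    rw [Matrix.smul_mul, Matrix.mul_smul, smul_smul, hA.inv_mul_self]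
    norm_num
  have := (hinv.smul (zero_le_two : (0 : ℝ) ≤ 2)).symm_conj hA.isHermitian
  convert this using 1
  rw [hA2, smul_sub, smul_smul, Matrix.mul_sub, Matrix.sub_mul]
  norm_num
  rw [hA.mul_inv_self, Matrix.one_mul]

/-- The congruence (1 - A⁻¹/L) A (1 - A⁻¹/L) = A - 2/L + A⁻¹/L² has nonnegative diagonal. This
converts the bound L on the inverse of the gap into a lower bound for its trace. -/
theorem Matrix.PosDef.inv_le_apply_self {A : Matrix (Fin n) (Fin n) ℝ} (hA : A.PosDef) {L : ℝ}
    (hL : 0 < L) {i : Fin n} (h : A⁻¹ i i ≤ L) : 1 / L ≤ A i i := by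
  have hherm : (1 - (1 / L) • A⁻¹).IsHermitian := by
    refine Matrix.isHermitian_one.sub ?_
    rw [Matrix.IsHermitian, Matrix.conjTranspose_smul, hA.isHermitian.inv.eq]
    simp
  have := (hA.posSemidef.symm_conj hherm).diag_nonneg (i := i)
  have e : (1 - (1 / L) • A⁻¹) * A * (1 - (1 / L) • A⁻¹) =
      A - (2 / L) • (1 : Matrix (Fin n) (Fin n) ℝ) + (1 / L ^ 2) • A⁻¹ := by
    simp only [Matrix.sub_mul, Matrix.mul_sub, Matrix.one_mul, Matrix.mul_one, Matrix.smul_mul,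
      Matrix.mul_smul, hA.inv_mul_self, hA.mul_inv_self, smul_sub, smul_smul]
    rw [show (1 / L ^ 2 : ℝ) = 1 / L * (1 / L) by field_simp]
    rw [show (2 / L : ℝ) = 1 / L + 1 / L by ring]
    module
  rw [e] at this
  simp only [Matrix.add_apply, Matrix.sub_apply, Matrix.smul_apply, Matrix.one_apply_eq,
    smul_eq_mul, mul_one] at this
  have h2 : 1 / L ^ 2 * A⁻¹ i i ≤ 1 / L := by
    calc 1 / L ^ 2 * A⁻¹ i i ≤ 1 / L ^ 2 * L := by gcongr
      _ = 1 / L := by field_simp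
  have h3 : 2 / L = 1 / L + 1 / L := by ring
  linarith

/-- A diagonal entry of the inverse of a correlation matrix is at most `1 / det`. -/
theorem Matrix.PosDef.inv_apply_self_le {Q : Matrix (Fin n) (Fin n) ℝ} (hQ : Q.PosDef)
    (hdiag : ∀ j, Q j j = 1) (i : Fin n) : Q⁻¹ i i ≤ 1 / Q.det := by
  obtain ⟨k, rfl⟩ : ∃ k, n = k + 1 := ⟨n - 1, by have := i.pos; omega⟩
  rw [Matrix.inv_def, Matrix.smul_apply, Ring.inverse_eq_inv', smul_eq_mul, one_div]
  refine mul_le_of_le_one_right (inv_nonneg.2 hQ.det_pos.le) ?_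
  rw [Matrix.adjugate_fin_succ_eq_det_submatrix]
  have hev : (-1 : ℝ) ^ ((i : ℕ) + (i : ℕ)) = 1 := (Even.add_self _).neg_one_pow
  rw [hev, one_mul]
  -- The diagonal cofactor is a principal minor of a matrix with unit diagonal, so its trace equals
  -- its size.
  refine (hQ.posSemidef.submatrix _).det_le_one_of_trace_le ?_
  simp [Matrix.trace, hdiag]

theorem abs_apply_le_maxEntryNorm (A : Matrix (Fin n) (Fin n) ℝ) (i j : Fin n) :
    |A i j| ≤ maxEntryNorm A :=
  le_ciSup (f := fun k : Fin n × Fin n => |A k.1 k.2|) (Set.finite_range _).bddAbove (i, j)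

theorem maxEntryNorm_le {A : Matrix (Fin n) (Fin n) ℝ} {K : ℝ} (hn : 0 < n)
    (h : ∀ i j, |A i j| ≤ K) : maxEntryNorm A ≤ K := by
  have : Nonempty (Fin n) := ⟨⟨0, hn⟩⟩
  exact ciSup_le fun k => h k.1 k.2

/-- If `A ≤ X` then the entries of `X⁻¹` are bounded by those of `A⁻¹`. -/
theorem Matrix.PosDef.abs_inv_apply_le {A X : Matrix (Fin n) (Fin n) ℝ} (hA : A.PosDef)
    (h : (X - A).PosSemidef) {K : ℝ} (hK : ∀ i, A⁻¹ i i ≤ K) (i j : Fin n) : |X⁻¹ i j| ≤ K := by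
  refine (hA.mono h).inv.posSemidef.abs_apply_le (fun k => ?_) i j
  have := (hA.inv_sub_inv_posSemidef h).diag_nonneg (i := k)
  rw [Matrix.sub_apply] at this
  linarith [hK k]

theorem Matrix.PosDef.abs_inv_apply_le_maxEntryNorm {A X : Matrix (Fin n) (Fin n) ℝ}
    (hA : A.PosDef) (h : (X - A).PosSemidef) (i j : Fin n) : |X⁻¹ i j| ≤ maxEntryNorm A⁻¹ :=
  hA.abs_inv_apply_le h (fun k => (le_abs_self _).trans (abs_apply_le_maxEntryNorm _ k k)) i j

/-- The Leibniz formula bounds |X⁻¹| by n! Kⁿ. The resulting lower bound on the determinant is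
uniform, hence survives limits. -/
theorem Matrix.PosDef.inv_le_det {X : Matrix (Fin n) (Fin n) ℝ} (hX : X.PosDef) {K : ℝ}
    (h : ∀ i j, |X⁻¹ i j| ≤ K) : 1 / ((n.factorial : ℝ) * K ^ n) ≤ X.det := by
  have h1 := Matrix.det_le (abv := AbsoluteValue.abs) (A := X⁻¹) (x := K) h
  simp only [Fintype.card_fin, nsmul_eq_mul, AbsoluteValue.abs_apply] at h1
  rw [Matrix.det_nonsing_inv, Ring.inverse_eq_inv', abs_of_pos (inv_pos.2 hX.det_pos)] at h1
  rw [one_div]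
  exact inv_le_of_inv_le₀ hX.det_pos h1

theorem Matrix.tendsto_inv {ι : Type*} {l : Filter ι} {X : ι → Matrix (Fin n) (Fin n) ℝ}
    {Y : Matrix (Fin n) (Fin n) ℝ} (h : Filter.Tendsto X l (nhds Y)) (hY : Y.det ≠ 0) :
    Filter.Tendsto (fun k => (X k)⁻¹) l (nhds Y⁻¹) := by
  have hc : ContinuousAt (Inv.inv : Matrix (Fin n) (Fin n) ℝ → _) Y := by
    refine continuousAt_matrix_inv Y ?_
    rw [Ring.inverse_eq_inv']
    exact continuousAt_inv₀ hY
  exact hc.tendsto.comp h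

theorem Matrix.tendsto_iff {ι : Type*} {l : Filter ι} {X : ι → Matrix (Fin n) (Fin n) ℝ}
    {Y : Matrix (Fin n) (Fin n) ℝ} : Filter.Tendsto X l (nhds Y) ↔
      ∀ i j, Filter.Tendsto (fun k => X k i j) l (nhds (Y i j)) := by
  refine tendsto_pi_nhds.trans (forall_congr' fun i => tendsto_pi_nhds)

/-- Invertibility with a bound on the inverse passes to limits. -/
theorem Matrix.det_pos_of_tendsto {ι : Type*} {l : Filter ι} [l.NeBot]
    {X : ι → Matrix (Fin n) (Fin n) ℝ} {Y : Matrix (Fin n) (Fin n) ℝ}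
    (h : Filter.Tendsto X l (nhds Y)) {K : ℝ} (hK : 0 < K) (hX : ∀ᶠ k in l, (X k).PosDef)
    (hb : ∀ᶠ k in l, ∀ i j, |(X k)⁻¹ i j| ≤ K) : 0 < Y.det ∧ ∀ i j, |Y⁻¹ i j| ≤ K := by
  have hdet : 1 / ((n.factorial : ℝ) * K ^ n) ≤ Y.det := by
    have hd : Filter.Tendsto (fun k => (X k).det) l (nhds Y.det) :=
      ((continuous_id.matrix_det (R := ℝ)).tendsto Y).comp h
    refine ge_of_tendsto hd ?_
    filter_upwards [hX, hb] with k h1 h2 using h1.inv_le_det h2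
  have hpos : 0 < Y.det := lt_of_lt_of_le (by positivity) hdet
  refine ⟨hpos, fun i j => ?_⟩
  have := (Matrix.tendsto_iff.1 (Matrix.tendsto_inv h hpos.ne') i j).abs
  refine le_of_tendsto this ?_
  filter_upwards [hb] with k hk using hk i j

end MatrixBounds

/-! ### Weak convergence of derivatives and the chain rule along Lipschitz paths -/

section LipschitzCalculus

theorem LipschitzWith.abs_deriv_le_one {g : ℝ → ℝ} (hg : LipschitzWith 1 g) (t : ℝ) :
    |deriv g t| ≤ 1 := by
  simpa using norm_deriv_le_of_lipschitz (x₀ := t) hg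

theorem LipschitzWith.absolutelyContinuousOnInterval {g : ℝ → ℝ} {K : NNReal}
    (hg : LipschitzWith K g) (a b : ℝ) : AbsolutelyContinuousOnInterval g a b :=
  hg.lipschitzOnWith.absolutelyContinuousOnInterval

theorem IntervalIntegrable.mul_deriv_lipschitz {D g : ℝ → ℝ} {a b : ℝ}
    (hD : IntervalIntegrable D volume a b) (hg : LipschitzWith 1 g) :
    IntervalIntegrable (fun t => D t * deriv g t) volume a b := by
  refine hD.mono_fun ((intervalIntegrable_iff.1 hD).aestronglyMeasurable.mul
    (measurable_deriv g).aestronglyMeasurable) (Filter.Eventually.of_forall fun t => ?_)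
  exact (norm_mul _ _).trans_le
    (mul_le_of_le_one_right (norm_nonneg _) (hg.abs_deriv_le_one t))

theorem abs_integral_mul_deriv_le {D g : ℝ → ℝ} {a b : ℝ} (hab : a ≤ b)
    (hD : IntervalIntegrable D volume a b) (hg : LipschitzWith 1 g) :
    |∫ t in a..b, D t * deriv g t| ≤ ∫ t in a..b, |D t| := by
  refine (intervalIntegral.abs_integral_le_integral_abs hab).trans ?_
  refine intervalIntegral.integral_mono_on hab (hD.mul_deriv_lipschitz hg).abs hD.abs
    (fun t _ => ?_)
  rw [abs_mul]
  exact mul_le_of_le_one_right (abs_nonneg _) (hg.abs_deriv_le_one t)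

open Polynomial in
theorem IntervalIntegrable.exists_polynomial_integral_sub_le {D : ℝ → ℝ} {a b : ℝ} (hab : a ≤ b)
    (hD : IntervalIntegrable D volume a b) {ε : ℝ} (hε : 0 < ε) :
    ∃ p : ℝ[X], ∫ t in a..b, |D t - p.eval t| ≤ ε := by
  have hi := (intervalIntegrable_iff_integrableOn_Ioc_of_le hab).1 hD
  obtain ⟨φ, hφ, hφi⟩ := hi.exists_boundedContinuous_integral_sub_le (half_pos hε)
  -- The added 1 keeps the denominator positive when a = b.
  have hδ : 0 < ε / 2 / (b - a + 1) := div_pos (half_pos hε) (by linarith)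
  obtain ⟨p, hp⟩ := exists_polynomial_near_of_continuousOn a b φ φ.continuous.continuousOn _ hδ
  refine ⟨p, ?_⟩
  have hφI : IntervalIntegrable φ volume a b := φ.continuous.intervalIntegrable a b
  have hpI : IntervalIntegrable (fun t => p.eval t) volume a b :=
    p.continuous.intervalIntegrable a b
  have h1 : ∫ t in a..b, |D t - φ t| ≤ ε / 2 := by
    rw [intervalIntegral.integral_of_le hab]; exact hφ
  have h2 : ∫ t in a..b, |φ t - p.eval t| ≤ ε / 2 := by
    calc ∫ t in a..b, |φ t - p.eval t| ≤ ∫ _t in a..b, ε / 2 / (b - a + 1) := by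
          refine intervalIntegral.integral_mono_on hab (hφI.sub hpI).abs
            intervalIntegrable_const (fun t ht => ?_)
          rw [abs_sub_comm]
          exact (hp t ht).le
      _ = (b - a) * (ε / 2 / (b - a + 1)) := by
          rw [intervalIntegral.integral_const, smul_eq_mul]
      _ ≤ ε / 2 := by
          rw [mul_div_assoc', div_le_iff₀ (by linarith)]
          nlinarith
  calc ∫ t in a..b, |D t - p.eval t| ≤ ∫ t in a..b, (|D t - φ t| + |φ t - p.eval t|) :=
        intervalIntegral.integral_mono_on hab (hD.sub hpI).abs
          ((hD.sub hφI).abs.add (hφI.sub hpI).abs) (fun t _ => abs_sub_le _ _ _)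
    _ = (∫ t in a..b, |D t - φ t|) + ∫ t in a..b, |φ t - p.eval t| :=
        intervalIntegral.integral_add (hD.sub hφI).abs (hφI.sub hpI).abs
    _ ≤ ε := by linarith

theorem intervalIntegrable_of_abs_le {D : ℝ → ℝ} {a b : ℝ}
    (hm : AEStronglyMeasurable D (volume.restrict (Set.uIoc a b))) {M : ℝ}
    (hb : ∀ t ∈ Set.uIoc a b, |D t| ≤ M) : IntervalIntegrable D volume a b := by
  refine (intervalIntegrable_const (c := M)).mono_fun hm ?_
  rw [EventuallyLE, ae_restrict_iff' measurableSet_uIoc]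
  exact Eventually.of_forall fun t ht => (hb t ht).trans (le_abs_self M)

/-- Weak convergence of the derivatives of uniformly Lipschitz functions. -/
theorem tendsto_integral_mul_deriv_of_integrable {g : ℕ → ℝ → ℝ} {g₀ : ℝ → ℝ} {a b B : ℝ}
    (hab : a ≤ b) (hg : ∀ k, LipschitzWith 1 (g k)) (hg₀ : LipschitzWith 1 g₀)
    (hB : ∀ k, ∀ t ∈ Set.Icc a b, |g k t| ≤ B)
    (hlim : ∀ t ∈ Set.Icc a b, Tendsto (fun k => g k t) atTop (𝓝 (g₀ t)))
    {D : ℝ → ℝ} (hD : IntervalIntegrable D volume a b) :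
    Tendsto (fun k => ∫ t in a..b, D t * deriv (g k) t) atTop
      (𝓝 (∫ t in a..b, D t * deriv g₀ t)) := by
  -- For polynomial weights, integration by parts moves the derivative off g, and pointwise
  -- convergence suffices. General weights follow by L¹ density, as |g'| ≤ 1 uniformly.
  have hpoly : ∀ p : Polynomial ℝ, Tendsto (fun k => ∫ t in a..b, p.eval t * deriv (g k) t) atTop
      (𝓝 (∫ t in a..b, p.eval t * deriv g₀ t)) := by
    intro p
    have hpac : AbsolutelyContinuousOnInterval (fun t => p.eval t) a b :=
      ((Polynomial.contDiff_aeval p 1).contDiffOn).absolutelyContinuousOnInterval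
    have hparts : ∀ u : ℝ → ℝ, LipschitzWith 1 u → ∫ t in a..b, p.eval t * deriv u t =
        p.eval b * u b - p.eval a * u a - ∫ t in a..b, deriv (fun t => p.eval t) t * u t :=
      fun u hu => hpac.integral_mul_deriv_eq_deriv_mul (hu.absolutelyContinuousOnInterval a b)
    simp only [hparts _ (hg _), hparts _ hg₀]
    refine ((tendsto_const_nhds.mul (hlim b ⟨hab, le_rfl⟩)).sub
      (tendsto_const_nhds.mul (hlim a ⟨le_rfl, hab⟩))).sub ?_
    have hdc : Continuous (deriv fun t => p.eval t) := by
      have : (deriv fun t => p.eval t) = fun t => p.derivative.eval t := funext fun t => p.deriv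
      rw [this]
      exact p.derivative.continuous
    refine intervalIntegral.tendsto_integral_filter_of_dominated_convergence
      (fun t => |deriv (fun t => p.eval t) t| * B) ?_ ?_ ?_ ?_
    · exact Eventually.of_forall fun k =>
        (hdc.mul (hg k).continuous).aestronglyMeasurable
    · refine Eventually.of_forall fun k => Eventually.of_forall fun t ht => ?_
      rw [norm_mul]
      rw [Set.uIoc_of_le hab] at ht
      exact mul_le_mul_of_nonneg_left (hB k t ⟨ht.1.le, ht.2⟩) (abs_nonneg _)
    · exact (hdc.abs.mul continuous_const).intervalIntegrable a b
    · refine Eventually.of_forall fun t ht => ?_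
      rw [Set.uIoc_of_le hab] at ht
      exact tendsto_const_nhds.mul (hlim t ⟨ht.1.le, ht.2⟩)
  rw [Metric.tendsto_atTop]
  intro ε hε
  obtain ⟨p, hp⟩ := hD.exists_polynomial_integral_sub_le hab (show 0 < ε / 4 by linarith)
  have hpI : IntervalIntegrable (fun t => p.eval t) volume a b :=
    p.continuous.intervalIntegrable a b
  have happ : ∀ u : ℝ → ℝ, LipschitzWith 1 u →
      |(∫ t in a..b, D t * deriv u t) - ∫ t in a..b, p.eval t * deriv u t| ≤ ε / 4 := by
    intro u hu
    rw [← intervalIntegral.integral_sub (hD.mul_deriv_lipschitz hu) (hpI.mul_deriv_lipschitz hu)]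
    simp only [← sub_mul]
    exact (abs_integral_mul_deriv_le hab (hD.sub hpI) hu).trans hp
  obtain ⟨N, hN⟩ := Metric.tendsto_atTop.1 (hpoly p) (ε / 4) (by linarith)
  refine ⟨N, fun k hk => ?_⟩
  have h1 := happ (g k) (hg k)
  have h2 := happ g₀ hg₀
  have h3 := hN k hk
  rw [Real.dist_eq] at h3 ⊢
  rw [abs_le] at h1 h2
  rw [abs_lt] at h3 ⊢
  constructor <;> linarith [h1.1, h1.2, h2.1, h2.2, h3.1, h3.2]

/-- Convergence of `∫ Dₖ gₖ'` for boundedly convergent `Dₖ` and uniformly Lipschitz `gₖ`. -/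
theorem tendsto_integral_mul_deriv {g : ℕ → ℝ → ℝ} {g₀ : ℝ → ℝ} {a b B : ℝ}
    (hab : a ≤ b) (hg : ∀ k, LipschitzWith 1 (g k)) (hg₀ : LipschitzWith 1 g₀)
    (hB : ∀ k, ∀ t ∈ Set.Icc a b, |g k t| ≤ B)
    (hlim : ∀ t ∈ Set.Icc a b, Tendsto (fun k => g k t) atTop (𝓝 (g₀ t)))
    {D : ℕ → ℝ → ℝ} {D₀ : ℝ → ℝ} {M : ℝ}
    (hm : ∀ k, AEStronglyMeasurable (D k) (volume.restrict (Set.uIoc a b)))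
    (hm₀ : AEStronglyMeasurable D₀ (volume.restrict (Set.uIoc a b)))
    (hM : ∀ k, ∀ t ∈ Set.uIoc a b, |D k t| ≤ M) (hM₀ : ∀ t ∈ Set.uIoc a b, |D₀ t| ≤ M)
    (hDlim : ∀ᵐ t, t ∈ Set.uIoc a b → Tendsto (fun k => D k t) atTop (𝓝 (D₀ t))) :
    Tendsto (fun k => ∫ t in a..b, D k t * deriv (g k) t) atTop
      (𝓝 (∫ t in a..b, D₀ t * deriv g₀ t)) := by
  have hI : ∀ k, IntervalIntegrable (D k) volume a b := fun k =>
    intervalIntegrable_of_abs_le (hm k) (hM k)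
  have hI₀ : IntervalIntegrable D₀ volume a b := intervalIntegrable_of_abs_le hm₀ hM₀
  have h1 := tendsto_integral_mul_deriv_of_integrable hab hg hg₀ hB hlim hI₀
  -- The derivatives converge only weakly, but the weights converge strongly in L¹, which is enough
  -- for the product.
  have h2 : Tendsto (fun k => ∫ t in a..b, (D k t - D₀ t) * deriv (g k) t) atTop (𝓝 0) := by
    have h0 : (0 : ℝ) = ∫ _t in a..b, (0 : ℝ) := by simp
    rw [h0]
    refine intervalIntegral.tendsto_integral_filter_of_dominated_convergence
      (fun _ => 2 * M) ?_ ?_ intervalIntegrable_const ?_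
    · exact Eventually.of_forall fun k => ((hm k).sub hm₀).mul
        (measurable_deriv _).aestronglyMeasurable
    · refine Eventually.of_forall fun k => Eventually.of_forall fun t ht => ?_
      rw [norm_mul]
      refine (mul_le_of_le_one_right (norm_nonneg _) ((hg k).abs_deriv_le_one t)).trans ?_
      have := (abs_sub (D k t) (D₀ t)).trans (add_le_add (hM k t ht) (hM₀ t ht))
      rw [Real.norm_eq_abs]
      linarith
    · filter_upwards [hDlim] with t ht hmem
      have h3 : Tendsto (fun k => |D k t - D₀ t|) atTop (𝓝 0) := by
        have := ((ht hmem).sub_const (D₀ t)).abs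
        simpa using this
      refine squeeze_zero_norm (fun k => ?_) h3
      rw [norm_mul]
      exact mul_le_of_le_one_right (norm_nonneg _) ((hg k).abs_deriv_le_one t)
  have h3 := h2.add h1
  rw [zero_add] at h3
  refine h3.congr fun k => ?_
  rw [← intervalIntegral.integral_add ((hI k).sub hI₀ |>.mul_deriv_lipschitz (hg k))
    (hI₀.mul_deriv_lipschitz (hg k))]
  simp only [sub_mul, sub_add_cancel]

variable {n : ℕ}

theorem frob_abs_le {A B : Matrix (Fin n) (Fin n) ℝ} {M K : ℝ} (hA : ∀ i j, |A i j| ≤ M)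
    (hB : ∀ i j, |B i j| ≤ K) (hM : 0 ≤ M) : |frob A B| ≤ n * n * (M * K) := by
  rw [frob_eq_sum]
  calc |∑ i, ∑ j, A i j * B j i| ≤ ∑ i, ∑ j, |A i j * B j i| :=
        (Finset.abs_sum_le_sum_abs _ _).trans
          (Finset.sum_le_sum fun i _ => Finset.abs_sum_le_sum_abs _ _)
    _ ≤ ∑ _i : Fin n, ∑ _j : Fin n, M * K := by
        refine Finset.sum_le_sum fun i _ => Finset.sum_le_sum fun j _ => ?_
        rw [abs_mul]
        exact mul_le_mul (hA i j) (hB j i) (abs_nonneg _) hM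
    _ = n * n * (M * K) := by simp; ring

theorem hasDerivAt_frob {X : ℝ → Matrix (Fin n) (Fin n) ℝ} {V : Matrix (Fin n) (Fin n) ℝ} {t : ℝ}
    (h : ∀ i j, HasDerivAt (fun s => X s i j) (V i j) t) (G : Matrix (Fin n) (Fin n) ℝ) :
    HasDerivAt (fun s => frob G (X s)) (frob G V) t := by
  simp only [frob_eq_sum]
  exact HasDerivAt.fun_sum fun i _ => HasDerivAt.fun_sum fun j _ => (h j i).const_mul _

/-- The fundamental theorem of calculus along a Lipschitz path of matrices, for a function with
bounded supergradients `G t`. -/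
theorem integral_frob_supergradient {X V G : ℝ → Matrix (Fin n) (Fin n) ℝ} {L : ℝ → ℝ}
    {a b M K : ℝ} (hab : a ≤ b) (hM : 0 ≤ M) (hK : 0 ≤ K)
    (hX : ∀ s ∈ Set.Icc a b, ∀ t ∈ Set.Icc a b, ∀ i j, |X s i j - X t i j| ≤ K * |s - t|)
    (hV : ∀ᵐ t, t ∈ Set.Icc a b → ∀ i j, HasDerivAt (fun s => X s i j) (V t i j) t)
    (hG : ∀ t ∈ Set.Icc a b, ∀ i j, |G t i j| ≤ M)
    (hL : ∀ s ∈ Set.Icc a b, ∀ t ∈ Set.Icc a b, L s - L t ≤ frob (G t) (X s - X t)) :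
    ∫ t in a..b, frob (G t) (V t) = L b - L a := by
  set C : ℝ := n * n * (M * K) with hC
  have hC0 : 0 ≤ C := by positivity
  have hlip : LipschitzOnWith C.toNNReal L (Set.uIcc a b) := by
    rw [Set.uIcc_of_le hab]
    refine LipschitzOnWith.of_dist_le_mul fun s hs t ht => ?_
    rw [Real.dist_eq, Real.dist_eq, Real.coe_toNNReal _ hC0]
    have hbd : ∀ s ∈ Set.Icc a b, ∀ t ∈ Set.Icc a b, L s - L t ≤ C * |s - t| := by
      intro s hs t ht
      refine (hL s hs t ht).trans ((le_abs_self _).trans ?_)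
      refine (frob_abs_le (hG t ht) (fun i j => ?_) hM (K := K * |s - t|)).trans_eq ?_
      · exact hX s hs t ht i j
      · rw [hC]; ring
    rw [abs_le]
    have h1 := hbd s hs t ht
    have h2 := hbd t ht s hs
    rw [abs_sub_comm] at h2
    constructor <;> linarith
  have hac := hlip.absolutelyContinuousOnInterval
  rw [← hac.integral_deriv_eq_sub]
  refine intervalIntegral.integral_congr_ae ?_
  have hne : ∀ᵐ t : ℝ, t ≠ b := by simp [ae_iff, measure_singleton]
  filter_upwards [hV, hac.ae_differentiableAt, hne] with t hVt hLt htb ht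
  rw [Set.uIoc_of_le hab] at ht
  have htI : t ∈ Set.Icc a b := ⟨ht.1.le, ht.2⟩
  have hd1 := hasDerivAt_frob (hVt htI) (G t)
  have hd2 := (hLt (by rwa [Set.uIcc_of_le hab])).hasDerivAt
  -- The supergradient inequality makes t a minimum, so the two derivatives agree wherever both
  -- exist. Neither smoothness of L as a function of the matrix nor regularity of G is needed.
  have hmin : IsLocalMin (fun s => frob (G t) (X s) - L s) t := by
    have hnh : Set.Icc a b ∈ 𝓝 t := Icc_mem_nhds ht.1 (lt_of_le_of_ne ht.2 htb)
    filter_upwards [hnh] with s hs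
    have := hL s hs t htI
    rw [frob_sub_right] at this
    linarith
  have := hmin.hasDerivAt_eq_zero (hd1.sub hd2)
  linarith

end LipschitzCalculus

theorem quadForm_eq_frob {n : ℕ} {A : Matrix (Fin n) (Fin n) ℝ} (v : Fin n → ℝ) :
    v ⬝ᵥ A *ᵥ v = frob (vecMulVec v v) A := by
  simp only [frob_eq_sum, dotProduct, mulVec, vecMulVec_apply, Finset.mul_sum]
  rw [Finset.sum_comm]
  exact Finset.sum_congr rfl fun i _ => Finset.sum_congr rfl fun j _ => by ring

/-- Pairing with a rank-one matrix is linear in the entries, so in this form positivity passes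
through derivatives, integrals, series and limits. -/
theorem posSemidef_of_frob_nonneg {n : ℕ} {A : Matrix (Fin n) (Fin n) ℝ} (hs : ∀ i j, A i j = A j i)
    (h : ∀ v : Fin n → ℝ, 0 ≤ frob (vecMulVec v v) A) : A.PosSemidef := by
  refine Matrix.PosSemidef.of_dotProduct_mulVec_nonneg ?_ fun v => ?_
  · ext i j; simpa using hs j i
  · rw [star_trivial, quadForm_eq_frob]; exact h v

/-! ### Elementary properties of distribution functions and matrix paths -/

namespace OverlapCDF

variable {n : ℕ} (x : OverlapCDF n)

theorem nonneg (t : ℝ) : 0 ≤ x.toFun t := by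
  rcases lt_or_ge t 0 with h | h
  · rw [x.eq_zero t h]
  · rw [← x.eq_zero (-1) (by norm_num)]
    exact x.monotone (by linarith)

theorem le_one (t : ℝ) : x.toFun t ≤ 1 := by
  rw [← x.eq_one (max t n) (le_max_right _ _)]
  exact x.monotone (le_max_left _ _)

theorem abs_le_one (t : ℝ) : |x.toFun t| ≤ 1 := by
  rw [abs_of_nonneg (x.nonneg t)]; exact x.le_one t

theorem measurable : Measurable x.toFun := x.monotone.measurable

end OverlapCDF

namespace MatrixPath

variable {n : ℕ} {Q : Matrix (Fin n) (Fin n) ℝ} (Φ : MatrixPath Q)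

theorem toFun_clamp (t : ℝ) : Φ.toFun t = Φ.toFun (max 0 (min t n)) := by
  have hn : (0 : ℝ) ≤ n := Nat.cast_nonneg n
  rcases le_total t 0 with h | h
  · rw [min_eq_left (h.trans hn), max_eq_left h, Φ.eq_start t h, Φ.eq_start 0 le_rfl]
  · rcases le_total t n with h' | h'
    · rw [min_eq_left h', max_eq_right h]
    · rw [min_eq_right h', max_eq_right hn, Φ.eq_end t h', Φ.eq_end n le_rfl]

theorem clamp_mem (t : ℝ) : max 0 (min t (n : ℝ)) ∈ Set.Icc (0 : ℝ) n :=
  ⟨le_max_left _ _, max_le (Nat.cast_nonneg n) (min_le_right _ _)⟩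

theorem posSemidef' (t : ℝ) : (Φ.toFun t).PosSemidef := by
  rw [Φ.toFun_clamp]; exact Φ.posSemidef _ (clamp_mem t)

theorem sub_posSemidef {s t : ℝ} (h : s ≤ t) : (Φ.toFun t - Φ.toFun s).PosSemidef := by
  rw [Φ.toFun_clamp s, Φ.toFun_clamp t]
  exact Φ.monotone _ (clamp_mem s) _ (clamp_mem t) (max_le_max_left _ (min_le_min_right _ h))

theorem lipschitzWith (i j : Fin n) : LipschitzWith 1 fun t => Φ.toFun t i j := by
  refine LipschitzWith.of_dist_le_mul fun s t => ?_
  simp only [Φ.toFun_clamp s, Φ.toFun_clamp t]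
  rw [Real.dist_eq, Real.dist_eq, NNReal.coe_one, one_mul]
  refine (Φ.lipschitz _ (clamp_mem t) _ (clamp_mem s) i j).trans ?_
  refine (abs_max_sub_max_le_max _ _ _ _).trans ?_
  rw [sub_self, abs_zero]
  refine max_le (abs_nonneg _) ((abs_min_sub_min_le_max _ _ _ _).trans ?_)
  rw [sub_self, abs_zero]
  exact max_le le_rfl (abs_nonneg _)

theorem abs_apply_le (t : ℝ) (i j : Fin n) : |Φ.toFun t i j| ≤ n := by
  rw [Φ.toFun_clamp]
  have hm := clamp_mem (n := n) t
  have h := Φ.lipschitz 0 ⟨le_refl _, Nat.cast_nonneg n⟩ _ hm i j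
  rw [Φ.eq_start 0 le_rfl] at h
  simp only [Matrix.zero_apply, sub_zero, abs_of_nonneg hm.1] at h
  exact h.trans hm.2

theorem sub_posSemidef_end (t : ℝ) : (Q - Φ.toFun t).PosSemidef := by
  have h := Φ.sub_posSemidef (le_max_left t (n : ℝ))
  rwa [Φ.eq_end _ (le_max_right _ _)] at h

theorem apply_symm (t : ℝ) (i j : Fin n) : Φ.toFun t i j = Φ.toFun t j i := by
  simpa using (Φ.posSemidef' t).isHermitian.apply j i

end MatrixPath

/-! ### The point t_x, the derivative of the path, and Φ̂ -/

namespace OrderParam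

variable {n : ℕ} {Q : Matrix (Fin n) (Fin n) ℝ} (p : OrderParam Q)

theorem tx_mem : p.tx ∈ Set.Icc (0 : ℝ) n := by
  have hbdd : BddBelow {t | t ∈ Set.Icc (0 : ℝ) n ∧ 1 ≤ p.x.toFun t} := ⟨0, fun t ht => ht.1.1⟩
  have hn : (n : ℝ) ∈ {t | t ∈ Set.Icc (0 : ℝ) n ∧ 1 ≤ p.x.toFun t} :=
    ⟨⟨Nat.cast_nonneg n, le_rfl⟩, (p.x.eq_one n le_rfl).ge⟩
  exact ⟨le_csInf ⟨_, hn⟩ fun t ht => ht.1.1, csInf_le hbdd hn⟩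

theorem tx_le {t : ℝ} (h0 : 0 ≤ t) (h : p.x.toFun t = 1) : p.tx ≤ t := by
  rcases le_total t n with hn | hn
  · exact csInf_le ⟨0, fun t ht => ht.1.1⟩ ⟨⟨h0, hn⟩, h.ge⟩
  · exact p.tx_mem.2.trans hn

theorem lt_one_of_lt_tx {t : ℝ} (h : t < p.tx) : p.x.toFun t < 1 := by
  rcases lt_or_ge t 0 with h0 | h0
  · rw [p.x.eq_zero t h0]; exact zero_lt_one
  · exact lt_of_le_of_ne (p.x.le_one t) fun h1 => absurd (p.tx_le h0 h1) (not_le.2 h)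

theorem eq_one_of_tx_le {t : ℝ} (h : p.tx ≤ t) : p.x.toFun t = 1 := by
  have hgt : ∀ s, p.tx < s → p.x.toFun s = 1 := by
    intro s hs
    have hn : (n : ℝ) ∈ {t | t ∈ Set.Icc (0 : ℝ) n ∧ 1 ≤ p.x.toFun t} :=
      ⟨⟨Nat.cast_nonneg n, le_rfl⟩, (p.x.eq_one n le_rfl).ge⟩
    obtain ⟨r, hr, hrs⟩ := exists_lt_of_csInf_lt ⟨_, hn⟩ hs
    exact le_antisymm (p.x.le_one s) (hr.2.trans (p.x.monotone hrs.le))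
  -- Right continuity is what includes t_x itself: the infimum is attained.
  have h1 := (p.x.right_continuous t).mono_left (nhdsWithin_mono t Set.Ioi_subset_Ici_self)
  have h2 : Tendsto p.x.toFun (𝓝[>] t) (𝓝 1) := by
    refine tendsto_const_nhds.congr' ?_
    filter_upwards [self_mem_nhdsWithin] with s hs
    exact (hgt s (lt_of_le_of_lt h hs)).symm
  exact tendsto_nhds_unique h1 h2

theorem abs_pathDeriv_le (t : ℝ) (i j : Fin n) : |p.pathDeriv t i j| ≤ 1 :=
  (p.Φ.lipschitzWith i j).abs_deriv_le_one t

theorem ae_hasDerivAt : ∀ᵐ t, ∀ i j,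
    HasDerivAt (fun s => p.Φ.toFun s i j) (p.pathDeriv t i j) t := by
  rw [ae_all_iff]; intro i
  rw [ae_all_iff]; intro j
  filter_upwards [(p.Φ.lipschitzWith i j).ae_differentiableAt_real] with t ht
  exact ht.hasDerivAt

/-- Each quadratic form is monotone along the path. The exceptional null set comes from
differentiability of the entries alone and so does not depend on the test vector. -/
theorem ae_pathDeriv_posSemidef : ∀ᵐ t, (p.pathDeriv t).PosSemidef := by
  filter_upwards [p.ae_hasDerivAt] with t ht
  refine posSemidef_of_frob_nonneg (fun i j => ?_) fun v => ?_
  · have : (fun s => p.Φ.toFun s i j) = fun s => p.Φ.toFun s j i :=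
      funext fun s => p.Φ.apply_symm s i j
    simp [pathDeriv, this]
  · have hmono : Monotone fun s => frob (vecMulVec v v) (p.Φ.toFun s) := by
      intro s s' hs
      refine frob_le_frob_right (p.Φ.sub_posSemidef hs) ?_
      simpa using posSemidef_vecMulVec_self_star v
    have := hmono.deriv_nonneg (x := t)
    rwa [(hasDerivAt_frob ht _).deriv] at this

theorem intervalIntegrable_mul_pathDeriv {w : ℝ → ℝ} {a b : ℝ}
    (hw : IntervalIntegrable w volume a b) (i j : Fin n) :
    IntervalIntegrable (fun t => w t * p.pathDeriv t i j) volume a b :=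
  hw.mul_deriv_lipschitz (p.Φ.lipschitzWith i j)

theorem intervalIntegrable_x_toFun (a b : ℝ) : IntervalIntegrable p.x.toFun volume a b :=
  p.x.monotone.intervalIntegrable

/-- The matrix `∫_a^b w(s) Φ'(s) ds`. -/
noncomputable def weightedIncrement (w : ℝ → ℝ) (a b : ℝ) : Matrix (Fin n) (Fin n) ℝ :=
  Matrix.of fun i j => ∫ s in a..b, w s * p.pathDeriv s i j

theorem frob_weightedIncrement (C : Matrix (Fin n) (Fin n) ℝ) {w : ℝ → ℝ} {a b : ℝ}
    (hw : IntervalIntegrable w volume a b) :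
    frob C (p.weightedIncrement w a b) = ∫ s in a..b, w s * frob C (p.pathDeriv s) := by
  have hI : ∀ i j, IntervalIntegrable (fun s => w s * (C i j * p.pathDeriv s j i)) volume a b := by
    intro i j
    refine ((p.intervalIntegrable_mul_pathDeriv hw j i).const_mul (C i j)).congr fun s _ => ?_
    ring
  simp only [frob_eq_sum, weightedIncrement, Matrix.of_apply, Finset.mul_sum]
  rw [intervalIntegral.integral_finsetSum fun i _ => ?_]
  · refine Finset.sum_congr rfl fun i _ => ?_
    rw [intervalIntegral.integral_finsetSum fun j _ => hI i j]
    refine Finset.sum_congr rfl fun j _ => ?_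
    rw [← intervalIntegral.integral_const_mul]
    refine intervalIntegral.integral_congr fun s _ => ?_
    ring
  · have := IntervalIntegrable.sum (μ := volume) (a := a) (b := b) Finset.univ
      (f := fun j s => w s * (C i j * p.pathDeriv s j i)) (fun j _ => hI i j)
    refine this.congr fun s _ => ?_
    simp

theorem weightedIncrement_posSemidef {w : ℝ → ℝ} {a b : ℝ} (hab : a ≤ b)
    (hw : IntervalIntegrable w volume a b) (hw0 : ∀ t ∈ Set.Icc a b, 0 ≤ w t) :
    (p.weightedIncrement w a b).PosSemidef := by
  refine posSemidef_of_frob_nonneg (fun i j => ?_) fun v => ?_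
  · have : ∀ s, p.pathDeriv s i j = p.pathDeriv s j i := by
      intro s
      have : (fun s => p.Φ.toFun s i j) = fun s => p.Φ.toFun s j i :=
        funext fun s => p.Φ.apply_symm s i j
      simp [pathDeriv, this]
    simp [weightedIncrement, this]
  · rw [frob_weightedIncrement _ _ hw]
    refine intervalIntegral.integral_nonneg_of_ae_restrict hab ?_
    filter_upwards [ae_restrict_of_ae p.ae_pathDeriv_posSemidef,
      ae_restrict_mem measurableSet_Icc] with t ht hmem
    refine mul_nonneg (hw0 t hmem) (frob_nonneg ?_ ht)
    simpa using posSemidef_vecMulVec_self_star v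

theorem weightedIncrement_one (a b : ℝ) :
    p.weightedIncrement (fun _ => 1) a b = p.Φ.toFun b - p.Φ.toFun a := by
  ext i j
  simp only [weightedIncrement, Matrix.of_apply, one_mul, Matrix.sub_apply, pathDeriv]
  exact ((p.Φ.lipschitzWith i j).absolutelyContinuousOnInterval a b).integral_deriv_eq_sub

theorem weightedIncrement_sub {w u : ℝ → ℝ} {a b : ℝ} (hw : IntervalIntegrable w volume a b)
    (hu : IntervalIntegrable u volume a b) :
    p.weightedIncrement (fun s => w s - u s) a b =
      p.weightedIncrement w a b - p.weightedIncrement u a b := by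
  ext i j
  simp only [weightedIncrement, Matrix.of_apply, Matrix.sub_apply, sub_mul]
  exact intervalIntegral.integral_sub (p.intervalIntegrable_mul_pathDeriv hw i j)
    (p.intervalIntegrable_mul_pathDeriv hu i j)

theorem pathHat_eq (t : ℝ) : p.pathHat t = p.weightedIncrement p.x.toFun t n := rfl

theorem pathHat_sub_pathHat (s t : ℝ) :
    p.pathHat s - p.pathHat t = p.weightedIncrement p.x.toFun s t := by
  ext i j
  simp only [pathHat_eq, weightedIncrement, Matrix.of_apply, Matrix.sub_apply]
  have h := fun a b => p.intervalIntegrable_mul_pathDeriv (p.intervalIntegrable_x_toFun a b) i j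
  rw [sub_eq_iff_eq_add]
  exact (intervalIntegral.integral_add_adjacent_intervals (h s t) (h t n)).symm

theorem pathHat_sub_posSemidef {s t : ℝ} (h : s ≤ t) : (p.pathHat s - p.pathHat t).PosSemidef := by
  rw [pathHat_sub_pathHat]
  exact p.weightedIncrement_posSemidef h (p.intervalIntegrable_x_toFun s t)
    fun r _ => p.x.nonneg r

theorem sub_pathHat_eq {s t : ℝ} :
    (p.Φ.toFun t - p.Φ.toFun s) - (p.pathHat s - p.pathHat t) =
      p.weightedIncrement (fun r => 1 - p.x.toFun r) s t := by
  rw [pathHat_sub_pathHat, ← weightedIncrement_one,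
    p.weightedIncrement_sub intervalIntegrable_const (p.intervalIntegrable_x_toFun s t)]

/-- The weight x is 1 from t_x on. In particular Φ̂(t_x) is the gap, which with monotonicity gives
the sandwich Q - Φ(t_x) ≤ Φ̂(t) ≤ Q - Φ(t) for t ≤ t_x. -/
theorem pathHat_of_tx_le {t : ℝ} (h : p.tx ≤ t) (ht : t ≤ n) : p.pathHat t = Q - p.Φ.toFun t := by
  have h1 := p.weightedIncrement_one t n
  rw [p.Φ.eq_end n le_rfl] at h1
  rw [← h1]
  ext i j
  simp only [pathHat, weightedIncrement, Matrix.of_apply]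
  refine intervalIntegral.integral_congr fun s hs => ?_
  rw [Set.uIcc_of_le ht] at hs
  rw [p.eq_one_of_tx_le (h.trans hs.1)]

theorem pathHat_sub_gap_posSemidef {t : ℝ} (h : t ≤ p.tx) :
    (p.pathHat t - (Q - p.Φ.toFun p.tx)).PosSemidef := by
  rw [← p.pathHat_of_tx_le le_rfl p.tx_mem.2]
  exact p.pathHat_sub_posSemidef h

theorem sub_pathHat_posSemidef {t : ℝ} (h : t ≤ n) :
    ((Q - p.Φ.toFun t) - p.pathHat t).PosSemidef := by
  have h1 := p.sub_pathHat_eq (s := t) (t := n)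
  have h2 : p.pathHat n = 0 := by ext i j; simp [pathHat]
  rw [h2, sub_zero, p.Φ.eq_end n le_rfl] at h1
  rw [h1]
  exact p.weightedIncrement_posSemidef h
    (intervalIntegrable_const.sub (p.intervalIntegrable_x_toFun _ _))
    fun r _ => sub_nonneg.2 (p.x.le_one r)

theorem gap_posSemidef {t : ℝ} (h : t ≤ p.tx) :
    ((Q - p.Φ.toFun t) - (Q - p.Φ.toFun p.tx)).PosSemidef := by
  rw [sub_sub_sub_cancel_left]
  exact p.Φ.sub_posSemidef h

theorem abs_pathHat_sub_le (s t : ℝ) (i j : Fin n) :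
    |p.pathHat s i j - p.pathHat t i j| ≤ |s - t| := by
  rw [← Matrix.sub_apply, pathHat_sub_pathHat, weightedIncrement, Matrix.of_apply, abs_sub_comm]
  have := intervalIntegral.norm_integral_le_of_norm_le_const (a := s) (b := t) (C := 1)
    (f := fun r => p.x.toFun r * p.pathDeriv r i j) (fun r _ => ?_)
  · rwa [one_mul] at this
  · rw [Real.norm_eq_abs, abs_mul]
    exact mul_le_one₀ (p.x.abs_le_one r) (abs_nonneg _) (p.abs_pathDeriv_le r i j)

theorem continuous_pathHat (i j : Fin n) : Continuous fun t => p.pathHat t i j := by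
  refine LipschitzWith.continuous (K := 1) (LipschitzWith.of_dist_le_mul fun s t => ?_)
  rw [NNReal.coe_one, one_mul, Real.dist_eq, Real.dist_eq]
  exact p.abs_pathHat_sub_le s t i j

theorem ae_hasDerivAt_pathHat : ∀ᵐ t, t ∈ Set.Icc (0 : ℝ) n → ∀ i j,
    HasDerivAt (fun s => p.pathHat s i j) ((-(p.x.toFun t • p.pathDeriv t)) i j) t := by
  have h : ∀ i j, ∀ᵐ t, t ∈ Set.Icc (0 : ℝ) n →
      HasDerivAt (fun s => p.pathHat s i j) ((-(p.x.toFun t • p.pathDeriv t)) i j) t := by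
    intro i j
    have := (p.intervalIntegrable_mul_pathDeriv
      (p.intervalIntegrable_x_toFun 0 n) i j).ae_hasDerivAt_integral
    filter_upwards [this] with t ht hmem
    rw [Set.uIcc_of_le (Nat.cast_nonneg n)] at ht
    have h1 := (ht hmem n ⟨Nat.cast_nonneg n, le_rfl⟩).neg
    refine h1.congr_of_eventuallyEq (Eventually.of_forall fun s => ?_)
    simp only [pathHat, Matrix.of_apply]
    exact intervalIntegral.integral_symm _ _
  have h' : ∀ᵐ t, ∀ i j, t ∈ Set.Icc (0 : ℝ) n →
      HasDerivAt (fun s => p.pathHat s i j) ((-(p.x.toFun t • p.pathDeriv t)) i j) t := by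
    rw [ae_all_iff]; intro i
    rw [ae_all_iff]; exact h i
  filter_upwards [h'] with t ht hmem i j using ht i j hmem

end OrderParam

/-! ### Convergence and Loewner monotonicity of ξ' -/

section MixedCovariance

variable {n : ℕ}

theorem Matrix.PosSemidef.hadamard_real {A B : Matrix (Fin n) (Fin n) ℝ} (hA : A.PosSemidef)
    (hB : B.PosSemidef) : (A ⊙ B).PosSemidef := hA.hadamard hB

theorem hadamardPow_posSemidef {A : Matrix (Fin n) (Fin n) ℝ} (hA : A.PosSemidef) (m : ℕ) :
    (Matrix.of fun i j => A i j ^ m).PosSemidef := by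
  induction m with
  | zero =>
    have := posSemidef_vecMulVec_self_star (R := ℝ) (fun _ : Fin n => (1 : ℝ))
    convert this using 1
    ext i j
    simp [vecMulVec_apply]
  | succ m ih =>
    convert ih.hadamard_real hA using 1
    ext i j
    simp [Matrix.hadamard_apply, pow_succ]

theorem hadamardPow_sub_posSemidef {A B : Matrix (Fin n) (Fin n) ℝ} (hA : A.PosSemidef)
    (h : (B - A).PosSemidef) (m : ℕ) :
    (Matrix.of fun i j => B i j ^ m - A i j ^ m).PosSemidef := by
  have hB : B.PosSemidef := by
    have := h.add hA
    rwa [sub_add_cancel] at this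
  induction m with
  | zero => convert Matrix.PosSemidef.zero using 1; ext i j; simp
  | succ m ih =>
    -- Telescoping, each product being positive by Schur: B^{m+1} - A^{m+1} = (B^m - A^m) ⊙ B + A^m
    -- ⊙ (B - A).
    convert (ih.hadamard_real hB).add ((hadamardPow_posSemidef hA m).hadamard_real h) using 1
    ext i j
    simp [Matrix.hadamard_apply, pow_succ]
    ring

/-- From p ≤ 2^p and |ab| ≤ a² + b². This series dominates ξ' on matrices with entries in [-1, 1],
the only ones a path visits. -/
theorem summable_mixedCoeff {β : ℕ → Fin n → ℝ}
    (hβ : ∀ j, Summable fun k : ℕ => (2 : ℝ) ^ (k + 2) * β (k + 2) j ^ 2) (i j : Fin n) :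
    Summable fun k : ℕ => ((k : ℝ) + 2) * |β (k + 2) i * β (k + 2) j| := by
  refine Summable.of_nonneg_of_le (fun k => by positivity) (fun k => ?_) ((hβ i).add (hβ j))
  have h1 : (k : ℝ) + 2 ≤ 2 ^ (k + 2) := by
    exact_mod_cast (Nat.lt_two_pow_self (n := k + 2)).le
  have h2 : |β (k + 2) i * β (k + 2) j| ≤ β (k + 2) i ^ 2 + β (k + 2) j ^ 2 := by
    rw [abs_le]
    constructor <;> nlinarith [sq_nonneg (β (k + 2) i + β (k + 2) j),
      sq_nonneg (β (k + 2) i - β (k + 2) j), sq_nonneg (β (k + 2) i), sq_nonneg (β (k + 2) j)]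
  rw [← mul_add]
  exact mul_le_mul h1 h2 (abs_nonneg _) (by positivity)

theorem abs_xiTerm_le {β : ℕ → Fin n → ℝ} (i j : Fin n) {a : ℝ} (ha : |a| ≤ 1) (k : ℕ) :
    ‖((k : ℝ) + 2) * (β (k + 2) i * β (k + 2) j) * a ^ (k + 1)‖ ≤
      ((k : ℝ) + 2) * |β (k + 2) i * β (k + 2) j| := by
  rw [norm_mul, norm_mul, norm_pow, Real.norm_eq_abs, Real.norm_eq_abs, Real.norm_eq_abs,
    abs_of_nonneg (by positivity : (0 : ℝ) ≤ (k : ℝ) + 2)]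
  exact mul_le_of_le_one_right (by positivity) (pow_le_one₀ (abs_nonneg _) ha)

theorem hasSum_xiDeriv {β : ℕ → Fin n → ℝ}
    (hβ : ∀ j, Summable fun k : ℕ => (2 : ℝ) ^ (k + 2) * β (k + 2) j ^ 2)
    {A : Matrix (Fin n) (Fin n) ℝ} (hA : ∀ i j, |A i j| ≤ 1) (i j : Fin n) :
    HasSum (fun k : ℕ => ((k : ℝ) + 2) * (β (k + 2) i * β (k + 2) j) * A i j ^ (k + 1))
      (xiDeriv β A i j) :=
  (Summable.of_norm_bounded (summable_mixedCoeff hβ i j)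
    fun k => abs_xiTerm_le i j (hA i j) k).hasSum

theorem abs_xiDeriv_le {β : ℕ → Fin n → ℝ}
    (hβ : ∀ j, Summable fun k : ℕ => (2 : ℝ) ^ (k + 2) * β (k + 2) j ^ 2)
    {A : Matrix (Fin n) (Fin n) ℝ} (hA : ∀ i j, |A i j| ≤ 1) (i j : Fin n) :
    |xiDeriv β A i j| ≤ ∑' k : ℕ, ((k : ℝ) + 2) * |β (k + 2) i * β (k + 2) j| :=
  tsum_of_norm_bounded (summable_mixedCoeff hβ i j).hasSum
    fun k => abs_xiTerm_le i j (hA i j) k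

theorem tendsto_xiDeriv {β : ℕ → Fin n → ℝ}
    (hβ : ∀ j, Summable fun k : ℕ => (2 : ℝ) ^ (k + 2) * β (k + 2) j ^ 2)
    {ι : Type*} {l : Filter ι} {X : ι → Matrix (Fin n) (Fin n) ℝ} {A : Matrix (Fin n) (Fin n) ℝ}
    (hX : ∀ k i j, |X k i j| ≤ 1) {i j : Fin n}
    (h : Tendsto (fun k => X k i j) l (𝓝 (A i j))) :
    Tendsto (fun k => xiDeriv β (X k) i j) l (𝓝 (xiDeriv β A i j)) := by
  refine tendsto_tsum_of_dominated_convergence (summable_mixedCoeff hβ i j) (fun k => ?_) ?_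
  · exact tendsto_const_nhds.mul (h.pow _)
  · exact Eventually.of_forall fun r k => abs_xiTerm_le i j (hX r i j) k

theorem xiDeriv_sub_posSemidef {β : ℕ → Fin n → ℝ}
    (hβ : ∀ j, Summable fun k : ℕ => (2 : ℝ) ^ (k + 2) * β (k + 2) j ^ 2)
    {A B : Matrix (Fin n) (Fin n) ℝ} (hA : A.PosSemidef) (h : (B - A).PosSemidef)
    (hA1 : ∀ i j, |A i j| ≤ 1) (hB1 : ∀ i j, |B i j| ≤ 1) :
    (xiDeriv β B - xiDeriv β A).PosSemidef := by
  have hterm : ∀ k : ℕ, (Matrix.of fun i j =>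
      ((k : ℝ) + 2) * (β (k + 2) i * β (k + 2) j) * B i j ^ (k + 1) -
      ((k : ℝ) + 2) * (β (k + 2) i * β (k + 2) j) * A i j ^ (k + 1)).PosSemidef := by
    intro k
    have h1 := posSemidef_vecMulVec_self_star (R := ℝ) (β (k + 2))
    have h2 := (h1.hadamard_real (hadamardPow_sub_posSemidef hA h (k + 1))).smul
      (by positivity : (0 : ℝ) ≤ (k : ℝ) + 2)
    convert h2 using 1
    ext i j
    simp [Matrix.hadamard_apply, vecMulVec_apply]
    ring
  have hsum : ∀ i j, HasSum (fun k : ℕ =>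
      ((k : ℝ) + 2) * (β (k + 2) i * β (k + 2) j) * B i j ^ (k + 1) -
      ((k : ℝ) + 2) * (β (k + 2) i * β (k + 2) j) * A i j ^ (k + 1))
      ((xiDeriv β B - xiDeriv β A) i j) := fun i j =>
    (hasSum_xiDeriv hβ hB1 i j).sub (hasSum_xiDeriv hβ hA1 i j)
  refine posSemidef_of_frob_nonneg (fun i j => ?_) fun v => ?_
  · refine (hsum i j).unique ?_
    convert hsum j i using 2 with k
    simpa using ((hterm k).isHermitian.apply i j).symm
  · have : HasSum (fun k : ℕ => frob (vecMulVec v v) (Matrix.of fun i j =>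
        ((k : ℝ) + 2) * (β (k + 2) i * β (k + 2) j) * B i j ^ (k + 1) -
        ((k : ℝ) + 2) * (β (k + 2) i * β (k + 2) j) * A i j ^ (k + 1)))
        (frob (vecMulVec v v) (xiDeriv β B - xiDeriv β A)) := by
      simp only [frob_eq_sum, Matrix.of_apply]
      exact hasSum_sum fun i _ => hasSum_sum fun j _ => (hsum j i).mul_left _
    refine this.nonneg fun k => frob_nonneg ?_ (hterm k)
    simpa using posSemidef_vecMulVec_self_star v

end MixedCovariance

/-! ### Integrals of the covariance along a path -/

namespace OrderParam

variable {n : ℕ} {Q : Matrix (Fin n) (Fin n) ℝ} (p : OrderParam Q)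

theorem abs_path_le_one (hdiag : ∀ j, Q j j = 1) (t : ℝ) (i j : Fin n) :
    |p.Φ.toFun t i j| ≤ 1 := by
  refine (p.Φ.posSemidef' t).abs_apply_le (fun k => ?_) i j
  have := (p.Φ.sub_posSemidef_end t).diag_nonneg (i := k)
  rw [Matrix.sub_apply, hdiag] at this
  linarith

theorem continuous_xiDeriv {β : ℕ → Fin n → ℝ}
    (hβ : ∀ j, Summable fun k : ℕ => (2 : ℝ) ^ (k + 2) * β (k + 2) j ^ 2)
    (hdiag : ∀ j, Q j j = 1) (i j : Fin n) :
    Continuous fun t => xiDeriv β (p.Φ.toFun t) i j := by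
  rw [continuous_iff_continuousAt]
  intro t
  exact tendsto_xiDeriv hβ (fun s => p.abs_path_le_one hdiag s)
    ((p.Φ.lipschitzWith i j).continuous.tendsto t)

theorem intervalIntegrable_frob {D : ℝ → Matrix (Fin n) (Fin n) ℝ} {a b : ℝ}
    (hD : ∀ i j, IntervalIntegrable (fun t => D t i j) volume a b) :
    IntervalIntegrable (fun t => frob (D t) (p.pathDeriv t)) volume a b := by
  have := IntervalIntegrable.sum (μ := volume) (a := a) (b := b) Finset.univ
    (f := fun (k : Fin n × Fin n) t => D t k.1 k.2 * p.pathDeriv t k.2 k.1)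
    (fun k _ => p.intervalIntegrable_mul_pathDeriv (hD k.1 k.2) k.2 k.1)
  refine this.congr fun t _ => ?_
  simp [frob_eq_sum, Fintype.sum_prod_type]

theorem integral_frob_eq_sum {D : ℝ → Matrix (Fin n) (Fin n) ℝ} {a b : ℝ}
    (hD : ∀ i j, IntervalIntegrable (fun t => D t i j) volume a b) :
    ∫ t in a..b, frob (D t) (p.pathDeriv t) =
      ∑ k : Fin n × Fin n, ∫ t in a..b, D t k.1 k.2 * p.pathDeriv t k.2 k.1 := by
  rw [← intervalIntegral.integral_finsetSum
    fun k _ => p.intervalIntegrable_mul_pathDeriv (hD k.1 k.2) k.2 k.1]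
  refine intervalIntegral.integral_congr fun t _ => ?_
  simp [frob_eq_sum, Fintype.sum_prod_type]

theorem integral_frob_mono {D E : ℝ → Matrix (Fin n) (Fin n) ℝ} {a b : ℝ} (hab : a ≤ b)
    (hD : ∀ i j, IntervalIntegrable (fun t => D t i j) volume a b)
    (hE : ∀ i j, IntervalIntegrable (fun t => E t i j) volume a b)
    (h : ∀ t ∈ Set.Icc a b, (E t - D t).PosSemidef) :
    ∫ t in a..b, frob (D t) (p.pathDeriv t) ≤ ∫ t in a..b, frob (E t) (p.pathDeriv t) := by
  refine intervalIntegral.integral_mono_ae_restrict hab (p.intervalIntegrable_frob hD)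
    (p.intervalIntegrable_frob hE) ?_
  filter_upwards [ae_restrict_of_ae p.ae_pathDeriv_posSemidef,
    ae_restrict_mem measurableSet_Icc] with t ht hmem
  exact frob_le_frob_left (h t hmem) ht

theorem integral_frob_const (C : Matrix (Fin n) (Fin n) ℝ) (a b : ℝ) :
    ∫ t in a..b, frob C (p.pathDeriv t) = frob C (p.Φ.toFun b - p.Φ.toFun a) := by
  rw [← weightedIncrement_one, frob_weightedIncrement _ _ intervalIntegrable_const]
  simp

/-- Since ξ' is Loewner monotone and Φ' ≥ 0, replacing Φ(t) by its endpoint Q only increases the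
integrand, which then integrates exactly. -/
theorem integral_xi_le {β : ℕ → Fin n → ℝ}
    (hβ : ∀ j, Summable fun k : ℕ => (2 : ℝ) ^ (k + 2) * β (k + 2) j ^ 2)
    (hdiag : ∀ j, Q j j = 1) (h : Fin n → ℝ) :
    ∫ t in (0 : ℝ)..n, frob (xiDeriv β (p.Φ.toFun t) + vecMulVec h h) (p.pathDeriv t) ≤
      frob (vecMulVec h h + xiDeriv β Q) Q := by
  have hQ1 : ∀ i j, |Q i j| ≤ 1 := by
    have := p.abs_path_le_one hdiag n
    rwa [p.Φ.eq_end n le_rfl] at this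
  have h1 := p.integral_frob_const (vecMulVec h h + xiDeriv β Q) 0 n
  rw [p.Φ.eq_start 0 le_rfl, p.Φ.eq_end n le_rfl, sub_zero] at h1
  rw [← h1]
  refine p.integral_frob_mono (Nat.cast_nonneg n) (fun i j => ?_)
    (fun i j => intervalIntegrable_const) (fun t _ => ?_)
  · exact ((p.continuous_xiDeriv hβ hdiag i j).add continuous_const).intervalIntegrable _ _
  · have := xiDeriv_sub_posSemidef hβ (p.Φ.posSemidef' t) (p.Φ.sub_posSemidef_end t)
      (p.abs_path_le_one hdiag t) hQ1
    convert this using 1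
    abel

end OrderParam

/-! ### Sequential continuity of the functional under a bound on the inverse of the gap -/

theorem measurable_inv_apply {n : ℕ} {X : ℝ → Matrix (Fin n) (Fin n) ℝ} (hX : Continuous X)
    (i j : Fin n) : Measurable fun t => (X t)⁻¹ i j := by
  simp only [Matrix.inv_def, Matrix.smul_apply, Ring.inverse_eq_inv', smul_eq_mul]
  exact (hX.matrix_det.measurable.inv).mul
    ((continuous_apply_apply i j).comp hX.matrix_adjugate).measurable

namespace OrderParam

variable {n : ℕ} {Q : Matrix (Fin n) (Fin n) ℝ}

theorem continuous_path (p : OrderParam Q) : Continuous p.Φ.toFun :=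
  continuous_pi fun i => continuous_pi fun j => (p.Φ.lipschitzWith i j).continuous

theorem continuous_pathHat' (p : OrderParam Q) : Continuous p.pathHat :=
  continuous_pi fun i => continuous_pi fun j => p.continuous_pathHat i j

/-- Almost everywhere convergence of the distribution functions and pointwise convergence of the
paths. -/
def ConvergesTo (p : ℕ → OrderParam Q) (q : OrderParam Q) : Prop :=
  (∀ᵐ t, Tendsto (fun k => (p k).x.toFun t) atTop (𝓝 (q.x.toFun t))) ∧
    ∀ t i j, Tendsto (fun k => (p k).Φ.toFun t i j) atTop (𝓝 (q.Φ.toFun t i j))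

variable {p : ℕ → OrderParam Q} {q : OrderParam Q}

theorem ConvergesTo.tendsto_integral (hc : ConvergesTo p q) {D : ℕ → ℝ → ℝ} {D₀ : ℝ → ℝ}
    {a b M : ℝ} (hab : a ≤ b) (hm : ∀ k, Measurable (D k)) (hm₀ : Measurable D₀)
    (hM : ∀ k, ∀ t ∈ Set.uIoc a b, |D k t| ≤ M) (hM₀ : ∀ t ∈ Set.uIoc a b, |D₀ t| ≤ M)
    (hD : ∀ᵐ t, t ∈ Set.uIoc a b → Tendsto (fun k => D k t) atTop (𝓝 (D₀ t))) (i j : Fin n) :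
    Tendsto (fun k => ∫ t in a..b, D k t * (p k).pathDeriv t i j) atTop
      (𝓝 (∫ t in a..b, D₀ t * q.pathDeriv t i j)) :=
  tendsto_integral_mul_deriv hab (fun k => (p k).Φ.lipschitzWith i j) (q.Φ.lipschitzWith i j)
    (fun k t _ => (p k).Φ.abs_apply_le t i j) (fun t _ => hc.2 t i j)
    (fun k => (hm k).aestronglyMeasurable) hm₀.aestronglyMeasurable hM hM₀ hD

theorem ConvergesTo.tendsto_integral_frob (hc : ConvergesTo p q)
    {D : ℕ → ℝ → Matrix (Fin n) (Fin n) ℝ} {D₀ : ℝ → Matrix (Fin n) (Fin n) ℝ}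
    {a b M : ℝ} (hab : a ≤ b) (hm : ∀ k i j, Measurable fun t => D k t i j)
    (hm₀ : ∀ i j, Measurable fun t => D₀ t i j)
    (hM : ∀ k, ∀ t ∈ Set.uIoc a b, ∀ i j, |D k t i j| ≤ M)
    (hM₀ : ∀ t ∈ Set.uIoc a b, ∀ i j, |D₀ t i j| ≤ M)
    (hD : ∀ᵐ t, t ∈ Set.uIoc a b → ∀ i j,
      Tendsto (fun k => D k t i j) atTop (𝓝 (D₀ t i j))) :
    Tendsto (fun k => ∫ t in a..b, frob (D k t) ((p k).pathDeriv t)) atTop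
      (𝓝 (∫ t in a..b, frob (D₀ t) (q.pathDeriv t))) := by
  have hI : ∀ k i j, IntervalIntegrable (fun t => D k t i j) volume a b := fun k i j =>
    intervalIntegrable_of_abs_le (hm k i j).aestronglyMeasurable fun t ht => hM k t ht i j
  have hI₀ : ∀ i j, IntervalIntegrable (fun t => D₀ t i j) volume a b := fun i j =>
    intervalIntegrable_of_abs_le (hm₀ i j).aestronglyMeasurable fun t ht => hM₀ t ht i j
  simp only [(p _).integral_frob_eq_sum (hI _), q.integral_frob_eq_sum hI₀]
  refine tendsto_finsetSum _ fun k _ => ?_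
  refine hc.tendsto_integral hab (fun r => hm r k.1 k.2) (hm₀ k.1 k.2)
    (fun r t ht => hM r t ht k.1 k.2) (fun t ht => hM₀ t ht k.1 k.2) ?_ k.2 k.1
  filter_upwards [hD] with t ht hmem using ht hmem k.1 k.2

theorem ConvergesTo.tendsto_pathHat (hc : ConvergesTo p q) {t : ℝ} (ht : t ≤ n) :
    Tendsto (fun k => (p k).pathHat t) atTop (𝓝 (q.pathHat t)) := by
  refine Matrix.tendsto_iff.2 fun i j => ?_
  refine hc.tendsto_integral ht (fun k => (p k).x.measurable) q.x.measurable
    (fun k s _ => (p k).x.abs_le_one s) (fun s _ => q.x.abs_le_one s) ?_ i j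
  filter_upwards [hc.1] with s hs _ using hs

theorem ConvergesTo.tendsto_path (hc : ConvergesTo p q) (t : ℝ) :
    Tendsto (fun k => (p k).Φ.toFun t) atTop (𝓝 (q.Φ.toFun t)) :=
  Matrix.tendsto_iff.2 fun i j => hc.2 t i j

theorem gap_posDef {p : OrderParam Q} (hp : p ∈ csDomain Q) :
    (Q - p.Φ.toFun p.tx).PosDef :=
  (p.Φ.sub_posSemidef_end _).posDef_of_det_pos hp

theorem sub_path_posDef {p : OrderParam Q} (hp : p ∈ csDomain Q) {t : ℝ} (ht : t ≤ p.tx) :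
    (Q - p.Φ.toFun t).PosDef :=
  (gap_posDef hp).mono (p.gap_posSemidef ht)

theorem pathHat_posDef {p : OrderParam Q} (hp : p ∈ csDomain Q) {t : ℝ} (ht : t ≤ p.tx) :
    (p.pathHat t).PosDef :=
  (gap_posDef hp).mono (p.pathHat_sub_gap_posSemidef ht)

/-- The difference `Φ̂(t)⁻¹ - (Q - Φ(t))⁻¹`, which vanishes after `t_x`. -/
noncomputable def invExcess (p : OrderParam Q) (t : ℝ) : Matrix (Fin n) (Fin n) ℝ :=
  (p.pathHat t)⁻¹ - (Q - p.Φ.toFun t)⁻¹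

theorem invExcess_of_tx_le (p : OrderParam Q) {t : ℝ} (h : p.tx ≤ t) (ht : t ≤ n) :
    p.invExcess t = 0 := by
  rw [invExcess, p.pathHat_of_tx_le h ht, sub_self]

theorem measurable_invExcess (p : OrderParam Q) (i j : Fin n) :
    Measurable fun t => p.invExcess t i j :=
  (measurable_inv_apply p.continuous_pathHat' i j).sub
    (measurable_inv_apply (continuous_const.sub p.continuous_path) i j)

theorem abs_pathHat_inv_le {p : OrderParam Q} (hp : p ∈ csDomain Q) {t : ℝ} (ht : t ≤ p.tx)
    (i j : Fin n) : |(p.pathHat t)⁻¹ i j| ≤ maxEntryNorm (Q - p.Φ.toFun p.tx)⁻¹ :=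
  (gap_posDef hp).abs_inv_apply_le_maxEntryNorm (p.pathHat_sub_gap_posSemidef ht) i j

theorem abs_sub_path_inv_le {p : OrderParam Q} (hp : p ∈ csDomain Q) {t : ℝ} (ht : t ≤ p.tx)
    (i j : Fin n) : |(Q - p.Φ.toFun t)⁻¹ i j| ≤ maxEntryNorm (Q - p.Φ.toFun p.tx)⁻¹ :=
  (gap_posDef hp).abs_inv_apply_le_maxEntryNorm (p.gap_posSemidef ht) i j

theorem abs_invExcess_le {p : OrderParam Q} (hp : p ∈ csDomain Q) {K : ℝ} (hK : 0 ≤ K)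
    (hpK : maxEntryNorm (Q - p.Φ.toFun p.tx)⁻¹ ≤ K) {t : ℝ} (ht : t ≤ n) (i j : Fin n) :
    |p.invExcess t i j| ≤ 2 * K := by
  rcases le_total p.tx t with h | h
  · rw [p.invExcess_of_tx_le h ht, Matrix.zero_apply, abs_zero]; positivity
  · rw [invExcess, Matrix.sub_apply]
    have h1 := abs_pathHat_inv_le hp h i j
    have h2 := abs_sub_path_inv_le hp h i j
    have := abs_sub ((p.pathHat t)⁻¹ i j) ((Q - p.Φ.toFun t)⁻¹ i j)
    linarith

theorem intervalIntegrable_pathHat_inv {p : OrderParam Q} (hp : p ∈ csDomain Q) (i j : Fin n) :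
    IntervalIntegrable (fun t => (p.pathHat t)⁻¹ i j) volume 0 p.tx := by
  refine intervalIntegrable_of_abs_le (M := maxEntryNorm (Q - p.Φ.toFun p.tx)⁻¹)
    (measurable_inv_apply p.continuous_pathHat' i j).aestronglyMeasurable fun t ht => ?_
  rw [Set.uIoc_of_le p.tx_mem.1] at ht
  exact abs_pathHat_inv_le hp ht.2 i j

theorem intervalIntegrable_sub_path_inv {p : OrderParam Q} (hp : p ∈ csDomain Q) (i j : Fin n) :
    IntervalIntegrable (fun t => (Q - p.Φ.toFun t)⁻¹ i j) volume 0 p.tx := by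
  refine intervalIntegrable_of_abs_le (M := maxEntryNorm (Q - p.Φ.toFun p.tx)⁻¹) (measurable_inv_apply
    (continuous_const.sub p.continuous_path) i j).aestronglyMeasurable fun t ht => ?_
  rw [Set.uIoc_of_le p.tx_mem.1] at ht
  exact abs_sub_path_inv_le hp ht.2 i j

theorem intervalIntegrable_invExcess {p : OrderParam Q} (hp : p ∈ csDomain Q) {a b : ℝ}
    (ha : a ≤ n) (hb : b ≤ n) (i j : Fin n) :
    IntervalIntegrable (fun t => p.invExcess t i j) volume a b := by
  refine intervalIntegrable_of_abs_le (M := 2 * maxEntryNorm (Q - p.Φ.toFun p.tx)⁻¹)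
    (p.measurable_invExcess i j).aestronglyMeasurable fun t ht => ?_
  exact abs_invExcess_le hp ((abs_nonneg _).trans (abs_apply_le_maxEntryNorm _ i j)) le_rfl
    (ht.2.trans (max_le ha hb)) i j

/-- The integrand is the derivative of -log|Q - Φ|; concavity of log det supplies the supergradient.
-/
theorem integral_sub_path_inv {p : OrderParam Q} (hp : p ∈ csDomain Q) (hn : 0 < n) :
    ∫ t in (0 : ℝ)..p.tx, frob (Q - p.Φ.toFun t)⁻¹ (p.pathDeriv t) =
      Real.log Q.det - Real.log (Q - p.Φ.toFun p.tx).det := by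
  have hM : 0 ≤ maxEntryNorm (Q - p.Φ.toFun p.tx)⁻¹ :=
    (abs_nonneg _).trans (abs_apply_le_maxEntryNorm _ ⟨0, hn⟩ ⟨0, hn⟩)
  have h := integral_frob_supergradient (X := fun t => Q - p.Φ.toFun t)
    (V := fun t => -p.pathDeriv t) (G := fun t => (Q - p.Φ.toFun t)⁻¹)
    (L := fun t => Real.log (Q - p.Φ.toFun t).det) p.tx_mem.1 hM zero_le_one
    (fun s _ t _ i j => ?_) ?_ (fun t ht => abs_sub_path_inv_le hp ht.2) (fun s hs t ht => ?_)
  · have h2 : (fun t => frob (Q - p.Φ.toFun t)⁻¹ (-p.pathDeriv t)) =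
        fun t => -frob (Q - p.Φ.toFun t)⁻¹ (p.pathDeriv t) := by
      funext t; simp [frob]
    rw [h2, intervalIntegral.integral_neg, p.Φ.eq_start 0 le_rfl, sub_zero] at h
    linarith
  · rw [one_mul, abs_sub_comm s t]
    have := (p.Φ.lipschitzWith i j).dist_le_mul t s
    rw [Real.dist_eq, Real.dist_eq, NNReal.coe_one, one_mul] at this
    simpa using this
  · filter_upwards [p.ae_hasDerivAt] with t ht _ i j
    simpa using (ht i j).const_sub (Q i j)
  · exact (sub_path_posDef hp ht.2).log_det_le (sub_path_posDef hp hs.2)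

/-- Under convergence t_x may jump, so neither log|Q - Φ(t_x)| nor the integral up to t_x need
converge by itself. Expressing the logarithm as an integral of (Q - Φ)⁻¹ merges them into an
integrand that vanishes beyond t_x, leaving the fixed interval [0, n]. -/
theorem crisantiSommers_eq {p : OrderParam Q} (hp : p ∈ csDomain Q) (hn : 0 < n)
    (β : ℕ → Fin n → ℝ) (h : Fin n → ℝ) :
    crisantiSommers β h p = 1 / 2 * ((∫ t in (0 : ℝ)..n,
        frob (p.x.toFun t • (xiDeriv β (p.Φ.toFun t) + vecMulVec h h)) (p.pathDeriv t)) +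
      Real.log Q.det + ∫ t in (0 : ℝ)..n, frob (p.invExcess t) (p.pathDeriv t)) := by
  have h0 : (0 : ℝ) ≤ n := Nat.cast_nonneg n
  have hI := fun a b ha hb => p.intervalIntegrable_frob
    (fun i j => intervalIntegrable_invExcess hp (a := a) (b := b) ha hb i j)
  have h1 : ∫ t in p.tx..n, frob (p.invExcess t) (p.pathDeriv t) = 0 := by
    rw [← intervalIntegral.integral_zero (a := p.tx) (b := n) (μ := volume)]
    refine intervalIntegral.integral_congr fun t ht => ?_
    rw [Set.uIcc_of_le p.tx_mem.2] at ht
    simp [p.invExcess_of_tx_le ht.1 ht.2, frob]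
  have h2 : ∫ t in (0 : ℝ)..n, frob (p.invExcess t) (p.pathDeriv t) =
      ∫ t in (0 : ℝ)..p.tx, frob (p.invExcess t) (p.pathDeriv t) := by
    rw [← intervalIntegral.integral_add_adjacent_intervals (hI 0 p.tx h0 p.tx_mem.2)
      (hI p.tx n p.tx_mem.2 le_rfl), h1, add_zero]
  have h3 : ∫ t in (0 : ℝ)..p.tx, frob (p.invExcess t) (p.pathDeriv t) =
      (∫ t in (0 : ℝ)..p.tx, frob (p.pathHat t)⁻¹ (p.pathDeriv t)) -
        (Real.log Q.det - Real.log (Q - p.Φ.toFun p.tx).det) := by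
    rw [← integral_sub_path_inv hp hn, ← intervalIntegral.integral_sub
      (p.intervalIntegrable_frob (intervalIntegrable_pathHat_inv hp))
      (p.intervalIntegrable_frob (intervalIntegrable_sub_path_inv hp))]
    simp only [invExcess, frob_sub_left]
  rw [crisantiSommers, h2, h3, p.Φ.eq_end n le_rfl]
  simp only [frob_smul_left]
  ring

theorem ConvergesTo.tendsto_invExcess (hc : ConvergesTo p q) {K : ℝ} (hK : 0 < K)
    (hp : ∀ k, p k ∈ csDomain Q)
    (hpK : ∀ k, maxEntryNorm (Q - (p k).Φ.toFun (p k).tx)⁻¹ ≤ K)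
    (hq : q ∈ csDomain Q) {t : ℝ} (ht : t ≤ n) :
    Tendsto (fun k => (p k).invExcess t) atTop (𝓝 (q.invExcess t)) := by
  have hX : Tendsto (fun k => Q - (p k).Φ.toFun t) atTop (𝓝 (Q - q.Φ.toFun t)) :=
    tendsto_const_nhds.sub (hc.tendsto_path t)
  have hH := hc.tendsto_pathHat ht
  by_cases hdet : 0 < (Q - q.Φ.toFun t).det
  · have hdet' : 0 < (q.pathHat t).det := by
      rcases le_total q.tx t with h | h
      · rwa [q.pathHat_of_tx_le h ht]
      · exact (pathHat_posDef hq h).det_pos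
    exact (Matrix.tendsto_inv hH hdet'.ne').sub (Matrix.tendsto_inv hX hdet.ne')
  -- When Q - Φ(t) is singular in the limit, t_x of the approximants must eventually be at most t.
  -- Otherwise uniformly bounded inverses along a subsequence would make the limit invertible. Both
  -- sides are then exactly 0.
  · have htx : q.tx ≤ t := by
      by_contra h
      exact hdet (sub_path_posDef hq (not_le.1 h).le).det_pos
    rw [q.invExcess_of_tx_le htx ht]
    have hev : ∀ᶠ k in atTop, (p k).tx ≤ t := by
      by_contra hfreq
      rw [not_eventually] at hfreq
      obtain ⟨φ, hφ, hφt⟩ := extraction_of_frequently_atTop hfreq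
      refine hdet (Matrix.det_pos_of_tendsto (hX.comp hφ.tendsto_atTop) hK
        (Eventually.of_forall fun k => ?_) (Eventually.of_forall fun k i j => ?_)).1
      · exact sub_path_posDef (hp _) (not_le.1 (hφt k)).le
      · exact (abs_sub_path_inv_le (hp _) (not_le.1 (hφt k)).le i j).trans (hpK _)
    refine tendsto_const_nhds.congr' ?_
    filter_upwards [hev] with k hk
    exact ((p k).invExcess_of_tx_le hk ht).symm

theorem exists_abs_xi_le {β : ℕ → Fin n → ℝ}
    (hβ : ∀ j, Summable fun k : ℕ => (2 : ℝ) ^ (k + 2) * β (k + 2) j ^ 2)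
    (hdiag : ∀ j, Q j j = 1) (h : Fin n → ℝ) : ∃ M, ∀ (r : OrderParam Q) t i j,
      |(xiDeriv β (r.Φ.toFun t) + vecMulVec h h) i j| ≤ M := by
  have hterm : ∀ i j, 0 ≤ (∑' k : ℕ, ((k : ℝ) + 2) * |β (k + 2) i * β (k + 2) j|) +
      |h i * h j| := fun i j => add_nonneg (tsum_nonneg fun k => by positivity) (abs_nonneg _)
  refine ⟨∑ i, ∑ j, ((∑' k : ℕ, ((k : ℝ) + 2) * |β (k + 2) i * β (k + 2) j|) + |h i * h j|),
    fun r t i j => ?_⟩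
  rw [Matrix.add_apply, vecMulVec_apply]
  refine (abs_add_le _ _).trans ?_
  refine (add_le_add_left (abs_xiDeriv_le hβ (r.abs_path_le_one hdiag t) i j) _).trans ?_
  refine le_trans ?_ (Finset.single_le_sum
    (f := fun i => ∑ j, ((∑' k : ℕ, ((k : ℝ) + 2) * |β (k + 2) i * β (k + 2) j|) +
      |h i * h j|)) (fun i _ => Finset.sum_nonneg fun j _ => hterm i j) (Finset.mem_univ i))
  exact Finset.single_le_sum
    (f := fun j => (∑' k : ℕ, ((k : ℝ) + 2) * |β (k + 2) i * β (k + 2) j|) +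
      |h i * h j|) (fun j _ => hterm i j) (Finset.mem_univ j)

theorem abs_smul_xi_le {β : ℕ → Fin n → ℝ} {h : Fin n → ℝ} {M : ℝ}
    {p : OrderParam Q} (hbd : ∀ t i j, |(xiDeriv β (p.Φ.toFun t) + vecMulVec h h) i j| ≤ M)
    {c : ℝ} (hc : |c| ≤ 1) (t : ℝ) (i j : Fin n) :
    |(c • (xiDeriv β (p.Φ.toFun t) + vecMulVec h h)) i j| ≤ M := by
  rw [Matrix.smul_apply, smul_eq_mul, abs_mul]
  exact (mul_le_mul hc (hbd t i j) (abs_nonneg _) zero_le_one).trans_eq (one_mul M)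

theorem measurable_smul_xi {β : ℕ → Fin n → ℝ}
    (hβ : ∀ j, Summable fun k : ℕ => (2 : ℝ) ^ (k + 2) * β (k + 2) j ^ 2)
    (hdiag : ∀ j, Q j j = 1) (h : Fin n → ℝ) (p : OrderParam Q) {w : ℝ → ℝ} (hw : Measurable w)
    (i j : Fin n) :
    Measurable fun t => (w t • (xiDeriv β (p.Φ.toFun t) + vecMulVec h h)) i j := by
  simp only [Matrix.smul_apply, smul_eq_mul, Matrix.add_apply]
  exact hw.mul ((p.continuous_xiDeriv hβ hdiag i j).measurable.add_const _)

theorem ConvergesTo.tendsto_crisantiSommers (hc : ConvergesTo p q) (hn : 0 < n)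
    {β : ℕ → Fin n → ℝ}
    (hβ : ∀ j, Summable fun k : ℕ => (2 : ℝ) ^ (k + 2) * β (k + 2) j ^ 2)
    (hdiag : ∀ j, Q j j = 1) (h : Fin n → ℝ) {K : ℝ} (hK : 0 < K)
    (hp : ∀ k, p k ∈ csDomain Q)
    (hpK : ∀ k, maxEntryNorm (Q - (p k).Φ.toFun (p k).tx)⁻¹ ≤ K)
    (hq : q ∈ csDomain Q) (hqK : maxEntryNorm (Q - q.Φ.toFun q.tx)⁻¹ ≤ K) :
    Tendsto (fun k => crisantiSommers β h (p k)) atTop (𝓝 (crisantiSommers β h q)) := by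
  simp only [crisantiSommers_eq (hp _) hn, crisantiSommers_eq hq hn]
  have hnn : (0 : ℝ) ≤ n := Nat.cast_nonneg n
  refine tendsto_const_nhds.mul ((Tendsto.add ?_ tendsto_const_nhds).add ?_)
  · obtain ⟨M, hbd⟩ := exists_abs_xi_le hβ hdiag h
    refine hc.tendsto_integral_frob hnn
      (fun k => measurable_smul_xi hβ hdiag h (p k) (p k).x.measurable)
      (measurable_smul_xi hβ hdiag h q q.x.measurable)
      (fun k t _ => abs_smul_xi_le (hbd (p k)) ((p k).x.abs_le_one t) t)
      (fun t _ => abs_smul_xi_le (hbd q) (q.x.abs_le_one t) t) ?_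
    filter_upwards [hc.1] with t ht _ i j
    simp only [Matrix.smul_apply, smul_eq_mul, Matrix.add_apply]
    exact ht.mul ((tendsto_xiDeriv hβ (fun k => (p k).abs_path_le_one hdiag t)
      (hc.2 t i j)).add_const _)
  · refine hc.tendsto_integral_frob hnn (M := 2 * K) (fun k => (p k).measurable_invExcess)
      q.measurable_invExcess (fun k t ht i j => ?_) (fun t ht i j => ?_)
      (Eventually.of_forall fun t ht => ?_)
    · rw [Set.uIoc_of_le hnn] at ht
      exact abs_invExcess_le (hp k) hK.le (hpK k) ht.2 i j
    · rw [Set.uIoc_of_le hnn] at ht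
      exact abs_invExcess_le hq hK.le hqK ht.2 i j
    · rw [Set.uIoc_of_le hnn] at ht
      exact Matrix.tendsto_iff.1 (hc.tendsto_invExcess hK hp hpK hq ht.2)

end OrderParam

/-! ### Helly selection, compactness and existence of minimizers -/

theorem posSemidef_of_tendsto {n : ℕ} {X : ℕ → Matrix (Fin n) (Fin n) ℝ}
    {Y : Matrix (Fin n) (Fin n) ℝ} (hX : ∀ k, (X k).PosSemidef)
    (h : ∀ i j, Tendsto (fun k => X k i j) atTop (𝓝 (Y i j))) : Y.PosSemidef := by
  refine posSemidef_of_frob_nonneg (fun i j => ?_) fun v => ?_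
  · refine tendsto_nhds_unique (h i j) ((h j i).congr fun k => ?_)
    simpa using (hX k).isHermitian.apply i j
  · have : Tendsto (fun k => frob (vecMulVec v v) (X k)) atTop (𝓝 (frob (vecMulVec v v) Y)) := by
      simp only [frob_eq_sum]
      exact tendsto_finsetSum _ fun i _ => tendsto_finsetSum _ fun j _ => (h j i).const_mul _
    refine ge_of_tendsto' this fun k => ?_
    refine frob_nonneg ?_ (hX k)
    simpa using posSemidef_vecMulVec_self_star v

/-- The right-continuous monotone extension of a monotone limit on the rationals. -/
theorem OverlapCDF.exists_limit {n : ℕ} (x : ℕ → OverlapCDF n) {l : ℚ → ℝ}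
    (hl : ∀ r : ℚ, Tendsto (fun k => (x k).toFun r) atTop (𝓝 (l r))) :
    ∃ y : OverlapCDF n, ∀ᵐ t, Tendsto (fun k => (x k).toFun t) atTop (𝓝 (y.toFun t)) := by
  have hl0 : ∀ r, 0 ≤ l r := fun r => ge_of_tendsto' (hl r) fun k => (x k).nonneg r
  have hl1 : ∀ r, l r ≤ 1 := fun r => le_of_tendsto' (hl r) fun k => (x k).le_one r
  have hne : ∀ t : ℝ, Nonempty {r : ℚ // t < r} := fun t =>
    let ⟨r, hr⟩ := exists_rat_gt t; ⟨⟨r, hr⟩⟩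
  have hbdd : ∀ t : ℝ, BddBelow (Set.range fun r : {r : ℚ // t < r} => l r) := fun t =>
    ⟨0, by rintro _ ⟨r, rfl⟩; exact hl0 r⟩
  -- The infimum over rationals strictly to the right makes y right-continuous.
  set y : ℝ → ℝ := fun t => ⨅ r : {r : ℚ // t < r}, l r with hy
  have hyle : ∀ (t : ℝ) (r : ℚ), t < r → y t ≤ l r := fun t r hr => ciInf_le (hbdd t) ⟨r, hr⟩
  have hylt : ∀ (t c : ℝ), y t < c → ∃ r : ℚ, t < r ∧ l r < c := by
    intro t c hc
    have := hne t
    obtain ⟨⟨r, hr⟩, hrc⟩ := exists_lt_of_ciInf_lt hc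
    exact ⟨r, hr, hrc⟩
  have hmono : Monotone y := by
    intro s t hst
    have := hne t
    exact le_ciInf fun r => hyle s r (lt_of_le_of_lt hst r.2)
  refine ⟨⟨y, hmono, fun t => ?_, fun t ht => ?_, fun t ht => ?_⟩, ?_⟩
  · refine tendsto_order.2 ⟨fun c hc => ?_, fun c hc => ?_⟩
    · filter_upwards [self_mem_nhdsWithin] with s hs
      exact lt_of_lt_of_le hc (hmono hs)
    · obtain ⟨r, hr, hrc⟩ := hylt t c hc
      have : Set.Iio (r : ℝ) ∈ 𝓝[≥] t := mem_nhdsWithin_of_mem_nhds (Iio_mem_nhds hr)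
      filter_upwards [this] with s hs
      exact lt_of_le_of_lt (hyle s r hs) hrc
  · obtain ⟨r, htr, hr0⟩ := exists_rat_btwn ht
    have h0 : l r = 0 := by
      refine tendsto_nhds_unique (hl r) (tendsto_const_nhds.congr fun k => ?_)
      exact ((x k).eq_zero r hr0).symm
    have := hne t
    exact le_antisymm (h0 ▸ hyle t r htr) (le_ciInf fun r => hl0 r)
  · have := hne t
    have h1 : ∀ r : {r : ℚ // t < r}, l r = 1 := fun r =>
      tendsto_nhds_unique (hl r) (tendsto_const_nhds.congr fun k =>
        ((x k).eq_one r (ht.trans r.2.le)).symm)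
    simp [hy, h1]
  -- Convergence holds at every continuity point of y, hence off a countable set.
  · have hcount := hmono.countable_not_continuousAt
    filter_upwards [hcount.ae_notMem volume] with t ht
    have hcont : ContinuousAt y t := by simpa using ht
    refine tendsto_order.2 ⟨fun c hc => ?_, fun c hc => ?_⟩
    · have hev := hcont.tendsto.eventually (lt_mem_nhds hc)
      have hlt : ∀ᶠ s in 𝓝[<] t, s < t := self_mem_nhdsWithin
      obtain ⟨s, hs, hst⟩ := ((hev.filter_mono nhdsWithin_le_nhds).and hlt).exists
      obtain ⟨r, hsr, hrt⟩ := exists_rat_btwn hst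
      filter_upwards [(hl r).eventually (lt_mem_nhds (lt_of_lt_of_le hs (hyle s r hsr)))] with k hk
      exact lt_of_lt_of_le hk ((x k).monotone hrt.le)
    · obtain ⟨r, hr, hrc⟩ := hylt t c hc
      filter_upwards [(hl r).eventually (gt_mem_nhds hrc)] with k hk
      exact lt_of_le_of_lt ((x k).monotone hr.le) hk

theorem MatrixPath.exists_limit {n : ℕ} {Q : Matrix (Fin n) (Fin n) ℝ} (Φ : ℕ → MatrixPath Q)
    {l : ℚ → Fin n → Fin n → ℝ}
    (hl : ∀ (r : ℚ) i j, Tendsto (fun k => (Φ k).toFun r i j) atTop (𝓝 (l r i j))) :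
    ∃ Ψ : MatrixPath Q, ∀ t i j, Tendsto (fun k => (Φ k).toFun t i j) atTop
      (𝓝 (Ψ.toFun t i j)) := by
  have hex : ∀ (t : ℝ) (i j : Fin n), ∃ a, Tendsto (fun k => (Φ k).toFun t i j) atTop (𝓝 a) := by
    intro t i j
    refine cauchySeq_tendsto_of_complete (Metric.cauchySeq_iff'.2 fun ε hε => ?_)
    -- The common Lipschitz constant carries the Cauchy property from rational to real times.
    obtain ⟨r, htr, hrt⟩ := exists_rat_btwn (show t < t + ε / 4 by linarith)
    obtain ⟨N, hN⟩ := Metric.cauchySeq_iff'.1 (hl r i j).cauchySeq (ε / 4) (by linarith)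
    refine ⟨N, fun k hk => ?_⟩
    have h1 := hN k hk
    have h2 : ∀ k, |(Φ k).toFun t i j - (Φ k).toFun r i j| ≤ ε / 4 := by
      intro k
      have := ((Φ k).lipschitzWith i j).dist_le_mul t r
      rw [Real.dist_eq, Real.dist_eq, NNReal.coe_one, one_mul] at this
      refine this.trans ?_
      rw [abs_le]; constructor <;> linarith
    have h3 := abs_le.1 (h2 k)
    have h4 := abs_le.1 (h2 N)
    rw [Real.dist_eq, abs_lt] at h1 ⊢
    constructor <;> linarith [h1.1, h1.2, h3.1, h3.2, h4.1, h4.2]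
  choose Ψ hΨ using hex
  refine ⟨⟨fun t => Matrix.of (Ψ t), fun t _ => ?_, fun s _ t _ hst => ?_, fun s hs t ht i j => ?_,
    fun t ht => ?_, fun t ht => ?_, fun t ht => ?_⟩, hΨ⟩
  · exact posSemidef_of_tendsto (fun k => (Φ k).posSemidef' t) (hΨ t)
  · exact posSemidef_of_tendsto (fun k => (Φ k).sub_posSemidef hst)
      fun i j => (hΨ t i j).sub (hΨ s i j)
  · exact le_of_tendsto' ((hΨ t i j).sub (hΨ s i j)).abs fun k => (Φ k).lipschitz s hs t ht i j
  · have : Tendsto (fun k => ((Φ k).toFun t).trace) atTop (𝓝 (Matrix.of (Ψ t)).trace) :=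
      tendsto_finsetSum _ fun i _ => hΨ t i i
    exact tendsto_nhds_unique this (tendsto_const_nhds.congr fun k => ((Φ k).trace_eq t ht).symm)
  · ext i j
    refine tendsto_nhds_unique (hΨ t i j) (tendsto_const_nhds.congr fun k => ?_)
    rw [(Φ k).eq_start t ht]
  · ext i j
    refine tendsto_nhds_unique (hΨ t i j) (tendsto_const_nhds.congr fun k => ?_)
    rw [(Φ k).eq_end t ht]

namespace OrderParam

variable {n : ℕ} {Q : Matrix (Fin n) (Fin n) ℝ}

/-- Helly's selection theorem for order parameters. -/
theorem exists_subseq_convergesTo (p : ℕ → OrderParam Q) :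
    ∃ (q : OrderParam Q) (φ : ℕ → ℕ), StrictMono φ ∧ ConvergesTo (p ∘ φ) q := by
  set u : ℕ → (ℚ ⊕ ℚ × Fin n × Fin n) → ℝ := fun k =>
    Sum.elim (fun r => (p k).x.toFun r) fun s => (p k).Φ.toFun s.1 s.2.1 s.2.2 with hu
  -- The index set is countable, so this compact product also has convergent subsequences. The
  -- radius n + 1 covers both x ≤ 1 and path entries of size at most n.
  have hK : IsCompact (Set.pi Set.univ fun _ : ℚ ⊕ ℚ × Fin n × Fin n =>
      Set.Icc (-(n + 1 : ℝ)) (n + 1)) := isCompact_univ_pi fun _ => isCompact_Icc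
  have hn : (0 : ℝ) ≤ n := Nat.cast_nonneg n
  obtain ⟨l, -, φ, hφ, hlim⟩ := hK.tendsto_subseq (x := u) (fun k => by
    rintro (r | s) -
    · have h1 := (p k).x.nonneg r
      have h2 := (p k).x.le_one r
      exact ⟨by simp only [hu, Sum.elim_inl]; linarith, by simp only [hu, Sum.elim_inl]; linarith⟩
    · have h1 := abs_le.1 ((p k).Φ.abs_apply_le s.1 s.2.1 s.2.2)
      exact ⟨by simp only [hu, Sum.elim_inr]; linarith [h1.1],
        by simp only [hu, Sum.elim_inr]; linarith [h1.2]⟩)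
  have hlim' := tendsto_pi_nhds.1 hlim
  obtain ⟨y, hy⟩ := OverlapCDF.exists_limit (fun k => (p (φ k)).x) (l := fun r => l (Sum.inl r))
    fun r => hlim' (Sum.inl r)
  obtain ⟨Ψ, hΨ⟩ := MatrixPath.exists_limit (fun k => (p (φ k)).Φ)
    (l := fun r i j => l (Sum.inr (r, i, j))) fun r i j => hlim' (Sum.inr (r, i, j))
  exact ⟨⟨y, Ψ⟩, φ, hφ, hy, hΨ⟩

variable {p : ℕ → OrderParam Q} {q : OrderParam Q}

/-- Lower semicontinuity of t_x: x < 1 is an open condition at a point of convergence, and such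
points are dense. The limit may reach 1 earlier than the approximants, so only this half is
asserted. -/
theorem ConvergesTo.eventually_lt_tx (hc : ConvergesTo p q) {t : ℝ} (ht : t < q.tx) :
    ∀ᶠ k in atTop, t < (p k).tx := by
  obtain ⟨s, hs, hts, hsq⟩ := (Measure.dense_of_ae hc.1).exists_between ht
  filter_upwards [(hs : Tendsto _ _ _).eventually (gt_mem_nhds (q.lt_one_of_lt_tx hsq))] with k hk
  by_contra h
  exact hk.ne ((p k).eq_one_of_tx_le ((not_lt.1 h).trans hts.le))

theorem ConvergesTo.tendsto_min_tx (hc : ConvergesTo p q) :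
    Tendsto (fun k => min q.tx (p k).tx) atTop (𝓝 q.tx) := by
  refine tendsto_order.2 ⟨fun a ha => ?_, fun a ha => ?_⟩
  · filter_upwards [hc.eventually_lt_tx ha] with k hk using lt_min ha hk
  · exact Eventually.of_forall fun k => lt_of_le_of_lt (min_le_left _ _) ha

/-- The maximum with 0 accounts for a negative T, where the condition on [0, n] says t_x = 0. -/
theorem mem_boundedParams_iff {p : OrderParam Q} {T L : ℝ} (hT : T ≤ n) :
    p ∈ boundedParams Q T L ↔ p ∈ csDomain Q ∧ p.tx ≤ max 0 T ∧
      maxEntryNorm (Q - p.Φ.toFun p.tx)⁻¹ ≤ L := by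
  have hn : (0 : ℝ) ≤ n := Nat.cast_nonneg n
  refine and_congr_right fun _ => and_congr_left fun _ => ⟨fun h => ?_, fun h t ht hTt => ?_⟩
  · exact p.tx_le (le_max_left _ _) (h _ ⟨le_max_left _ _, max_le hn hT⟩ (le_max_right _ _))
  · exact p.eq_one_of_tx_le (h.trans (max_le ht.1 hTt))

theorem ConvergesTo.mem_boundedParams (hc : ConvergesTo p q) (hn : 0 < n) {T L : ℝ} (hT : T ≤ n)
    (hL : 0 < L) (hp : ∀ k, p k ∈ boundedParams Q T L) : q ∈ boundedParams Q T L := by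
  simp only [mem_boundedParams_iff hT] at hp ⊢
  -- Evaluating at the smaller of the two stopping points keeps the approximating matrices above
  -- their own gaps, with inverses bounded by L, while the points still converge to t_x of the
  -- limit.
  have hX : Tendsto (fun k => Q - (p k).Φ.toFun (min q.tx (p k).tx)) atTop
      (𝓝 (Q - q.Φ.toFun q.tx)) := by
    refine tendsto_const_nhds.sub (Matrix.tendsto_iff.2 fun i j => ?_)
    have h1 : Tendsto (fun k => (p k).Φ.toFun (min q.tx (p k).tx) i j - (p k).Φ.toFun q.tx i j)
        atTop (𝓝 0) := by
      have h2 : Tendsto (fun k => |min q.tx (p k).tx - q.tx|) atTop (𝓝 0) := by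
        simpa using (hc.tendsto_min_tx.sub_const q.tx).abs
      refine squeeze_zero_norm (fun k => ?_) h2
      have := ((p k).Φ.lipschitzWith i j).dist_le_mul (min q.tx (p k).tx) q.tx
      rwa [Real.dist_eq, Real.dist_eq, NNReal.coe_one, one_mul] at this
    simpa using h1.add (hc.2 q.tx i j)
  obtain ⟨hdet, hb⟩ := Matrix.det_pos_of_tendsto hX hL
    (Eventually.of_forall fun k => sub_path_posDef (hp k).1 (min_le_right _ _))
    (Eventually.of_forall fun k i j =>
      (abs_sub_path_inv_le (hp k).1 (min_le_right _ _) i j).trans (hp k).2.2)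
  refine ⟨hdet, ?_, maxEntryNorm_le hn hb⟩
  by_contra h
  obtain ⟨k, hk⟩ := (hc.eventually_lt_tx (not_le.1 h)).exists
  exact absurd (hp k).2.1 (not_le.2 hk)

theorem ConvergesTo.tendsto (hc : ConvergesTo p q) : Tendsto p atTop (𝓝 q) := by
  have hn : (0 : ℝ) ≤ n := Nat.cast_nonneg n
  have hX : Tendsto (fun k => distX (p k) q) atTop (𝓝 0) := by
    have h0 : (0 : ℝ) = ∫ _t in (0 : ℝ)..n, (0 : ℝ) := by simp
    rw [h0]
    refine intervalIntegral.tendsto_integral_filter_of_dominated_convergence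
      (fun _ => 1) ?_ ?_ intervalIntegrable_const ?_
    · exact Eventually.of_forall fun k =>
        (((p k).x.measurable.sub q.x.measurable).norm).aestronglyMeasurable
    · refine Eventually.of_forall fun k => Eventually.of_forall fun t _ => ?_
      rw [Real.norm_eq_abs, abs_abs, abs_le]
      constructor <;> linarith [(p k).x.nonneg t, (p k).x.le_one t, q.x.nonneg t, q.x.le_one t]
    · filter_upwards [hc.1] with t ht _
      simpa using (ht.sub_const (q.x.toFun t)).abs
  have hP : Tendsto (fun k => distPath (p k) q) atTop (𝓝 0) := by
    rw [Metric.tendsto_atTop]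
    intro ε hε
    -- A finite net and the common Lipschitz constant upgrade pointwise to uniform convergence.
    obtain ⟨S, -, hSfin, hS⟩ := (isCompact_Icc (a := (0 : ℝ)) (b := n)).finite_cover_balls
      (show 0 < ε / 4 by linarith)
    have hev : ∀ᶠ k in atTop, ∀ s ∈ S, ∀ i j,
        |(p k).Φ.toFun s i j - q.Φ.toFun s i j| < ε / 4 := by
      rw [hSfin.eventually_all]
      intro s _
      rw [eventually_all]; intro i
      rw [eventually_all]; intro j
      have := Metric.tendsto_nhds.1 (hc.2 s i j) (ε / 4) (by linarith)
      simpa [Real.dist_eq] using this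
    obtain ⟨N, hN⟩ := eventually_atTop.1 hev
    refine ⟨N, fun k hk => ?_⟩
    have hle : distPath (p k) q ≤ 3 * (ε / 4) := by
      refine Real.iSup_le ?_ (by linarith)
      rintro ⟨⟨t, ht⟩, i, j⟩
      obtain ⟨s, hs, hts⟩ := Set.mem_iUnion₂.1 (hS ht)
      rw [Metric.mem_ball, Real.dist_eq] at hts
      have hlip : ∀ r : OrderParam Q, |r.Φ.toFun t i j - r.Φ.toFun s i j| ≤ ε / 4 := by
        intro r
        have := (r.Φ.lipschitzWith i j).dist_le_mul t s
        rw [Real.dist_eq, Real.dist_eq, NNReal.coe_one, one_mul] at this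
        exact this.trans hts.le
      have h1 := abs_le.1 (hlip (p k))
      have h2 := abs_le.1 (hlip q)
      have h3 := abs_lt.1 (hN k hk s hs i j)
      simp only
      rw [abs_le]
      constructor <;> linarith [h1.1, h1.2, h2.1, h2.2, h3.1, h3.2]
    have h0 : 0 ≤ distPath (p k) q := Real.iSup_nonneg fun _ => abs_nonneg _
    rw [Real.dist_eq, sub_zero, abs_of_nonneg h0]
    linarith
  rw [tendsto_iff_dist_tendsto_zero]
  have := hX.add hP
  rw [add_zero] at this
  exact this

theorem isCompact_boundedParams (hn : 0 < n) {T L : ℝ} (hT : T ≤ n) (hL : 0 < L) :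
    IsCompact (boundedParams Q T L) := by
  refine IsSeqCompact.isCompact fun p hp => ?_
  obtain ⟨q, φ, hφ, hc⟩ := exists_subseq_convergesTo p
  exact ⟨q, hc.mem_boundedParams hn hT hL fun k => hp (φ k), φ, hφ, hc.tendsto⟩

theorem exists_isMinOn_boundedParams (hn : 0 < n) {β : ℕ → Fin n → ℝ}
    (hβ : ∀ j, Summable fun k : ℕ => (2 : ℝ) ^ (k + 2) * β (k + 2) j ^ 2)
    (hdiag : ∀ j, Q j j = 1) (h : Fin n → ℝ) {T L : ℝ} (hT : T ≤ n) (hL : 0 < L)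
    (hne : (boundedParams Q T L).Nonempty) :
    ∃ p ∈ boundedParams Q T L, IsMinOn (crisantiSommers β h) (boundedParams Q T L) p := by
  have hcomp : IsCompact (crisantiSommers β h '' boundedParams Q T L) := by
    refine IsSeqCompact.isCompact fun v hv => ?_
    choose p hp hpv using hv
    obtain ⟨q, φ, hφ, hc⟩ := exists_subseq_convergesTo p
    have hq := hc.mem_boundedParams hn hT hL fun k => hp (φ k)
    refine ⟨_, ⟨q, hq, rfl⟩, φ, hφ, ?_⟩
    have := hc.tendsto_crisantiSommers hn hβ hdiag h hL (fun k => (hp (φ k)).1)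
      (fun k => (hp (φ k)).2.2) hq.1 hq.2.2
    refine this.congr fun k => ?_
    exact hpv (φ k)
  obtain ⟨_, ⟨p, hp, rfl⟩, hmin⟩ := hcomp.exists_isLeast (hne.image _)
  exact ⟨p, hp, fun r hr => hmin ⟨r, hr, rfl⟩⟩

end OrderParam

/-! ### First variation under dilation of the distribution function -/

theorem abs_mul_apply_le {n : ℕ} {A B : Matrix (Fin n) (Fin n) ℝ} {a b : ℝ}
    (hA : ∀ i j, |A i j| ≤ a) (hB : ∀ i j, |B i j| ≤ b) (ha : 0 ≤ a) (i j : Fin n) :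
    |(A * B) i j| ≤ n * (a * b) := by
  rw [Matrix.mul_apply]
  calc |∑ k, A i k * B k j| ≤ ∑ k, |A i k * B k j| := Finset.abs_sum_le_sum_abs _ _
    _ ≤ ∑ _k : Fin n, a * b := by
        refine Finset.sum_le_sum fun k _ => ?_
        rw [abs_mul]
        exact mul_le_mul (hA i k) (hB k j) (abs_nonneg _) ha
    _ = n * (a * b) := by simp

/-- The distribution function of the point mass at `0`. -/
noncomputable def OverlapCDF.dirac (n : ℕ) : OverlapCDF n where
  toFun t := if t < 0 then 0 else 1
  monotone s t hst := by
    dsimp only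
    split_ifs with h1 h2 h2
    · exact le_rfl
    · exact zero_le_one
    · exact absurd (lt_of_le_of_lt hst h2) h1
    · exact le_rfl
  right_continuous t := by
    rcases lt_or_ge t 0 with h | h
    · refine (continuousAt_const (y := (0 : ℝ))).continuousWithinAt.congr_of_eventuallyEq ?_ (if_pos h)
      filter_upwards [mem_nhdsWithin_of_mem_nhds (Iio_mem_nhds h)] with s hs using if_pos hs
    · refine continuousWithinAt_const.congr (f := fun _ => (1 : ℝ)) (fun s hs => ?_) (if_neg h.not_gt)
      exact if_neg (h.trans hs).not_gt
  eq_zero t ht := if_pos ht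
  eq_one t ht := if_neg ((Nat.cast_nonneg n).trans ht).not_gt

/-- The truncated dilation `min ((1 + ε) x) 1`. -/
noncomputable def OverlapCDF.dilate {n : ℕ} (x : OverlapCDF n) (ε : ℝ) (hε : 0 ≤ ε) :
    OverlapCDF n where
  toFun t := min ((1 + ε) * x.toFun t) 1
  monotone s t hst := min_le_min_right _ (mul_le_mul_of_nonneg_left (x.monotone hst) (by linarith))
  right_continuous t := ((x.right_continuous t).const_mul _).min continuousWithinAt_const
  eq_zero t ht := by simp [x.eq_zero t ht]
  eq_one t ht := by rw [x.eq_one t ht, mul_one]; exact min_eq_right (by linarith)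

theorem OverlapCDF.le_dilate {n : ℕ} (x : OverlapCDF n) {ε : ℝ} (hε : 0 ≤ ε) (t : ℝ) :
    x.toFun t ≤ (x.dilate ε hε).toFun t :=
  le_min (by nlinarith [x.nonneg t]) (x.le_one t)

theorem OverlapCDF.dilate_le {n : ℕ} (x : OverlapCDF n) {ε : ℝ} (hε : 0 ≤ ε) (t : ℝ) :
    (x.dilate ε hε).toFun t ≤ x.toFun t + ε := by
  refine (min_le_left _ _).trans ?_
  nlinarith [x.le_one t]

namespace OrderParam

variable {n : ℕ} {Q : Matrix (Fin n) (Fin n) ℝ} (p : OrderParam Q)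

/-- The order parameter with dilated distribution function. -/
noncomputable def dilate (ε : ℝ) (hε : 0 ≤ ε) : OrderParam Q := ⟨p.x.dilate ε hε, p.Φ⟩

/-- Dilation raises x, so 1 is reached no later. Hence the gap increases and every bound on its
inverse is inherited, making dilations admissible competitors. -/
theorem tx_dilate_le (ε : ℝ) (hε : 0 ≤ ε) : (p.dilate ε hε).tx ≤ p.tx := by
  refine tx_le _ p.tx_mem.1 ?_
  refine le_antisymm (OverlapCDF.le_one _ _) ?_
  rw [← p.eq_one_of_tx_le le_rfl]
  exact p.x.le_dilate hε _

theorem gap_dilate_posSemidef (ε : ℝ) (hε : 0 ≤ ε) :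
    ((Q - (p.dilate ε hε).Φ.toFun (p.dilate ε hε).tx) - (Q - p.Φ.toFun p.tx)).PosSemidef :=
  p.gap_posSemidef (p.tx_dilate_le ε hε)

variable {p}

theorem dilate_mem_csDomain (hp : p ∈ csDomain Q) (ε : ℝ) (hε : 0 ≤ ε) :
    p.dilate ε hε ∈ csDomain Q :=
  ((gap_posDef hp).mono (p.gap_dilate_posSemidef ε hε)).det_pos

theorem maxEntryNorm_dilate_le (hn : 0 < n) (hp : p ∈ csDomain Q) (ε : ℝ) (hε : 0 ≤ ε) :
    maxEntryNorm (Q - (p.dilate ε hε).Φ.toFun (p.dilate ε hε).tx)⁻¹ ≤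
      maxEntryNorm (Q - p.Φ.toFun p.tx)⁻¹ :=
  maxEntryNorm_le hn fun i j =>
    (gap_posDef hp).abs_inv_apply_le_maxEntryNorm (p.gap_dilate_posSemidef ε hε) i j

theorem pathHat_dilate_sub (ε : ℝ) (hε : 0 ≤ ε) (t : ℝ) :
    (p.dilate ε hε).pathHat t - p.pathHat t =
      p.weightedIncrement (fun s => (p.dilate ε hε).x.toFun s - p.x.toFun s) t n :=
  (p.weightedIncrement_sub (OrderParam.intervalIntegrable_x_toFun _ _ _)
    (p.intervalIntegrable_x_toFun _ _)).symm

theorem pathHat_dilate_posSemidef (ε : ℝ) (hε : 0 ≤ ε) {t : ℝ} (ht : t ≤ p.tx) :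
    ((p.dilate ε hε).pathHat t - (Q - p.Φ.toFun p.tx)).PosSemidef := by
  have h1 := p.weightedIncrement_posSemidef (ht.trans p.tx_mem.2)
    ((OrderParam.intervalIntegrable_x_toFun (p.dilate ε hε) t n).sub
      (p.intervalIntegrable_x_toFun t n)) fun s _ => sub_nonneg.2 (p.x.le_dilate hε s)
  rw [← pathHat_dilate_sub] at h1
  have := h1.add (p.pathHat_sub_gap_posSemidef ht)
  rwa [sub_add_sub_cancel] at this

theorem weightedIncrement_smul (c : ℝ) (w : ℝ → ℝ) (a b : ℝ) :
    p.weightedIncrement (fun s => c * w s) a b = c • p.weightedIncrement w a b := by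
  ext i j
  simp only [weightedIncrement, Matrix.of_apply, Matrix.smul_apply, smul_eq_mul, mul_assoc]
  exact intervalIntegral.integral_const_mul _ _

theorem dilation_nonneg (k : ℕ) : (0 : ℝ) ≤ 1 / ((k : ℝ) + 1) := by positivity

/-- The sequence of dilations with parameter `1 / (k + 1)`. -/
noncomputable def dilateSeq (p : OrderParam Q) (k : ℕ) : OrderParam Q :=
  p.dilate (1 / ((k : ℝ) + 1)) (dilation_nonneg k)

/-- The difference quotient of the dilated distribution functions. -/
noncomputable def dilationQuot (p : OrderParam Q) (k : ℕ) (t : ℝ) : ℝ :=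
  ((k : ℝ) + 1) * ((p.dilateSeq k).x.toFun t - p.x.toFun t)

theorem measurable_dilationQuot (k : ℕ) : Measurable (p.dilationQuot k) :=
  ((p.dilateSeq k).x.measurable.sub p.x.measurable).const_mul _

theorem abs_dilationQuot_le (k : ℕ) (t : ℝ) : |p.dilationQuot k t| ≤ 1 := by
  have h1 : p.x.toFun t ≤ (p.dilateSeq k).x.toFun t := p.x.le_dilate (dilation_nonneg k) t
  have h2 : (p.dilateSeq k).x.toFun t ≤ p.x.toFun t + 1 / ((k : ℝ) + 1) :=
    p.x.dilate_le (dilation_nonneg k) t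
  have hk : (0 : ℝ) < (k : ℝ) + 1 := by positivity
  rw [dilationQuot, abs_mul, abs_of_pos hk]
  have h3 : |(p.dilateSeq k).x.toFun t - p.x.toFun t| ≤ 1 / ((k : ℝ) + 1) := by
    rw [abs_of_nonneg (sub_nonneg.2 h1)]
    exact sub_le_iff_le_add'.2 h2
  calc ((k : ℝ) + 1) * |(p.dilateSeq k).x.toFun t - p.x.toFun t|
      ≤ ((k : ℝ) + 1) * (1 / ((k : ℝ) + 1)) := mul_le_mul_of_nonneg_left h3 hk.le
    _ = 1 := by field_simp

theorem dilationQuot_of_tx_le {t : ℝ} (h : p.tx ≤ t) (k : ℕ) : p.dilationQuot k t = 0 := by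
  have h1 : (p.dilateSeq k).x.toFun t = 1 :=
    (p.dilateSeq k).eq_one_of_tx_le ((p.tx_dilate_le _ (dilation_nonneg k)).trans h)
  rw [dilationQuot, p.eq_one_of_tx_le h, h1, sub_self, mul_zero]

theorem tendsto_dilation : Tendsto (fun k : ℕ => 1 / ((k : ℝ) + 1)) atTop (𝓝 0) :=
  tendsto_one_div_add_atTop_nhds_zero_nat

/-- Before t_x one has x(t) < 1, so the truncation is inactive for small ε and the quotient equals
x(t); from t_x on nothing changes. -/
theorem tendsto_dilationQuot (t : ℝ) :
    Tendsto (fun k => p.dilationQuot k t) atTop (𝓝 (if t < p.tx then p.x.toFun t else 0)) := by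
  split_ifs with h
  · have hlim : Tendsto (fun k : ℕ => (1 + 1 / ((k : ℝ) + 1)) * p.x.toFun t) atTop
        (𝓝 (p.x.toFun t)) := by
      have := (tendsto_dilation.const_add 1).mul_const (p.x.toFun t)
      simpa using this
    refine tendsto_const_nhds.congr' ?_
    filter_upwards [hlim.eventually (gt_mem_nhds (p.lt_one_of_lt_tx h))] with k hk
    have hk0 : (k : ℝ) + 1 ≠ 0 := by positivity
    have h1 : (p.dilateSeq k).x.toFun t = (1 + 1 / ((k : ℝ) + 1)) * p.x.toFun t :=
      min_eq_left hk.le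
    rw [dilationQuot, h1]
    field_simp
    ring
  · simp only [dilationQuot_of_tx_le (not_lt.1 h)]
    exact tendsto_const_nhds

theorem convergesTo_dilateSeq : ConvergesTo p.dilateSeq p := by
  refine ⟨Eventually.of_forall fun t => ?_, fun t i j => tendsto_const_nhds⟩
  have h1 := tendsto_dilation.mul (p.tendsto_dilationQuot t)
  rw [zero_mul] at h1
  have h2 := h1.add_const (p.x.toFun t)
  rw [zero_add] at h2
  refine h2.congr fun k => ?_
  have hk0 : (k : ℝ) + 1 ≠ 0 := by positivity
  rw [dilationQuot]
  field_simp
  ring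

theorem convergesTo_const : ConvergesTo (fun _ => p) p :=
  ⟨Eventually.of_forall fun _ => tendsto_const_nhds, fun _ _ _ => tendsto_const_nhds⟩

theorem measurable_ite_x : Measurable fun t => if t < p.tx then p.x.toFun t else 0 :=
  Measurable.ite measurableSet_Iio p.x.measurable measurable_const

theorem abs_ite_x_le (t : ℝ) : |if t < p.tx then p.x.toFun t else 0| ≤ 1 := by
  split_ifs
  · exact p.x.abs_le_one t
  · simp

/-- The derivative of `Φ̂` under dilation. -/
theorem tendsto_pathHat_dilate {t : ℝ} (ht : t ≤ p.tx) :
    Tendsto (fun k : ℕ => ((k : ℝ) + 1) • ((p.dilateSeq k).pathHat t - p.pathHat t)) atTop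
      (𝓝 (p.pathHat t - (Q - p.Φ.toFun p.tx))) := by
  have h1 : ∀ k : ℕ, ((k : ℝ) + 1) • ((p.dilateSeq k).pathHat t - p.pathHat t) =
      p.weightedIncrement (p.dilationQuot k) t n := by
    intro k
    rw [dilateSeq, pathHat_dilate_sub, ← weightedIncrement_smul]
    rfl
  have h2 : p.pathHat t - (Q - p.Φ.toFun p.tx) =
      p.weightedIncrement (fun s => if s < p.tx then p.x.toFun s else 0) t n := by
    rw [← p.pathHat_of_tx_le le_rfl p.tx_mem.2, pathHat_sub_pathHat]
    ext i j
    simp only [weightedIncrement, Matrix.of_apply]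
    have hw : ∀ a b, IntervalIntegrable (fun s => if s < p.tx then p.x.toFun s else 0) volume a b :=
      fun a b => intervalIntegrable_of_abs_le measurable_ite_x.aestronglyMeasurable
        fun s _ => abs_ite_x_le s
    have hI := fun a b => p.intervalIntegrable_mul_pathDeriv (hw a b) i j
    rw [← intervalIntegral.integral_add_adjacent_intervals (hI t p.tx) (hI p.tx n)]
    have h3 : ∫ s in p.tx..n, (if s < p.tx then p.x.toFun s else 0) * p.pathDeriv s i j = 0 := by
      rw [← intervalIntegral.integral_zero (a := p.tx) (b := n) (μ := volume)]
      refine intervalIntegral.integral_congr fun s hs => ?_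
      rw [Set.uIcc_of_le p.tx_mem.2] at hs
      simp [not_lt.2 hs.1]
    rw [h3, add_zero]
    refine intervalIntegral.integral_congr_ae ?_
    have hne : ∀ᵐ s : ℝ, s ≠ p.tx := by simp [ae_iff, measure_singleton]
    filter_upwards [hne] with s hs hmem
    rw [Set.uIoc_of_le ht] at hmem
    rw [if_pos (lt_of_le_of_ne hmem.2 hs)]
  simp only [h1, h2]
  refine Matrix.tendsto_iff.2 fun i j => ?_
  exact convergesTo_const.tendsto_integral (ht.trans p.tx_mem.2) measurable_dilationQuot
    measurable_ite_x (fun k s _ => abs_dilationQuot_le k s) (fun s _ => abs_ite_x_le s)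
    (Eventually.of_forall fun s _ => tendsto_dilationQuot s) i j

theorem abs_pathHat_dilate_le {t : ℝ} (h0 : 0 ≤ t) (ht : t ≤ n) (k : ℕ) (i j : Fin n) :
    |(((k : ℝ) + 1) • ((p.dilateSeq k).pathHat t - p.pathHat t)) i j| ≤ n := by
  rw [dilateSeq, pathHat_dilate_sub, ← weightedIncrement_smul, weightedIncrement, Matrix.of_apply]
  have := intervalIntegral.norm_integral_le_of_norm_le_const (a := t) (b := (n : ℝ)) (C := 1)
    (f := fun s => p.dilationQuot k s * p.pathDeriv s i j) (fun s _ => ?_)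
  · rw [one_mul, abs_of_nonneg (sub_nonneg.2 ht)] at this
    refine le_trans this (by linarith)
  · rw [Real.norm_eq_abs, abs_mul]
    exact mul_le_one₀ (abs_dilationQuot_le k s) (abs_nonneg _) (p.abs_pathDeriv_le s i j)

/-- The resolvent identity, which turns the difference quotient of Φ̂⁻¹ into that of Φ̂ between
bounded factors. -/
theorem smul_inv_sub_inv {A B : Matrix (Fin n) (Fin n) ℝ} (hA : A.PosDef) (hB : B.PosDef) (c : ℝ) :
    c • (A⁻¹ - B⁻¹) = -(A⁻¹ * (c • (A - B)) * B⁻¹) := by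
  rw [Matrix.mul_smul, Matrix.smul_mul, Matrix.mul_sub, Matrix.sub_mul, hA.inv_mul_self,
    Matrix.one_mul, Matrix.mul_assoc, hB.mul_inv_self, Matrix.mul_one]
  module

theorem pathHat_dilateSeq_posDef (hp : p ∈ csDomain Q) {t : ℝ} (ht : t ≤ p.tx) (k : ℕ) :
    ((p.dilateSeq k).pathHat t).PosDef :=
  (gap_posDef hp).mono (pathHat_dilate_posSemidef _ _ ht)

theorem invExcess_dilateSeq_sub (hp : p ∈ csDomain Q) {t : ℝ} (ht : t ≤ p.tx) (k : ℕ) :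
    ((k : ℝ) + 1) • ((p.dilateSeq k).invExcess t - p.invExcess t) =
      -(((p.dilateSeq k).pathHat t)⁻¹ *
        (((k : ℝ) + 1) • ((p.dilateSeq k).pathHat t - p.pathHat t)) * (p.pathHat t)⁻¹) := by
  rw [← smul_inv_sub_inv (pathHat_dilateSeq_posDef hp ht k) (pathHat_posDef hp ht)]
  have : (p.dilateSeq k).invExcess t - p.invExcess t =
      ((p.dilateSeq k).pathHat t)⁻¹ - (p.pathHat t)⁻¹ := sub_sub_sub_cancel_right _ _ _
  rw [this]

theorem invExcess_dilateSeq_sub_of_tx_le {t : ℝ} (h : p.tx ≤ t) (ht : t ≤ n) (k : ℕ) :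
    ((k : ℝ) + 1) • ((p.dilateSeq k).invExcess t - p.invExcess t) = 0 := by
  rw [p.invExcess_of_tx_le h ht, OrderParam.invExcess_of_tx_le (p.dilateSeq k)
    ((p.tx_dilate_le _ (dilation_nonneg k)).trans h) ht, sub_self, smul_zero]

theorem dilateSeq_mem_csDomain (hp : p ∈ csDomain Q) (k : ℕ) : p.dilateSeq k ∈ csDomain Q :=
  dilate_mem_csDomain hp _ (dilation_nonneg k)

theorem abs_invExcess_dilateSeq_sub_le (hn : 0 < n) (hp : p ∈ csDomain Q) {t : ℝ} (h0 : 0 ≤ t)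
    (ht : t ≤ n) (k : ℕ) (i j : Fin n) :
    |(((k : ℝ) + 1) • ((p.dilateSeq k).invExcess t - p.invExcess t)) i j| ≤
      n * (n * (maxEntryNorm (Q - p.Φ.toFun p.tx)⁻¹ * n) *
        maxEntryNorm (Q - p.Φ.toFun p.tx)⁻¹) := by
  have hK : 0 ≤ maxEntryNorm (Q - p.Φ.toFun p.tx)⁻¹ :=
    (abs_nonneg _).trans (abs_apply_le_maxEntryNorm _ i j)
  rcases le_total p.tx t with h | h
  · rw [invExcess_dilateSeq_sub_of_tx_le h ht, Matrix.zero_apply, abs_zero]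
    positivity
  · rw [invExcess_dilateSeq_sub hp h, Matrix.neg_apply, abs_neg]
    refine abs_mul_apply_le (abs_mul_apply_le (fun i j => ?_) (abs_pathHat_dilate_le h0 ht k) hK)
      (abs_pathHat_inv_le hp h) (by positivity) i j
    exact (gap_posDef hp).abs_inv_apply_le_maxEntryNorm (pathHat_dilate_posSemidef _ _ h) i j

theorem tendsto_invExcess_dilateSeq (hp : p ∈ csDomain Q) {t : ℝ} (ht : t ≤ p.tx) :
    Tendsto (fun k : ℕ => ((k : ℝ) + 1) • ((p.dilateSeq k).invExcess t - p.invExcess t)) atTop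
      (𝓝 (-((p.pathHat t)⁻¹ -
        (p.pathHat t)⁻¹ * (Q - p.Φ.toFun p.tx) * (p.pathHat t)⁻¹))) := by
  have hH := pathHat_posDef hp ht
  have h1 : Tendsto (fun k => ((p.dilateSeq k).pathHat t)⁻¹) atTop (𝓝 (p.pathHat t)⁻¹) :=
    Matrix.tendsto_inv (convergesTo_dilateSeq.tendsto_pathHat (ht.trans p.tx_mem.2))
      hH.det_pos.ne'
  have h2 : (p.pathHat t)⁻¹ - (p.pathHat t)⁻¹ * (Q - p.Φ.toFun p.tx) * (p.pathHat t)⁻¹ =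
      (p.pathHat t)⁻¹ * (p.pathHat t - (Q - p.Φ.toFun p.tx)) * (p.pathHat t)⁻¹ := by
    rw [Matrix.mul_sub (p.pathHat t)⁻¹ (p.pathHat t), Matrix.sub_mul, hH.inv_mul_self,
      Matrix.one_mul]
  simp only [invExcess_dilateSeq_sub hp ht, h2]
  exact ((h1.mul (tendsto_pathHat_dilate ht)).mul tendsto_const_nhds).neg

theorem intervalIntegrable_frob_smul_xi {β : ℕ → Fin n → ℝ}
    (hβ : ∀ j, Summable fun k : ℕ => (2 : ℝ) ^ (k + 2) * β (k + 2) j ^ 2)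
    (hdiag : ∀ j, Q j j = 1) (h : Fin n → ℝ) {w : ℝ → ℝ} (hw : Measurable w)
    (hw1 : ∀ t, |w t| ≤ 1) (a b : ℝ) :
    IntervalIntegrable (fun t => frob (w t • (xiDeriv β (p.Φ.toFun t) + vecMulVec h h))
      (p.pathDeriv t)) volume a b := by
  obtain ⟨M, hbd⟩ := exists_abs_xi_le (Q := Q) hβ hdiag h
  exact p.intervalIntegrable_frob fun i j => intervalIntegrable_of_abs_le (M := M)
    (measurable_smul_xi hβ hdiag h p hw i j).aestronglyMeasurable
    fun t _ => abs_smul_xi_le (hbd p) (hw1 t) t i j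

/-- In the form of `crisantiSommers_eq` both values are integrals over [0, n] along the same path,
so the difference quotient is one integral although t_x may move. -/
theorem integral_dilationQuot (hn : 0 < n) {β : ℕ → Fin n → ℝ}
    (hβ : ∀ j, Summable fun k : ℕ => (2 : ℝ) ^ (k + 2) * β (k + 2) j ^ 2)
    (hdiag : ∀ j, Q j j = 1) (h : Fin n → ℝ) (hp : p ∈ csDomain Q) (k : ℕ) :
    ∫ t in (0 : ℝ)..n, frob (p.dilationQuot k t • (xiDeriv β (p.Φ.toFun t) + vecMulVec h h) +
        ((k : ℝ) + 1) • ((p.dilateSeq k).invExcess t - p.invExcess t)) (p.pathDeriv t) =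
      2 * ((k : ℝ) + 1) * (crisantiSommers β h (p.dilateSeq k) - crisantiSommers β h p) := by
  have h0 : (0 : ℝ) ≤ n := Nat.cast_nonneg n
  rw [crisantiSommers_eq hp hn, crisantiSommers_eq (dilateSeq_mem_csDomain hp k) hn]
  have hx := p.intervalIntegrable_frob_smul_xi hβ hdiag h p.x.measurable p.x.abs_le_one 0 n
  have hxk := (p.dilateSeq k).intervalIntegrable_frob_smul_xi hβ hdiag h
    (p.dilateSeq k).x.measurable (p.dilateSeq k).x.abs_le_one 0 n
  have hi := p.intervalIntegrable_frob (intervalIntegrable_invExcess hp h0 le_rfl)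
  have hik := (p.dilateSeq k).intervalIntegrable_frob
    (intervalIntegrable_invExcess (dilateSeq_mem_csDomain hp k) h0 le_rfl)
  have hsum := intervalIntegral.integral_sub (hxk.add hik) (hx.add hi)
  rw [intervalIntegral.integral_add hxk hik, intervalIntegral.integral_add hx hi] at hsum
  have : ∀ t, frob (p.dilationQuot k t • (xiDeriv β (p.Φ.toFun t) + vecMulVec h h) +
        ((k : ℝ) + 1) • ((p.dilateSeq k).invExcess t - p.invExcess t)) (p.pathDeriv t) =
      ((k : ℝ) + 1) * ((frob ((p.dilateSeq k).x.toFun t • (xiDeriv β ((p.dilateSeq k).Φ.toFun t) +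
        vecMulVec h h)) ((p.dilateSeq k).pathDeriv t) +
        frob ((p.dilateSeq k).invExcess t) ((p.dilateSeq k).pathDeriv t)) -
      (frob (p.x.toFun t • (xiDeriv β (p.Φ.toFun t) + vecMulVec h h)) (p.pathDeriv t) +
        frob (p.invExcess t) (p.pathDeriv t))) := by
    intro t
    have e1 : (p.dilateSeq k).Φ = p.Φ := rfl
    have e2 : (p.dilateSeq k).pathDeriv t = p.pathDeriv t := rfl
    rw [e1, e2]
    simp only [frob_add_left, frob_smul_left, frob_sub_left, dilationQuot]
    ring
  simp only [this]
  rw [intervalIntegral.integral_const_mul, hsum]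
  ring

/-- Stationarity of a minimizer under dilations of the distribution function. -/
theorem integral_le_of_isMinOn (hn : 0 < n) {β : ℕ → Fin n → ℝ}
    (hβ : ∀ j, Summable fun k : ℕ => (2 : ℝ) ^ (k + 2) * β (k + 2) j ^ 2)
    (hdiag : ∀ j, Q j j = 1) (h : Fin n → ℝ) (hp : p ∈ csDomain Q)
    (hmin : ∀ k, crisantiSommers β h p ≤ crisantiSommers β h (p.dilateSeq k)) :
    ∫ t in (0 : ℝ)..p.tx, frob ((p.pathHat t)⁻¹ -
        (p.pathHat t)⁻¹ * (Q - p.Φ.toFun p.tx) * (p.pathHat t)⁻¹) (p.pathDeriv t) ≤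
      ∫ t in (0 : ℝ)..p.tx,
        frob (p.x.toFun t • (xiDeriv β (p.Φ.toFun t) + vecMulVec h h)) (p.pathDeriv t) := by
  obtain ⟨M, hbd⟩ := exists_abs_xi_le (Q := Q) hβ hdiag h
  set K := maxEntryNorm (Q - p.Φ.toFun p.tx)⁻¹ with hKdef
  have hK : 0 ≤ K := (abs_nonneg _).trans (abs_apply_le_maxEntryNorm _ ⟨0, hn⟩ ⟨0, hn⟩)
  set F := fun t => xiDeriv β (p.Φ.toFun t) + vecMulVec h h with hF
  set G := fun t => (p.pathHat t)⁻¹ -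
    (p.pathHat t)⁻¹ * (Q - p.Φ.toFun p.tx) * (p.pathHat t)⁻¹ with hG
  set D : ℕ → ℝ → Matrix (Fin n) (Fin n) ℝ := fun k t => p.dilationQuot k t • F t +
    ((k : ℝ) + 1) • ((p.dilateSeq k).invExcess t - p.invExcess t) with hD
  -- At t_x itself the quotient tends to 0 instead of x; a single point is negligible.
  have hDlim : ∀ t ∈ Set.uIoc 0 p.tx, t ≠ p.tx → ∀ i j,
      Tendsto (fun k => D k t i j) atTop (𝓝 ((p.x.toFun t • F t - G t) i j)) := by
    intro t ht hne
    rw [Set.uIoc_of_le p.tx_mem.1] at ht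
    refine Matrix.tendsto_iff.1 ?_
    rw [sub_eq_add_neg]
    refine Tendsto.add ?_ (tendsto_invExcess_dilateSeq hp ht.2)
    have := p.tendsto_dilationQuot t
    rw [if_pos (lt_of_le_of_ne ht.2 hne)] at this
    exact this.smul_const _
  have hDm : ∀ k i j, Measurable fun t => D k t i j := fun k i j =>
    (measurable_smul_xi hβ hdiag h p (measurable_dilationQuot k) i j).add
      ((((p.dilateSeq k).measurable_invExcess i j).sub (p.measurable_invExcess i j)).const_mul _)
  set B := M + n * (n * (K * n) * K) with hB
  have hDb : ∀ k, ∀ t ∈ Set.uIoc 0 (n : ℝ), ∀ i j, |D k t i j| ≤ B := by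
    intro k t ht i j
    rw [Set.uIoc_of_le (Nat.cast_nonneg n)] at ht
    exact (abs_add_le _ _).trans (add_le_add
      (abs_smul_xi_le (hbd p) (abs_dilationQuot_le k t) t i j)
      (abs_invExcess_dilateSeq_sub_le hn hp ht.1.le ht.2 k i j))
  have hGm : ∀ i j, Measurable fun t => G t i j := by
    intro i j
    have hA := measurable_inv_apply p.continuous_pathHat'
    simp only [hG, Matrix.sub_apply, Matrix.mul_apply]
    exact (hA i j).sub (Finset.measurable_sum _ fun k _ =>
      (Finset.measurable_sum _ fun l _ => (hA i l).mul_const _).mul (hA k j))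
  have hm0 : ∀ i j, Measurable fun t => (p.x.toFun t • F t - G t) i j := fun i j =>
    (measurable_smul_xi hβ hdiag h p p.x.measurable i j).sub (hGm i j)
  have hsub : Set.uIoc 0 p.tx ⊆ Set.uIoc 0 (n : ℝ) := by
    rw [Set.uIoc_of_le p.tx_mem.1, Set.uIoc_of_le (Nat.cast_nonneg n)]
    exact Set.Ioc_subset_Ioc_right p.tx_mem.2
  have hGb : ∀ t ∈ Set.uIoc 0 p.tx, ∀ i j, |G t i j| ≤ n * (n * (K * n) * K) := by
    intro t ht i j
    rw [Set.uIoc_of_le p.tx_mem.1] at ht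
    have hlim := (Matrix.tendsto_iff.1 (tendsto_invExcess_dilateSeq hp ht.2) i j).abs
    rw [Matrix.neg_apply, abs_neg] at hlim
    exact le_of_tendsto hlim (Eventually.of_forall fun k =>
      abs_invExcess_dilateSeq_sub_le hn hp ht.1.le (ht.2.trans p.tx_mem.2) k i j)
  have hne : ∀ᵐ s : ℝ, s ≠ p.tx := by simp [ae_iff, measure_singleton]
  have hlim := (convergesTo_const (p := p)).tendsto_integral_frob (D := D)
    (D₀ := fun t => p.x.toFun t • F t - G t) p.tx_mem.1 hDm hm0
    (fun k t ht => hDb k t (hsub ht)) (fun t ht i j => (abs_sub _ _).trans (add_le_add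
      (abs_smul_xi_le (hbd p) (p.x.abs_le_one t) t i j) (hGb t ht i j)))
    (by filter_upwards [hne] with t ht hmem using hDlim t hmem ht)
  have hDI : ∀ k a b, a ∈ Set.Icc (0 : ℝ) n → b ∈ Set.Icc (0 : ℝ) n →
      IntervalIntegrable (fun t => frob (D k t) (p.pathDeriv t)) volume a b :=
    fun k a b ha hb => p.intervalIntegrable_frob fun i j => intervalIntegrable_of_abs_le
      (hDm k i j).aestronglyMeasurable fun t ht => hDb k t (by
        rw [Set.uIoc_of_le (Nat.cast_nonneg n)]
        exact ⟨(le_min ha.1 hb.1).trans_lt ht.1, ht.2.trans (max_le ha.2 hb.2)⟩) i j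
  -- The integrand vanishes beyond t_x, so this is a nonnegative multiple of the increase of the
  -- functional.
  have hpos : ∀ k, 0 ≤ ∫ t in (0 : ℝ)..p.tx, frob (D k t) (p.pathDeriv t) := by
    intro k
    have h1 : ∫ t in p.tx..n, frob (D k t) (p.pathDeriv t) = 0 := by
      rw [← intervalIntegral.integral_zero (a := p.tx) (b := n) (μ := volume)]
      refine intervalIntegral.integral_congr fun t ht => ?_
      rw [Set.uIcc_of_le p.tx_mem.2] at ht
      simp only [hD, dilationQuot_of_tx_le ht.1, invExcess_dilateSeq_sub_of_tx_le ht.1 ht.2]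
      simp [frob]
    have h2 := intervalIntegral.integral_add_adjacent_intervals
      (hDI k 0 p.tx ⟨le_rfl, Nat.cast_nonneg n⟩ p.tx_mem)
      (hDI k p.tx n p.tx_mem ⟨Nat.cast_nonneg n, le_rfl⟩)
    rw [h1, add_zero] at h2
    rw [h2, hD, hF, integral_dilationQuot hn hβ hdiag h hp]
    exact mul_nonneg (by positivity) (sub_nonneg.2 (hmin k))
  have hfin := ge_of_tendsto hlim (Eventually.of_forall hpos)
  have hGI := p.intervalIntegrable_frob (a := 0) (b := p.tx) (D := G) fun i j =>
    intervalIntegrable_of_abs_le (hGm i j).aestronglyMeasurable fun t ht => hGb t ht i j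
  have hFI := p.intervalIntegrable_frob_smul_xi hβ hdiag h p.x.measurable p.x.abs_le_one 0 p.tx
  simp only [frob_sub_left _ (G _)] at hfin
  rw [intervalIntegral.integral_sub hFI hGI] at hfin
  exact sub_nonneg.1 hfin

end OrderParam

/-! ### The a priori inequality for a minimizer -/

theorem frob_comm {n : ℕ} (A B : Matrix (Fin n) (Fin n) ℝ) : frob A B = frob B A :=
  Matrix.trace_mul_comm A B

theorem frob_neg_right {n : ℕ} (A B : Matrix (Fin n) (Fin n) ℝ) : frob A (-B) = -frob A B := by
  simp [frob]

/-- Convexity of the inverse on positive definite matrices. -/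
theorem Matrix.PosDef.inv_sub_inv_add_posSemidef {n : ℕ} {X Z : Matrix (Fin n) (Fin n) ℝ}
    (hX : X.PosDef) (hZ : Z.PosDef) :
    ((Z⁻¹ - X⁻¹) + X⁻¹ * (Z - X) * X⁻¹).PosSemidef := by
  have h := hZ.posSemidef.symm_conj (B := X⁻¹ - Z⁻¹)
    (hX.isHermitian.inv.sub hZ.isHermitian.inv)
  convert h using 1
  simp only [Matrix.mul_sub, Matrix.sub_mul, hX.inv_mul_self, hZ.inv_mul_self, Matrix.one_mul,
    Matrix.mul_assoc, hZ.mul_inv_self, Matrix.mul_one]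
  abel

/-- Convexity of the inverse makes Z ↦ -⟨A, Z⁻¹⟩ concave; this is its supergradient inequality, as
required by `integral_frob_supergradient`. -/
theorem frob_sub_frob_inv_le {n : ℕ} {A X Z : Matrix (Fin n) (Fin n) ℝ} (hA : A.PosSemidef)
    (hX : X.PosDef) (hZ : Z.PosDef) :
    -frob A Z⁻¹ - -frob A X⁻¹ ≤ frob (X⁻¹ * A * X⁻¹) (Z - X) := by
  have h := frob_nonneg hA (hX.inv_sub_inv_add_posSemidef hZ)
  have h1 : frob (X⁻¹ * A * X⁻¹) (Z - X) = frob A (X⁻¹ * (Z - X) * X⁻¹) := by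
    unfold frob
    rw [Matrix.mul_assoc, Matrix.mul_assoc, Matrix.trace_mul_comm]
    simp only [Matrix.mul_assoc]
  rw [h1]
  rw [frob_add_right, frob_sub_right] at h
  linarith

theorem maxRowSumNorm_le {n : ℕ} (hn : 0 < n) {A : Matrix (Fin n) (Fin n) ℝ} {K : ℝ}
    (h : ∀ i, ∑ j, |A i j| ≤ K) : maxRowSumNorm A ≤ K := by
  have : Nonempty (Fin n) := ⟨⟨0, hn⟩⟩
  exact ciSup_le h

theorem maxEntryNorm_le_maxRowSumNorm {n : ℕ} (hn : 0 < n) (A : Matrix (Fin n) (Fin n) ℝ) :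
    maxEntryNorm A ≤ maxRowSumNorm A :=
  maxEntryNorm_le hn fun i j => (Finset.single_le_sum (f := fun j => |A i j|)
    (fun _ _ => abs_nonneg _) (Finset.mem_univ j)).trans
      (le_ciSup (f := fun i => ∑ j, |A i j|) (Set.finite_range _).bddAbove i)

namespace OrderParam

variable {n : ℕ} {Q : Matrix (Fin n) (Fin n) ℝ} {p : OrderParam Q}

/-- The order parameter with the same path and with the point mass at `0`. -/
noncomputable def replicaSymmetric (p : OrderParam Q) : OrderParam Q := ⟨OverlapCDF.dirac n, p.Φ⟩

theorem tx_replicaSymmetric : p.replicaSymmetric.tx = 0 :=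
  le_antisymm (tx_le _ le_rfl (if_neg (lt_irrefl _))) (tx_mem _).1

theorem gap_replicaSymmetric :
    Q - p.replicaSymmetric.Φ.toFun p.replicaSymmetric.tx = Q := by
  rw [tx_replicaSymmetric, p.replicaSymmetric.Φ.eq_start 0 le_rfl, sub_zero]

theorem replicaSymmetric_mem_csDomain (hQ : Q.PosDef) : p.replicaSymmetric ∈ csDomain Q := by
  rw [csDomain, Set.mem_ofPred_eq, gap_replicaSymmetric]
  exact hQ.det_pos

theorem crisantiSommers_replicaSymmetric (β : ℕ → Fin n → ℝ) (h : Fin n → ℝ) :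
    crisantiSommers β h p.replicaSymmetric = 1 / 2 * ((∫ t in (0 : ℝ)..n,
      frob (xiDeriv β (p.Φ.toFun t) + vecMulVec h h) (p.pathDeriv t)) + Real.log Q.det) := by
  have hint : ∫ t in (0 : ℝ)..n, p.replicaSymmetric.x.toFun t *
        frob (xiDeriv β (p.replicaSymmetric.Φ.toFun t) + vecMulVec h h)
          (p.replicaSymmetric.pathDeriv t) =
      ∫ t in (0 : ℝ)..n, frob (xiDeriv β (p.Φ.toFun t) + vecMulVec h h) (p.pathDeriv t) := by
    refine intervalIntegral.integral_congr fun t ht => ?_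
    rw [Set.uIcc_of_le (Nat.cast_nonneg n)] at ht
    have : p.replicaSymmetric.x.toFun t = 1 := if_neg ht.1.not_gt
    simp only [this, one_mul]
    rfl
  have hend := p.replicaSymmetric.Φ.eq_end n le_rfl
  rw [crisantiSommers, hint, hend, gap_replicaSymmetric, tx_replicaSymmetric,
    intervalIntegral.integral_same, add_zero]

theorem xi_posSemidef {β : ℕ → Fin n → ℝ}
    (hβ : ∀ j, Summable fun k : ℕ => (2 : ℝ) ^ (k + 2) * β (k + 2) j ^ 2)
    (hdiag : ∀ j, Q j j = 1) (h : Fin n → ℝ) (p : OrderParam Q) (t : ℝ) :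
    (xiDeriv β (p.Φ.toFun t) + vecMulVec h h).PosSemidef := by
  have h1 := xiDeriv_sub_posSemidef hβ (A := 0) (B := p.Φ.toFun t) Matrix.PosSemidef.zero
    (by rw [sub_zero]; exact p.Φ.posSemidef' t) (by simp) (p.abs_path_le_one hdiag t)
  have h2 : xiDeriv β (0 : Matrix (Fin n) (Fin n) ℝ) = 0 := by ext i j; simp [xiDeriv]
  rw [h2, sub_zero] at h1
  exact h1.add (by simpa using posSemidef_vecMulVec_self_star h)

theorem measurable_inv_conj (p : OrderParam Q) (A : Matrix (Fin n) (Fin n) ℝ)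
    (i j : Fin n) : Measurable fun t => ((p.pathHat t)⁻¹ * A * (p.pathHat t)⁻¹) i j := by
  have hA := measurable_inv_apply p.continuous_pathHat'
  simp only [Matrix.mul_apply]
  exact Finset.measurable_sum _ fun k _ =>
    (Finset.measurable_sum _ fun l _ => (hA i l).mul_const _).mul (hA k j)

theorem abs_inv_conj_le (hp : p ∈ csDomain Q) (A : Matrix (Fin n) (Fin n) ℝ) {t : ℝ}
    (ht : t ≤ p.tx) (i j : Fin n) : |((p.pathHat t)⁻¹ * A * (p.pathHat t)⁻¹) i j| ≤
      n * (n * (maxEntryNorm (Q - p.Φ.toFun p.tx)⁻¹ * maxEntryNorm A) *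
        maxEntryNorm (Q - p.Φ.toFun p.tx)⁻¹) := by
  have h0 : ∀ B : Matrix (Fin n) (Fin n) ℝ, 0 ≤ maxEntryNorm B := fun B =>
    (abs_nonneg _).trans (abs_apply_le_maxEntryNorm B i j)
  have h1 := h0 A
  have h2 := h0 (Q - p.Φ.toFun p.tx)⁻¹
  exact abs_mul_apply_le (abs_mul_apply_le (abs_pathHat_inv_le hp ht)
    (abs_apply_le_maxEntryNorm A) h2) (abs_pathHat_inv_le hp ht) (by positivity) i j

theorem intervalIntegrable_inv_conj (hp : p ∈ csDomain Q) (A : Matrix (Fin n) (Fin n) ℝ)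
    (i j : Fin n) :
    IntervalIntegrable (fun t => ((p.pathHat t)⁻¹ * A * (p.pathHat t)⁻¹) i j) volume 0 p.tx := by
  refine intervalIntegrable_of_abs_le
    (M := n * (n * (maxEntryNorm (Q - p.Φ.toFun p.tx)⁻¹ * maxEntryNorm A) *
      maxEntryNorm (Q - p.Φ.toFun p.tx)⁻¹))
    (p.measurable_inv_conj _ i j).aestronglyMeasurable fun t ht => ?_
  rw [Set.uIoc_of_le p.tx_mem.1] at ht
  exact abs_inv_conj_le hp A ht.2 i j

theorem integral_inv_mul (hn : 0 < n) (hp : p ∈ csDomain Q) :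
    ∫ t in (0 : ℝ)..p.tx, p.x.toFun t * frob (p.pathHat t)⁻¹ (p.pathDeriv t) =
      Real.log (p.pathHat 0).det - Real.log (Q - p.Φ.toFun p.tx).det := by
  have hM : 0 ≤ maxEntryNorm (Q - p.Φ.toFun p.tx)⁻¹ :=
    (abs_nonneg _).trans (abs_apply_le_maxEntryNorm _ ⟨0, hn⟩ ⟨0, hn⟩)
  have h := integral_frob_supergradient (X := p.pathHat)
    (V := fun t => -(p.x.toFun t • p.pathDeriv t)) (G := fun t => (p.pathHat t)⁻¹)
    (L := fun t => Real.log (p.pathHat t).det) p.tx_mem.1 hM zero_le_one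
    (fun s _ t _ i j => by rw [one_mul]; exact p.abs_pathHat_sub_le s t i j)
    (by filter_upwards [p.ae_hasDerivAt_pathHat] with t ht hmem
        exact ht ⟨hmem.1, hmem.2.trans p.tx_mem.2⟩)
    (fun t ht => abs_pathHat_inv_le hp ht.2)
    (fun s hs t ht => (pathHat_posDef hp ht.2).log_det_le (pathHat_posDef hp hs.2))
  rw [p.pathHat_of_tx_le le_rfl p.tx_mem.2] at h
  simp only [frob_neg_right, frob_smul_right, intervalIntegral.integral_neg] at h
  linarith

/-- With Φ̂' = -xΦ' the integrand is the derivative of ⟨A, Φ̂⁻¹⟩, where A is the gap. At t_x this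
pairing is tr(A A⁻¹) = n. -/
theorem integral_inv_conj_mul (hn : 0 < n) (hp : p ∈ csDomain Q) :
    ∫ t in (0 : ℝ)..p.tx, p.x.toFun t * frob ((p.pathHat t)⁻¹ * (Q - p.Φ.toFun p.tx) *
        (p.pathHat t)⁻¹) (p.pathDeriv t) =
      n - frob (p.pathHat 0)⁻¹ (Q - p.Φ.toFun p.tx) := by
  have h0 : ∀ B : Matrix (Fin n) (Fin n) ℝ, 0 ≤ maxEntryNorm B := fun B =>
    (abs_nonneg _).trans (abs_apply_le_maxEntryNorm B ⟨0, hn⟩ ⟨0, hn⟩)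
  have h1 := h0 (Q - p.Φ.toFun p.tx)
  have h2 := h0 (Q - p.Φ.toFun p.tx)⁻¹
  have h := integral_frob_supergradient (X := p.pathHat)
    (V := fun t => -(p.x.toFun t • p.pathDeriv t))
    (G := fun t => (p.pathHat t)⁻¹ * (Q - p.Φ.toFun p.tx) * (p.pathHat t)⁻¹)
    (L := fun t => -frob (Q - p.Φ.toFun p.tx) (p.pathHat t)⁻¹) p.tx_mem.1
    (by positivity) zero_le_one
    (fun s _ t _ i j => by rw [one_mul]; exact p.abs_pathHat_sub_le s t i j)
    (by filter_upwards [p.ae_hasDerivAt_pathHat] with t ht hmem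
        exact ht ⟨hmem.1, hmem.2.trans p.tx_mem.2⟩)
    (fun t ht => abs_inv_conj_le hp _ ht.2)
    (fun s hs t ht => frob_sub_frob_inv_le (gap_posDef hp).posSemidef (pathHat_posDef hp ht.2)
      (pathHat_posDef hp hs.2))
  have h3 : frob (Q - p.Φ.toFun p.tx) (p.pathHat p.tx)⁻¹ = n := by
    rw [p.pathHat_of_tx_le le_rfl p.tx_mem.2, frob, (gap_posDef hp).mul_inv_self]
    simp
  simp only [frob_neg_right, frob_smul_right, intervalIntegral.integral_neg, h3] at h
  rw [frob_comm (p.pathHat 0)⁻¹]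
  linarith

theorem weightedIncrement_one_sub_tx :
    p.weightedIncrement (fun r => 1 - p.x.toFun r) 0 p.tx = Q - p.pathHat 0 := by
  rw [← sub_pathHat_eq, p.pathHat_of_tx_le le_rfl p.tx_mem.2, p.Φ.eq_start 0 le_rfl]
  abel

/-- A lower bound for the singular part of the first variation. -/
theorem le_integral_inv (hn : 0 < n) (hp : p ∈ csDomain Q) :
    2 * (Real.log (p.pathHat 0).det - Real.log (Q - p.Φ.toFun p.tx).det) - n +
        frob (p.pathHat 0)⁻¹ (Q - p.Φ.toFun p.tx) +
        2 * frob ((Q - p.Φ.toFun p.tx) + p.pathHat 0)⁻¹ (Q - p.pathHat 0) ≤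
      ∫ t in (0 : ℝ)..p.tx, frob ((2 : ℝ) • (p.pathHat t)⁻¹ -
        (p.pathHat t)⁻¹ * (Q - p.Φ.toFun p.tx) * (p.pathHat t)⁻¹) (p.pathDeriv t) := by
  set A := Q - p.Φ.toFun p.tx with hA
  set C := (2 : ℝ) • (A + p.pathHat 0)⁻¹ with hC
  have hApd : A.PosDef := gap_posDef hp
  have hE : ∀ i j, IntervalIntegrable (fun t => ((2 : ℝ) • (p.pathHat t)⁻¹ -
      (p.pathHat t)⁻¹ * A * (p.pathHat t)⁻¹) i j) volume 0 p.tx := fun i j =>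
    ((intervalIntegrable_pathHat_inv hp i j).const_mul 2).sub (intervalIntegrable_inv_conj hp A i j)
  have hx : ∀ {D : ℝ → Matrix (Fin n) (Fin n) ℝ} (w : ℝ → ℝ), Measurable w → (∀ t, |w t| ≤ 1) →
      (∀ i j, IntervalIntegrable (fun t => D t i j) volume 0 p.tx) →
      ∀ i j, IntervalIntegrable (fun t => (w t • D t) i j) volume 0 p.tx := by
    intro D w hw hw1 hD i j
    have hb := fun (s : Set ℝ) => (ae_of_all (volume.restrict s) hw1 : ∀ᵐ t ∂_, ‖w t‖ ≤ 1)
    exact ⟨(hD i j).1.bdd_mul hw.aestronglyMeasurable (hb _),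
      (hD i j).2.bdd_mul hw.aestronglyMeasurable (hb _)⟩
  have hw1 : ∀ t, |1 - p.x.toFun t| ≤ 1 := fun t => by
    rw [abs_of_nonneg (sub_nonneg.2 (p.x.le_one t))]
    linarith [p.x.nonneg t]
  have hwm : Measurable fun t => 1 - p.x.toFun t := measurable_const.sub p.x.measurable
  -- On the part weighted by 1 - x, the integrand is at least 2(A + Φ̂(t))⁻¹. This is antitone in
  -- Φ̂(t) ≤ Φ̂(0), so a constant matrix bounds it below.
  have h1 := p.integral_frob_mono p.tx_mem.1
    (hx (D := fun _ => C) _ hwm hw1 fun i j => intervalIntegrable_const) (hx _ hwm hw1 hE)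
    (fun t ht => by
      have hH := pathHat_posDef hp ht.2
      have e1 := hApd.two_smul_inv_sub_posSemidef (p.pathHat_sub_gap_posSemidef ht.2)
      have e2 := (hApd.add hH).inv_sub_inv_posSemidef (B := A + p.pathHat 0)
        (by rw [add_sub_add_left_eq_sub]; exact p.pathHat_sub_posSemidef ht.1)
      have e3 := e1.add (e2.smul (zero_le_two (α := ℝ)))
      rw [smul_sub, sub_add_sub_cancel] at e3
      rw [← smul_sub]
      exact e3.smul (sub_nonneg.2 (p.x.le_one t)))
  have h2 : ∫ t in (0 : ℝ)..p.tx, frob ((1 - p.x.toFun t) • C) (p.pathDeriv t) =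
      frob C (Q - p.pathHat 0) := by
    rw [← weightedIncrement_one_sub_tx, frob_weightedIncrement _ _
      (intervalIntegrable_const.sub (p.intervalIntegrable_x_toFun _ _))]
    simp only [frob_smul_left]
  rw [h2, hC, frob_smul_left] at h1
  have hY := p.intervalIntegrable_frob (hx _ p.x.measurable p.x.abs_le_one
    (intervalIntegrable_pathHat_inv hp))
  have hYAY := p.intervalIntegrable_frob (hx _ p.x.measurable p.x.abs_le_one
    (intervalIntegrable_inv_conj hp A))
  have hlast := p.intervalIntegrable_frob (hx _ hwm hw1 hE)
  have h3 : ∫ t in (0 : ℝ)..p.tx, frob ((2 : ℝ) • (p.pathHat t)⁻¹ -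
        (p.pathHat t)⁻¹ * A * (p.pathHat t)⁻¹) (p.pathDeriv t) =
      2 * (Real.log (p.pathHat 0).det - Real.log A.det) - (n - frob (p.pathHat 0)⁻¹ A) +
      ∫ t in (0 : ℝ)..p.tx, frob ((1 - p.x.toFun t) • ((2 : ℝ) • (p.pathHat t)⁻¹ -
        (p.pathHat t)⁻¹ * A * (p.pathHat t)⁻¹)) (p.pathDeriv t) := by
    rw [← integral_inv_mul hn hp, ← integral_inv_conj_mul hn hp]
    simp only [frob_smul_left] at hY hYAY hlast ⊢
    rw [← intervalIntegral.integral_const_mul,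
      ← intervalIntegral.integral_sub (hY.const_mul 2) hYAY,
      ← intervalIntegral.integral_add ((hY.const_mul 2).sub hYAY) hlast]
    refine intervalIntegral.integral_congr fun t _ => ?_
    simp only [frob_sub_left, frob_smul_left]
    ring
  rw [h3]
  linarith

/-- The a priori estimate for a minimizer. -/
theorem le_xi_of_isMinOn (hn : 0 < n) {β : ℕ → Fin n → ℝ}
    (hβ : ∀ j, Summable fun k : ℕ => (2 : ℝ) ^ (k + 2) * β (k + 2) j ^ 2)
    (hdiag : ∀ j, Q j j = 1) (h : Fin n → ℝ) (hp : p ∈ csDomain Q)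
    (hmin : ∀ k, crisantiSommers β h p ≤ crisantiSommers β h (p.dilateSeq k))
    (hrs : crisantiSommers β h p ≤ crisantiSommers β h p.replicaSymmetric) :
    2 * Real.log (p.pathHat 0).det - Real.log (Q - p.Φ.toFun p.tx).det - Real.log Q.det - n +
        frob (p.pathHat 0)⁻¹ (Q - p.Φ.toFun p.tx) +
        2 * frob ((Q - p.Φ.toFun p.tx) + p.pathHat 0)⁻¹ (Q - p.pathHat 0) ≤
      frob (vecMulVec h h + xiDeriv β Q) Q := by
  have h1 := le_integral_inv hn hp
  have h2 := integral_le_of_isMinOn hn hβ hdiag h hp hmin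
  have h3 := p.integral_xi_le hβ hdiag h
  rw [crisantiSommers_replicaSymmetric, crisantiSommers, p.Φ.eq_end n le_rfl] at hrs
  set A := Q - p.Φ.toFun p.tx with hA
  have hY := p.intervalIntegrable_frob (intervalIntegrable_pathHat_inv hp)
  have hYAY := p.intervalIntegrable_frob (intervalIntegrable_inv_conj hp A)
  have hF := fun a b => p.intervalIntegrable_frob_smul_xi hβ hdiag h p.x.measurable
    p.x.abs_le_one a b
  simp only [frob_sub_left, frob_smul_left] at h1 h2 hF
  rw [intervalIntegral.integral_sub hY hYAY] at h2
  rw [intervalIntegral.integral_sub (hY.const_mul 2) hYAY,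
    intervalIntegral.integral_const_mul] at h1
  -- Stationarity involves the covariance only up to t_x. The rest is nonnegative, so the full
  -- integral in the value comparison cancels it when the two inequalities are added.
  have h4 : 0 ≤ ∫ t in p.tx..n,
      p.x.toFun t * frob (xiDeriv β (p.Φ.toFun t) + vecMulVec h h) (p.pathDeriv t) := by
    refine intervalIntegral.integral_nonneg_of_ae_restrict p.tx_mem.2 ?_
    filter_upwards [ae_restrict_of_ae p.ae_pathDeriv_posSemidef] with t ht
    exact mul_nonneg (p.x.nonneg t) (frob_nonneg (xi_posSemidef hβ hdiag h p t) ht)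
  have h5 := intervalIntegral.integral_add_adjacent_intervals (hF 0 p.tx) (hF p.tx n)
  linarith

end OrderParam

/-! ### From the a priori inequality to the constant L -/

/-- Apply log u ≤ u - 1 to each factor of 1/p = 1/(a+p) · (a+2p)/(2p) · 2(a+p)/(a+2p). -/
theorem two_mul_log_add_nonneg {a p : ℝ} (ha : 0 < a) (hp : 0 < p) :
    0 ≤ 2 * Real.log p + a / p + 2 * (1 - p) / (a + p) := by
  have h1 := Real.log_le_sub_one_of_pos (show 0 < 1 / (a + p) by positivity)
  have h2 := Real.log_le_sub_one_of_pos (show 0 < (a + 2 * p) / (2 * p) by positivity)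
  have h3 := Real.log_le_sub_one_of_pos (show 0 < 2 * (a + p) / (a + 2 * p) by positivity)
  rw [Real.log_div one_ne_zero (by positivity), Real.log_one] at h1
  rw [Real.log_div (by positivity) (by positivity), Real.log_mul two_ne_zero hp.ne'] at h2
  rw [Real.log_div (by positivity) (by positivity), Real.log_mul two_ne_zero (by positivity)] at h3
  have h4 : (a + 2 * p) / (2 * p) - 1 = (a / p) / 2 := by field_simp; ring
  have h5 : 2 * (a + p) / (a + 2 * p) - 1 ≤ a / (a + p) := by
    rw [div_sub_one (by positivity), div_le_div_iff₀ (by positivity) (by positivity)]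
    nlinarith [mul_pos ha hp]
  have h6 : 2 * (1 - p) / (a + p) = 2 * (1 / (a + p) - 1 + a / (a + p)) := by
    field_simp; ring
  rw [h6]
  linarith

theorem four_mul_sqrt_le_exp {n : ℕ} (hn : 2 ≤ n) : 4 * √(n : ℝ) ≤ Real.exp n := by
  have h2 : (2 : ℝ) ≤ n := by exact_mod_cast hn
  have hs := Real.sq_sqrt (Nat.cast_nonneg (α := ℝ) n)
  have h1 : Real.exp n = Real.exp 1 * Real.exp 1 * Real.exp (n - 2) := by
    rw [← Real.exp_add, ← Real.exp_add]; congr 1; ring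
  have he := Real.exp_one_gt_d9
  have h3 := Real.add_one_le_exp ((n : ℝ) - 2)
  have h7 : 7 ≤ Real.exp 1 * Real.exp 1 := by nlinarith
  rw [h1]
  have : 7 * ((n : ℝ) - 2 + 1) ≤ Real.exp 1 * Real.exp 1 * Real.exp (n - 2) :=
    mul_le_mul h7 h3 (by linarith) (by positivity)
  nlinarith [sq_nonneg (√(n : ℝ) - 3 / 2)]

theorem Matrix.PosDef.abs_inv_apply_le_of_entropy_le {n : ℕ} (hn : 0 < n)
    {A P Q : Matrix (Fin n) (Fin n) ℝ} (hA : A.PosDef) (hPA : (P - A).PosSemidef)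
    (hQP : (Q - P).PosSemidef) (hdiag : ∀ j, Q j j = 1) {m : ℝ}
    (h : 2 * Real.log P.det - Real.log A.det - Real.log Q.det - n + frob P⁻¹ A +
      2 * frob (A + P)⁻¹ (Q - P) ≤ m) (i j : Fin n) :
    |A⁻¹ i j| ≤ 4 * Real.exp m / Q.det := by
  have hP := hA.mono hPA
  have hQ := hP.mono hQP
  -- Since A + P ≤ 2P, the last term of the hypothesis is at least ⟨P⁻¹, Q - P⟩, which turns its
  -- left side into the sum of two relative entropies.
  have h1 := (hA.add hP).inv_sub_inv_posSemidef (B := (2 : ℝ) • P) (by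
    have : (2 : ℝ) • P - (A + P) = P - A := by module
    rwa [this])
  have h2 := frob_le_frob_left h1 hQP
  have h3 : ((2 : ℝ) • P)⁻¹ = (2 : ℝ)⁻¹ • P⁻¹ := by
    refine Matrix.inv_eq_right_inv ?_
    rw [Matrix.smul_mul, Matrix.mul_smul, hP.mul_inv_self, smul_smul, mul_inv_cancel₀ two_ne_zero,
      one_smul]
  have h4 : frob P⁻¹ P = n := by simp [frob, hP.inv_mul_self]
  rw [h3, frob_smul_left, frob_sub_right P⁻¹, h4] at h2
  have h5 := hA.sub_smul_posSemidef_of_entropy_le (m := m) hn hP hQ (by linarith)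
  have hc : 0 < Real.exp (-m) / 4 := by positivity
  refine (hQ.smul hc).abs_inv_apply_le h5 (fun k => ?_) i j
  have h6 : ((Real.exp (-m) / 4) • Q)⁻¹ = (Real.exp (-m) / 4)⁻¹ • Q⁻¹ := by
    refine Matrix.inv_eq_right_inv ?_
    rw [Matrix.smul_mul, Matrix.mul_smul, hQ.mul_inv_self, smul_smul, mul_inv_cancel₀ hc.ne',
      one_smul]
  have h7 : (Real.exp (-m) / 4)⁻¹ = 4 * Real.exp m := by
    rw [Real.exp_neg]; field_simp
  rw [h6, h7, Matrix.smul_apply, smul_eq_mul, div_eq_mul_one_div]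
  exact mul_le_mul_of_nonneg_left (hQ.inv_apply_self_le hdiag k) (by positivity)

/-- In dimension one the factor 4 of the entropy bound exceeds e, so it would miss the constant L.
The scalar inequality `two_mul_log_add_nonneg` gives -log a ≤ m + 1 directly. -/
theorem Matrix.PosDef.inv_apply_le_of_entropy_le_one {A P Q : Matrix (Fin 1) (Fin 1) ℝ}
    (hA : A.PosDef) (hP : P.PosDef) (hdiag : ∀ j, Q j j = 1) {m : ℝ}
    (h : 2 * Real.log P.det - Real.log A.det - Real.log Q.det - (1 : ℕ) + frob P⁻¹ A +
      2 * frob (A + P)⁻¹ (Q - P) ≤ m) (i j : Fin 1) :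
    |A⁻¹ i j| ≤ Real.exp (m + 1) := by
  have hAdet := hA.det_pos
  have hPdet := hP.det_pos
  have hinv : ∀ X : Matrix (Fin 1) (Fin 1) ℝ, ∀ i j, X⁻¹ i j = (X 0 0)⁻¹ := by
    intro X i j
    rw [Subsingleton.elim i 0, Subsingleton.elim j 0, Matrix.inv_def, Matrix.smul_apply,
      Matrix.adjugate_subsingleton, Matrix.det_fin_one, Ring.inverse_eq_inv', Matrix.one_apply_eq,
      smul_eq_mul, mul_one]
  simp only [frob_eq_sum, Finset.univ_unique, Fin.default_eq_zero, Fin.isValue, hinv,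
    Finset.sum_singleton, Matrix.det_fin_one, hdiag, Real.log_one, Matrix.add_apply,
    Matrix.sub_apply, Nat.cast_one] at h hAdet hPdet
  have h1 := two_mul_log_add_nonneg hAdet hPdet
  rw [hinv, abs_of_pos (inv_pos.2 hAdet)]
  rw [div_eq_inv_mul, div_eq_inv_mul] at h1
  calc (A 0 0)⁻¹ = Real.exp (-Real.log (A 0 0)) := by rw [Real.exp_neg, Real.exp_log hAdet]
    _ ≤ Real.exp (m + 1) := Real.exp_le_exp.2 (by linarith)

theorem csL_eq {n : ℕ} (β : ℕ → Fin n → ℝ) (h : Fin n → ℝ) {Q : Matrix (Fin n) (Fin n) ℝ}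
    (hQ : Q.PosDef) : csL β h Q =
      √(n : ℝ) * (Real.exp (frob (vecMulVec h h + xiDeriv β Q) Q) * Real.exp n / Q.det) := by
  rw [csL, csExponent, Real.exp_sub, Real.exp_add, Real.exp_log hQ.det_pos]

theorem csL_pos {n : ℕ} (hn : 0 < n) (β : ℕ → Fin n → ℝ) (h : Fin n → ℝ)
    (Q : Matrix (Fin n) (Fin n) ℝ) : 0 < csL β h Q :=
  mul_pos (Real.sqrt_pos.2 (by exact_mod_cast hn)) (Real.exp_pos _)

theorem csT_le {n : ℕ} (β : ℕ → Fin n → ℝ) (h : Fin n → ℝ) (Q : Matrix (Fin n) (Fin n) ℝ) :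
    csT β h Q ≤ n :=
  sub_le_self _ (by positivity)

theorem csT_eq {n : ℕ} (β : ℕ → Fin n → ℝ) (h : Fin n → ℝ)
    (Q : Matrix (Fin n) (Fin n) ℝ) : csT β h Q = n - 1 / csL β h Q := by
  rw [csT, csL, Real.exp_neg, one_div, one_div, mul_inv]

theorem maxRowSumNorm_inv_le_csL {n : ℕ} (hn : 0 < n) {β : ℕ → Fin n → ℝ} {h : Fin n → ℝ}
    {A P Q : Matrix (Fin n) (Fin n) ℝ} (hA : A.PosDef) (hPA : (P - A).PosSemidef)
    (hQP : (Q - P).PosSemidef) (hdiag : ∀ j, Q j j = 1)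
    (hle : 2 * Real.log P.det - Real.log A.det - Real.log Q.det - n + frob P⁻¹ A +
      2 * frob (A + P)⁻¹ (Q - P) ≤ frob (vecMulVec h h + xiDeriv β Q) Q) :
    maxRowSumNorm A⁻¹ ≤ csL β h Q := by
  have hP := hA.mono hPA
  have hQ := hP.mono hQP
  have hdet := hQ.det_pos
  rw [csL_eq β h hQ]
  refine maxRowSumNorm_le hn fun i => ?_
  rcases (show 1 ≤ n from hn).eq_or_lt with rfl | hn2
  · rw [Matrix.det_fin_one, hdiag, div_one, Nat.cast_one, Real.sqrt_one, one_mul, ← Real.exp_add]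
    simpa using hA.inv_apply_le_of_entropy_le_one hP hdiag hle i 0
  · refine (Finset.sum_le_sum fun j _ =>
      hA.abs_inv_apply_le_of_entropy_le hn hPA hQP hdiag hle i j).trans ?_
    rw [Finset.sum_const, Finset.card_univ, Fintype.card_fin, nsmul_eq_mul]
    have hs := Real.mul_self_sqrt (Nat.cast_nonneg (α := ℝ) n)
    calc (n : ℝ) * (4 * Real.exp (frob (vecMulVec h h + xiDeriv β Q) Q) / Q.det)
        = √(n : ℝ) * (Real.exp (frob (vecMulVec h h + xiDeriv β Q) Q) * (4 * √(n : ℝ)) /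
            Q.det) := by
          nth_rewrite 1 [← hs]
          ring
      _ ≤ _ := by
          have := four_mul_sqrt_le_exp hn2
          gcongr

/-- The path `t ↦ (t / n) Q`. -/
noncomputable def MatrixPath.linear {n : ℕ} (hn : 0 < n) {Q : Matrix (Fin n) (Fin n) ℝ}
    (hQ : Q.PosSemidef) (hdiag : ∀ j, Q j j = 1) : MatrixPath Q where
  toFun t := (min (max t 0) n / n) • Q
  posSemidef t ht := hQ.smul (by positivity)
  monotone s hs t ht hst := by
    rw [← sub_smul]
    refine hQ.smul (sub_nonneg.2 ?_)
    gcongr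
  lipschitz s hs t ht i j := by
    have hn1 : (1 : ℝ) ≤ n := by exact_mod_cast hn
    have hQ1 := hQ.abs_apply_le (fun k => (hdiag k).le) i j
    rw [max_eq_left hs.1, max_eq_left ht.1, min_eq_left hs.2, min_eq_left ht.2,
      Matrix.smul_apply, Matrix.smul_apply, ← sub_smul, ← sub_div, smul_eq_mul, abs_mul, abs_div,
      Nat.abs_cast]
    exact (mul_le_of_le_one_right (by positivity) hQ1).trans (div_le_self (abs_nonneg _) hn1)
  trace_eq t ht := by
    have hn1 : (n : ℝ) ≠ 0 := by exact_mod_cast hn.ne'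
    rw [max_eq_left ht.1, min_eq_left ht.2, Matrix.trace_smul]
    simp [Matrix.trace, hdiag, hn1]
  eq_start t ht := by simp [max_eq_right ht]
  eq_end t ht := by
    have hn1 : (n : ℝ) ≠ 0 := by exact_mod_cast hn.ne'
    rw [max_eq_left ((Nat.cast_nonneg n).trans ht), min_eq_right ht, div_self hn1, one_smul]

/-! ### The constant T and removal of the auxiliary bound K -/

namespace OrderParam

variable {n : ℕ} {Q : Matrix (Fin n) (Fin n) ℝ} {p : OrderParam Q}

theorem trace_gap (hdiag : ∀ j, Q j j = 1) (p : OrderParam Q) :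
    (Q - p.Φ.toFun p.tx).trace = n - p.tx := by
  rw [Matrix.trace_sub, p.Φ.trace_eq _ p.tx_mem]
  simp [Matrix.trace, hdiag]

theorem mem_boundedParams_natCast_iff {K : ℝ} : p ∈ boundedParams Q n K ↔
    p ∈ csDomain Q ∧ maxEntryNorm (Q - p.Φ.toFun p.tx)⁻¹ ≤ K := by
  rw [mem_boundedParams_iff le_rfl, max_eq_right (Nat.cast_nonneg n)]
  simp [p.tx_mem.2]

/-- One diagonal entry of the gap is at least 1/L and the others are nonnegative, so its trace n -
t_x is at least 1/L = n - T. -/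
theorem mem_boundedParams_of_maxRowSumNorm_le (hn : 0 < n) (hdiag : ∀ j, Q j j = 1)
    {β : ℕ → Fin n → ℝ} {h : Fin n → ℝ} (hp : p ∈ csDomain Q)
    (hrow : maxRowSumNorm (Q - p.Φ.toFun p.tx)⁻¹ ≤ csL β h Q) :
    p ∈ boundedParams Q (csT β h Q) (csL β h Q) := by
  have hA := gap_posDef hp
  have hmax := (maxEntryNorm_le_maxRowSumNorm hn _).trans hrow
  refine (mem_boundedParams_iff (csT_le β h Q)).2 ⟨hp, le_max_of_le_right ?_, hmax⟩
  have h1 : 1 / csL β h Q ≤ (Q - p.Φ.toFun p.tx) ⟨0, hn⟩ ⟨0, hn⟩ :=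
    hA.inv_le_apply_self (csL_pos hn β h Q)
      ((le_abs_self _).trans ((abs_apply_le_maxEntryNorm _ _ _).trans hmax))
  have h2 := Finset.single_le_sum (f := fun i => (Q - p.Φ.toFun p.tx) i i)
    (fun i _ => hA.posSemidef.diag_nonneg) (Finset.mem_univ ⟨0, hn⟩)
  have h3 := p.trace_gap hdiag
  rw [Matrix.trace] at h3
  simp only [Matrix.diag_apply] at h3
  rw [csT_eq]
  linarith

/-- A minimizer over a sufficiently large bounded set satisfies the a priori bound. -/
theorem maxRowSumNorm_le_of_isMinOn (hn : 0 < n) {β : ℕ → Fin n → ℝ}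
    (hβ : ∀ j, Summable fun k : ℕ => (2 : ℝ) ^ (k + 2) * β (k + 2) j ^ 2)
    (hdiag : ∀ j, Q j j = 1) (h : Fin n → ℝ) (hQ : Q.PosDef) {K : ℝ}
    (hK : maxEntryNorm Q⁻¹ ≤ K) (hp : p ∈ boundedParams Q n K)
    (hmin : IsMinOn (crisantiSommers β h) (boundedParams Q n K) p) :
    maxRowSumNorm (Q - p.Φ.toFun p.tx)⁻¹ ≤ csL β h Q := by
  rw [mem_boundedParams_natCast_iff] at hp
  have h0 := p.sub_pathHat_posSemidef (t := 0) (Nat.cast_nonneg n)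
  rw [p.Φ.eq_start 0 le_rfl, sub_zero] at h0
  refine maxRowSumNorm_inv_le_csL hn (gap_posDef hp.1) (p.pathHat_sub_gap_posSemidef p.tx_mem.1)
    h0 hdiag ?_
  refine le_xi_of_isMinOn hn hβ hdiag h hp.1 (fun k => ?_) ?_
  · refine isMinOn_iff.1 hmin _ (mem_boundedParams_natCast_iff.2
      ⟨dilateSeq_mem_csDomain hp.1 k, ?_⟩)
    exact (maxEntryNorm_dilate_le hn hp.1 _ (dilation_nonneg k)).trans hp.2
  · refine isMinOn_iff.1 hmin _ (mem_boundedParams_natCast_iff.2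
      ⟨replicaSymmetric_mem_csDomain hQ, ?_⟩)
    rwa [gap_replicaSymmetric]

end OrderParam

theorem mainTheorem3 (n : ℕ) (hn : 1 ≤ n)
    (β : ℕ → Fin n → ℝ)
    (hβ : ∀ j, Summable fun k : ℕ => (2 : ℝ) ^ (k + 2) * β (k + 2) j ^ 2)
    (hodd : ∀ p, 2 ≤ p → Odd p → β p = 0)
    (h : Fin n → ℝ)
    (Q : Matrix (Fin n) (Fin n) ℝ) (hQ : Q.PosDef) (hdiag : ∀ j, Q j j = 1) :
    IsCompact (boundedParams Q (csT β h Q) (csL β h Q)) ∧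
    ∃ p ∈ boundedParams Q (csT β h Q) (csL β h Q),
      maxRowSumNorm (Q - p.Φ.toFun p.tx)⁻¹ ≤ csL β h Q ∧
      IsMinOn (crisantiSommers β h) (csDomain Q) p := by
  have hL := csL_pos hn β h Q
  refine ⟨OrderParam.isCompact_boundedParams hn (csT_le β h Q) hL, ?_⟩
  -- The second entry admits the point mass at 0 as a competitor; the first makes every order
  -- parameter obeying the a priori bound admissible.
  set K₀ := max (csL β h Q) (maxEntryNorm Q⁻¹) with hK₀
  have hmin : ∀ K, K₀ ≤ K → ∃ p ∈ boundedParams Q n K,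
      IsMinOn (crisantiSommers β h) (boundedParams Q n K) p ∧
      maxRowSumNorm (Q - p.Φ.toFun p.tx)⁻¹ ≤ csL β h Q := by
    intro K hK
    have hQK : maxEntryNorm Q⁻¹ ≤ K := (le_max_right _ _).trans hK
    have hne : (boundedParams Q n K).Nonempty := by
      refine ⟨(OrderParam.replicaSymmetric
        ⟨OverlapCDF.dirac n, MatrixPath.linear hn hQ.posSemidef hdiag⟩), ?_⟩
      rw [OrderParam.mem_boundedParams_natCast_iff, OrderParam.gap_replicaSymmetric]
      exact ⟨OrderParam.replicaSymmetric_mem_csDomain hQ, hQK⟩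
    obtain ⟨p, hp, hpmin⟩ := OrderParam.exists_isMinOn_boundedParams hn hβ hdiag h le_rfl
      (hL.trans_le ((le_max_left _ _).trans hK)) hne
    exact ⟨p, hp, hpmin, OrderParam.maxRowSumNorm_le_of_isMinOn hn hβ hdiag h hQ hQK hp hpmin⟩
  obtain ⟨p, hp, hpmin, hrow⟩ := hmin K₀ le_rfl
  refine ⟨p, OrderParam.mem_boundedParams_of_maxRowSumNorm_le hn hdiag hp.1 hrow, hrow,
    isMinOn_iff.2 fun q hq => ?_⟩
  set K := max K₀ (maxEntryNorm (Q - q.Φ.toFun q.tx)⁻¹)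
  obtain ⟨r, hr, hrmin, hrrow⟩ := hmin K (le_max_left _ _)
  have h1 : crisantiSommers β h r ≤ crisantiSommers β h q := isMinOn_iff.1 hrmin q
    (OrderParam.mem_boundedParams_natCast_iff.2 ⟨hq, le_max_right _ _⟩)
  have h2 : crisantiSommers β h p ≤ crisantiSommers β h r := isMinOn_iff.1 hpmin r
    (OrderParam.mem_boundedParams_natCast_iff.2 ⟨hr.1,
      (maxEntryNorm_le_maxRowSumNorm hn _).trans (hrrow.trans (le_max_left _ _))⟩)
  exact h2.trans h1
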